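/- Consider the following one-dimensional diffusion-limited aggregation model. Let $D>0$. At time $0$ there are $N(i,0)$ particles at each site $i\ge 1$ of $\mathbb{Z}$. The displacements of the particles are independent continuous-time simple symmetric random walks on $\mathbb{Z}$ with jump rate $D$, and they are independent of $\{N(i,0)\}_{i\ge1}$. All particles are white at time $0$; colours do not influence the paths. Put $\tau_0=0$ and, for $k\ge 0$, let $\tau_{k+1}$ be the first time $t>\tau_k$ at which some white particle jumps to the site $k$ ($\tau_{k+1}=\infty$ if there is no such time); at time $\tau_{k+1}$ all white particles which were at the site $k+1$ at time $\tau_{k+1}-$ (including the one that jumps) turn black, and they stay black for ever. Let $R(t)=k$ for $\tau_k\le t<\tau_{k+1}$, so that $\{0,1,\dots,R(t)\}$ is the aggregate at time $t$ (on the event that $\tau_k\le t$ for all $k$, put $R(t)=0$). Theorem. Assume that the $N(i,0)$, $i\ge 1$, are i.i.d. nonnegative-integer-valued random variables with finite and positive second moment, $0<E\{N(1,0)^2\}<\infty$. Then, for every $\varepsilon>0$, there exist an $\eta>0$ and a $t_0$ such that $$P\left\{\frac{R(t)}{\sqrt t}>\eta\right\}\ge 1-\varepsilon\qquad\text{for all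 } t\ge t_0 .$$ -/

import Mathlib

open MeasureTheory ProbabilityTheory Filter Topology
open scoped NNReal ENNReal

noncomputable section

namespace DLA

/-- The law of the displacement, over a time interval of length `u`, of the continuous-time simple
symmetric random walk on `ℤ` with jump rate `D`: the up-steps and the down-steps are independent
Poisson processes, each of rate `D / 2`. -/
def srwLaw (D u : ℝ≥0) : Measure ℤ :=
  ((poissonMeasure (D / 2 * u)).prod (poissonMeasure (D / 2 * u))).map
    (fun p : ℕ × ℕ => (p.1 : ℤ) - (p.2 : ℤ))

/-- `S` is a continuous-time simple symmetric random walk on `ℤ` with jump rate `D`, started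
at `0`: its paths are right continuous with left limits and have only jumps `+1` and `-1`, its
increments are independent, and they have the law `srwLaw`. -/
structure IsSimpleRandomWalk {Ω : Type*} [MeasurableSpace Ω] (P : Measure Ω) (D : ℝ≥0)
    (S : ℝ≥0 → Ω → ℤ) : Prop where
  measurable : ∀ t, Measurable (S t)
  start : ∀ ω, S 0 ω = 0
  rightContinuous : ∀ ω t, ContinuousWithinAt (fun s => S s ω) (Set.Ici t) t
  leftLimit : ∀ ω t, ∃ l : ℤ, Tendsto (fun s => S s ω) (𝓝[<] t) (𝓝 l)
  nearestNeighbour : ∀ ω t, ∀ᶠ s in 𝓝[<] t, |S t ω - S s ω| ≤ 1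
  indepIncrements : HasIndepIncrements S P
  law : ∀ s t, s ≤ t → HasLaw (fun ω => S t ω - S s ω) (srwLaw D (t - s)) P

/-- The path `x` is at the site `z` at time `t-`. -/
def AtLeft (x : ℝ≥0 → ℤ) (z : ℤ) (t : ℝ≥0) : Prop :=
  ∀ᶠ s in 𝓝[<] t, x s = z

/-- The path `x` jumps to the site `z` at time `t`. -/
def JumpsTo (x : ℝ≥0 → ℤ) (z : ℤ) (t : ℝ≥0) : Prop :=
  x t = z ∧ ∀ᶠ s in 𝓝[<] t, x s ≠ z

variable {ι : Type*}

/-- The first time after `τ` at which some particle of the set `W` jumps to the site `z`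
(`∞` if there is none), where the particle `ρ` follows the path `x ρ`. -/
def nextTime (x : ι → ℝ≥0 → ℤ) (W : Set ι) (z : ℤ) (τ : ℝ≥0∞) : ℝ≥0∞ :=
  sInf {t : ℝ≥0∞ | τ < t ∧ ∃ s : ℝ≥0, (s : ℝ≥0∞) = t ∧ ∃ ρ ∈ W, JumpsTo (x ρ) z s}

/-- The `k`-th growth time of the aggregate, together with the set of the particles that are still
white right after it, if the particles are those of the set `A`, all of them initially white, and
the particle `ρ` follows the path `x ρ`. Growth number `k + 1` happens when, after growth
number `k`, a white particle first jumps to the site `k`; then all the white particles that were at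
the site `k + 1` just before turn black. -/
def stage (x : ι → ℝ≥0 → ℤ) (A : Set ι) : ℕ → ℝ≥0∞ × Set ι
  | 0 => (0, A)
  | k + 1 =>
    let τ := (stage x A k).1
    let W := (stage x A k).2
    let τ' := nextTime x W (k : ℤ) τ
    (τ', W \ {ρ | ∃ s : ℝ≥0, (s : ℝ≥0∞) = τ' ∧ AtLeft (x ρ) ((k : ℤ) + 1) s})

/-- The growth times `τ_k` of the aggregate. -/
def growthTime (x : ι → ℝ≥0 → ℤ) (A : Set ι) (k : ℕ) : ℝ≥0∞ :=
  (stage x A k).1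

/-- The right end `R(t)` of the aggregate `{0, …, R(t)}`: the last `k` with `τ_k ≤ t`, that is,
`R(t) = k` for `τ_k ≤ t < τ_{k+1}`. If there have been infinitely many growth times up to time `t`
(explosion), the value is `0` by convention. -/
def rightEnd (x : ι → ℝ≥0 → ℤ) (A : Set ι) (t : ℝ≥0) : ℕ :=
  sSup {k : ℕ | growthTime x A k ≤ (t : ℝ≥0∞)}

/-- `R(t)` in the system that starts with `N i ω` particles at each site `i ≥ 1`. The particle with
the label `(i, j)` starts at `i`, is present if and only if `j < N i ω`, and has the displacement
`S (i, j) t ω` at time `t`. -/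
def R {Ω : Type*} (N : ℕ+ → Ω → ℕ) (S : ℕ+ × ℕ → ℝ≥0 → Ω → ℤ) (ω : Ω) (t : ℝ≥0) : ℕ :=
  rightEnd (fun (ρ : ℕ+ × ℕ) (s : ℝ≥0) => ((ρ.1 : ℕ) : ℤ) + S ρ s ω) {ρ | ρ.2 < N ρ.1 ω} t

end DLA

end

noncomputable section

namespace DLA

/-! Why the aggregate reaches order `√t`: a slow aggregate would have to absorb many particles
simultaneously, and simultaneous absorption is rare. Fix a time `T = r ^ 2` and `K = ⌊η * r⌋`, and
suppose that growth number `K + 1` comes after `T`. Consider one labelled particle at each of the `a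
* r` sites of `(a * r, 2 * a * r]`. By the central limit theorem each of them is present and at or
below `0` at time `T` with probability at least a constant `q`, so with high probability at least a
fixed multiple of `r` of them are there. A particle that gets to `0` must have turned black at one
of at most `K` growths. Since `K` is a small multiple of `r`, the pigeonhole principle
(`card_le_add_card_pairs`) gives at least a multiple of `r` ordered pairs that turn black together.

The expected number of such pairs is small. As long as two particles are white, removing them does
not change the growth times (`Good.stage_diff`). Hence a pair that turns black together stays above
the front of the system without the pair and then visits a common site next to it
(`Good.pair_meets`). That front is independent of the two walks, and its law is at most `4` times
the law of the full front (`IsSystem.measure_front_diff_le`), which does not depend on the pair. It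
remains to bound, for a deterministic monotone front `f ≤ K`, the sum over times and sites of the
square of the expected number of survivors that visit the site (`exists_sum_sq_le`).

This expected number is at most a constant, which settles the `O(K)` sites and times where the front
has recently moved. When the front has rested for a long time `L`, it is at most `δ`, because the
time-reversed walk would have to stay bounded above for a time `L` (`sum_surviveAt_le_reversed`,
`IsSimpleRandomWalk.exists_reversed_le`). Then one factor of the square is replaced by `δ`, and the
other is summed over time: each walk spends only a bounded expected time next to the front before it
is killed (`IsSimpleRandomWalk.sum_surviveVisit_front_le`). The total is `O(K) + O(δ r)`, up to a
constant depending on `L`. Choosing `δ` first, then `L`, then `η`, Markov's inequality concludes.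

Explosion, for which `R` is `0` by convention, is excluded almost surely by counting the particles
that move in a short time interval (`IsSystem.ae_exists_lt_growthTime`). -/

variable {ι : Type*}

/-! ### Regular paths and the first jump to a site -/

/-- A right continuous integer-valued path with left limits and jumps of size at most one. -/
structure RegularPath (x : ℝ≥0 → ℤ) : Prop where
  right : ∀ t, ∀ᶠ s in 𝓝[≥] t, x s = x t
  left : ∀ t, ∃ l : ℤ, AtLeft x l t
  step : ∀ t, ∀ᶠ s in 𝓝[<] t, |x t - x s| ≤ 1

/-- In `ℝ≥0` the filter `𝓝[<] 0` is trivial, so at time `0` a path is `AtLeft` every site. Hence the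
positivity hypotheses on times below. -/
lemma nhdsLT_neBot {t : ℝ≥0} (ht : 0 < t) : (𝓝[<] t).NeBot :=
  nhdsLT_neBot_of_exists_lt ⟨0, ht⟩

lemma AtLeft.unique {x : ℝ≥0 → ℤ} {t : ℝ≥0} (ht : 0 < t) {a b : ℤ} (ha : AtLeft x a t)
    (hb : AtLeft x b t) : a = b := by
  have := nhdsLT_neBot ht
  obtain ⟨s, h1, h2⟩ := (ha.and hb).exists
  exact h1.symm.trans h2

lemma RegularPath.abs_sub_le {x : ℝ≥0 → ℤ} (hx : RegularPath x) {t : ℝ≥0} (ht : 0 < t) {l : ℤ}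
    (hl : AtLeft x l t) : |x t - l| ≤ 1 := by
  have := nhdsLT_neBot ht
  obtain ⟨s, h1, h2⟩ := (hl.and (hx.step t)).exists
  exact h1 ▸ h2

lemma AtLeft.exists_mem {x : ℝ≥0 → ℤ} {t a : ℝ≥0} {l : ℤ} (hl : AtLeft x l t) (ha : a < t) :
    ∃ u, a < u ∧ u < t ∧ x u = l := by
  have := nhdsLT_neBot (pos_of_gt ha)
  have h2 : ∀ᶠ s in 𝓝[<] t, s ∈ Set.Ioo a t := Ioo_mem_nhdsLT ha
  obtain ⟨s, h1, h2⟩ := (hl.and h2).exists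
  exact ⟨s, h2.1, h2.2, h1⟩

lemma AtLeft.ge_of_forall {x : ℝ≥0 → ℤ} {t a : ℝ≥0} {l z : ℤ} (hl : AtLeft x l t) (ha : a < t)
    (h : ∀ u, a ≤ u → u < t → z ≤ x u) : z ≤ l := by
  obtain ⟨u, h1, h2, h3⟩ := hl.exists_mem ha
  exact h3 ▸ h u h1.le h2

lemma exists_coe_of_ne_top {t : ℝ≥0∞} (ht : t ≠ ⊤) : ∃ s : ℝ≥0, (s : ℝ≥0∞) = t :=
  ⟨t.toNNReal, ENNReal.coe_toNNReal ht⟩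

/-- A regular path cannot get below `z + 1` without jumping to `z`. -/
lemma RegularPath.exists_jumpsTo {x : ℝ≥0 → ℤ} (hx : RegularPath x) {a b : ℝ≥0} (hab : a ≤ b)
    {z : ℤ} (ha : z + 1 ≤ x a) (hb : x b ≤ z) : ∃ s, a < s ∧ s ≤ b ∧ JumpsTo x z s := by
  -- By right continuity the infimum of the times in `U` belongs to `U`. The left limit there is at
  -- least `z + 1`, and a jump of size at most one lands exactly on `z`.
  set U : Set ℝ≥0 := {u | a ≤ u ∧ x u ≤ z}
  have hU : U.Nonempty := ⟨b, hab, hb⟩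
  have hglb : IsGLB U (sInf U) := isGLB_csInf hU (OrderBot.bddBelow U)
  set s := sInf U
  have has : a ≤ s := hglb.2 fun u hu => hu.1
  obtain ⟨u, hu, hux⟩ := ((hglb.frequently_mem hU).and_eventually (hx.right s)).exists
  have hsz : x s ≤ z := hux ▸ hu.2
  have has' : a < s := by
    rcases has.lt_or_eq with h | h
    · exact h
    · rw [← h] at hsz; omega
  have hbefore : ∀ u, a ≤ u → u < s → z + 1 ≤ x u := by
    intro u hau hus
    by_contra! hlt
    exact absurd (hglb.1 (show u ∈ U from ⟨hau, by omega⟩)) (not_le.2 hus)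
  obtain ⟨l, hl⟩ := hx.left s
  have hlz := hl.ge_of_forall has' hbefore
  have h1 := abs_le.1 (hx.abs_sub_le (pos_of_gt has') hl)
  refine ⟨s, has', hglb.1 ⟨hab, hb⟩, by omega, hl.mono fun u hu => by omega⟩

/-- The deterministic regularity of a system of paths under which the growth of the aggregate is
well behaved. -/
structure Good (x : ι → ℝ≥0 → ℤ) (A : Set ι) : Prop where
  regular : ∀ ρ ∈ A, RegularPath (x ρ)
  start : ∀ ρ ∈ A, 1 ≤ x ρ 0
  finite : ∀ (z : ℤ) (T : ℝ≥0), {ρ | ρ ∈ A ∧ ∃ u ≤ T, x ρ u ≤ z}.Finite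
  noSimultaneous : ∀ ρ ∈ A, ∀ σ ∈ A, ρ ≠ σ → ∀ t, 0 < t →
    AtLeft (x ρ) (x ρ t) t ∨ AtLeft (x σ) (x σ t) t

lemma Good.mono {x : ι → ℝ≥0 → ℤ} {A B : Set ι} (h : Good x A) (hBA : B ⊆ A) : Good x B where
  regular ρ hρ := h.regular ρ (hBA hρ)
  start ρ hρ := h.start ρ (hBA hρ)
  finite z T := (h.finite z T).subset fun _ hρ => ⟨hBA hρ.1, hρ.2⟩
  noSimultaneous ρ hρ σ hσ := h.noSimultaneous ρ (hBA hρ) σ (hBA hσ)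

lemma nextTime_mono {x : ι → ℝ≥0 → ℤ} {V W : Set ι} (h : V ⊆ W) (z : ℤ) (τ : ℝ≥0∞) :
    nextTime x W z τ ≤ nextTime x V z τ :=
  sInf_le_sInf fun _ ⟨h1, s, hs, ρ, hρ, hj⟩ => ⟨h1, s, hs, ρ, h hρ, hj⟩

lemma nextTime_le {x : ι → ℝ≥0 → ℤ} {W : Set ι} {z : ℤ} {τ : ℝ≥0∞} {t : ℝ≥0} (h : τ < t) {ρ : ι}
    (hρ : ρ ∈ W) (hj : JumpsTo (x ρ) z t) : nextTime x W z τ ≤ t :=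
  sInf_le ⟨h, t, rfl, ρ, hρ, hj⟩

lemma le_nextTime (x : ι → ℝ≥0 → ℤ) (W : Set ι) (z : ℤ) (τ : ℝ≥0∞) : τ ≤ nextTime x W z τ :=
  le_sInf fun _ h => h.1.le

lemma Good.ge_of_lt_nextTime {x : ι → ℝ≥0 → ℤ} {W : Set ι} (h : Good x W) {z : ℤ} {s : ℝ≥0}
    (hs : ∀ ρ ∈ W, z + 1 ≤ x ρ s) {u : ℝ≥0} (hsu : s ≤ u) (hu : (u : ℝ≥0∞) < nextTime x W z s)
    {ρ : ι} (hρ : ρ ∈ W) : z + 1 ≤ x ρ u := by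
  by_contra! hlt
  obtain ⟨v, hv, hvu, hj⟩ := (h.regular ρ hρ).exists_jumpsTo hsu (hs ρ hρ) (by omega)
  have := nextTime_le (W := W) (ENNReal.coe_lt_coe.2 hv) hρ hj
  exact absurd (hu.trans_le this) (not_lt.2 (ENNReal.coe_le_coe.2 hvu))

/-- The infimum in `nextTime` is attained, by a particle that jumps from `z + 1` to `z`. -/
lemma Good.nextTime_attained {x : ι → ℝ≥0 → ℤ} {W : Set ι} (h : Good x W) {z : ℤ} {s : ℝ≥0}
    (hs : ∀ ρ ∈ W, z + 1 ≤ x ρ s) {t : ℝ≥0} (ht : nextTime x W z s = t) :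
    s < t ∧ ∃ ρ ∈ W, x ρ t = z ∧ AtLeft (x ρ) (z + 1) t := by
  set J : Set ℝ≥0 := {u | s < u ∧ ∃ ρ ∈ W, JumpsTo (x ρ) z u}
  have hJglb : IsGLB J t := by
    constructor
    · rintro u ⟨hu, ρ, hρ, hj⟩
      have := nextTime_le (W := W) (ENNReal.coe_lt_coe.2 hu) hρ hj
      rw [ht] at this
      exact ENNReal.coe_le_coe.1 this
    · intro b hb
      have : (b : ℝ≥0∞) ≤ nextTime x W z s := by
        refine le_sInf ?_
        rintro _ ⟨h1, u, rfl, ρ, hρ, hj⟩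
        exact ENNReal.coe_le_coe.2 (hb ⟨ENNReal.coe_lt_coe.1 h1, ρ, hρ, hj⟩)
      rw [ht] at this
      exact ENNReal.coe_le_coe.1 this
  have hJne : J.Nonempty := by
    by_contra hne
    rw [Set.not_nonempty_iff_eq_empty] at hne
    rw [hne] at hJglb
    have := hJglb.2 (show t + 1 ∈ lowerBounds (∅ : Set ℝ≥0) by simp)
    exact absurd this (not_le.2 (lt_add_one t))
  have hst : s ≤ t := hJglb.2 fun u hu => hu.1.le
  -- Only finitely many particles get to `z` by time `t + 1`, so they have a common right
  -- neighbourhood of `t` in which none of them moves. A jump time in it forces its jumper to be at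
  -- `z` already at time `t`.
  have hev : ∀ᶠ u in 𝓝[≥] t, ∀ ρ ∈ {ρ | ρ ∈ W ∧ ∃ u ≤ t + 1, x ρ u ≤ z}, x ρ u = x ρ t :=
    (eventually_all_finite (h.finite z (t + 1))).2 fun ρ hρ => (h.regular ρ hρ.1).right t
  have hev2 : ∀ᶠ u in 𝓝[≥] t, u ≤ t + 1 :=
    mem_nhdsWithin_of_mem_nhds (Iic_mem_nhds (lt_add_one t))
  obtain ⟨u, ⟨-, ρ, hρ, hj⟩, h2, h3⟩ :=
    ((hJglb.frequently_mem hJne).and_eventually (hev.and hev2)).exists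
  have hxt : x ρ t = z := by
    rw [← h2 ρ ⟨hρ, u, h3, hj.1.le⟩, hj.1]
  have hst' : s < t := by
    rcases hst.lt_or_eq with h' | h'
    · exact h'
    · have := hs ρ hρ
      rw [h'] at this; omega
  refine ⟨hst', ρ, hρ, hxt, ?_⟩
  obtain ⟨l, hl⟩ := (h.regular ρ hρ).left t
  have hlz : z + 1 ≤ l := hl.ge_of_forall hst' fun u hu hut =>
    h.ge_of_lt_nextTime hs hu (by rw [ht]; exact ENNReal.coe_lt_coe.2 hut) hρ
  have h1 := abs_le.1 ((h.regular ρ hρ).abs_sub_le (pos_of_gt hst') hl)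
  have : l = z + 1 := by omega
  exact this ▸ hl

/-- The particle is at least at `z + 2` just before `t`, and it cannot move at `t` because the
jumper does. This excludes a particle stepping from `z + 2` to `z + 1` at the instant of growth,
which would stay white on a site of the new aggregate. -/
lemma Good.ge_at_nextTime {x : ι → ℝ≥0 → ℤ} {W : Set ι} (h : Good x W) {z : ℤ} {s : ℝ≥0}
    (hs : ∀ ρ ∈ W, z + 1 ≤ x ρ s) {t : ℝ≥0} (ht : nextTime x W z s = t) {ρ : ι} (hρ : ρ ∈ W)
    (hn : ¬ AtLeft (x ρ) (z + 1) t) : z + 2 ≤ x ρ t := by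
  obtain ⟨hst, σ, hσ, hσt, hσl⟩ := h.nextTime_attained hs ht
  have ht0 := pos_of_gt hst
  obtain ⟨l, hl⟩ := (h.regular ρ hρ).left t
  have hlz : z + 1 ≤ l := hl.ge_of_forall hst fun u hu hut =>
    h.ge_of_lt_nextTime hs hu (by rw [ht]; exact ENNReal.coe_lt_coe.2 hut) hρ
  have hlne : l ≠ z + 1 := fun e => hn (e ▸ hl)
  have h1 := abs_le.1 ((h.regular ρ hρ).abs_sub_le ht0 hl)
  have hne : ρ ≠ σ := fun e => hn (e ▸ hσl)
  rcases h.noSimultaneous ρ hρ σ hσ hne t ht0 with h2 | h2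
  · have := hl.unique ht0 h2; omega
  · have := hσl.unique ht0 h2; omega

/-! ### The stages of the growth -/

/-- The particles that are still white right after growth number `k`. -/
def white (x : ι → ℝ≥0 → ℤ) (A : Set ι) (k : ℕ) : Set ι := (stage x A k).2

lemma growthTime_zero (x : ι → ℝ≥0 → ℤ) (A : Set ι) : growthTime x A 0 = 0 := rfl

lemma growthTime_succ (x : ι → ℝ≥0 → ℤ) (A : Set ι) (k : ℕ) :
    growthTime x A (k + 1) = nextTime x (white x A k) k (growthTime x A k) := rfl

lemma white_succ (x : ι → ℝ≥0 → ℤ) (A : Set ι) (k : ℕ) :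
    white x A (k + 1) = white x A k \
      {ρ | ∃ s : ℝ≥0, (s : ℝ≥0∞) = growthTime x A (k + 1) ∧ AtLeft (x ρ) ((k : ℤ) + 1) s} := rfl

lemma white_antitone (x : ι → ℝ≥0 → ℤ) (A : Set ι) : Antitone (white x A) :=
  antitone_nat_of_succ_le fun k => by rw [white_succ]; exact Set.sdiff_subset

lemma white_subset (x : ι → ℝ≥0 → ℤ) (A : Set ι) (k : ℕ) : white x A k ⊆ A :=
  white_antitone x A (Nat.zero_le k)

lemma growthTime_mono (x : ι → ℝ≥0 → ℤ) (A : Set ι) : Monotone (growthTime x A) :=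
  monotone_nat_of_le_succ fun k => by rw [growthTime_succ]; exact le_nextTime _ _ _ _

section Good

variable {x : ι → ℝ≥0 → ℤ} {A : Set ι}

lemma Good.white_good (h : Good x A) (k : ℕ) : Good x (white x A k) :=
  h.mono (white_subset x A k)

/-- The invariant of the growth: the particles at `k + 1` just before the growth turn black, and the
others are beyond that site by `Good.ge_at_nextTime`. -/
lemma Good.white_ge_at (h : Good x A) (k : ℕ) : ∀ s : ℝ≥0, growthTime x A k = s →
    ∀ ρ ∈ white x A k, (k : ℤ) + 1 ≤ x ρ s := by
  induction k with
  | zero =>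
    intro s hs ρ hρ
    rw [growthTime_zero] at hs
    have : s = 0 := by exact_mod_cast hs.symm
    subst this
    simpa using h.start ρ hρ
  | succ k ih =>
    intro t ht ρ hρ
    have hle : growthTime x A k ≤ t := ht ▸ growthTime_mono x A (Nat.le_succ k)
    obtain ⟨s, hs⟩ := exists_coe_of_ne_top (ne_top_of_le_ne_top ENNReal.coe_ne_top hle)
    have hW := ih s hs.symm
    have ht' : nextTime x (white x A k) k s = t := by rw [hs, ← growthTime_succ, ht]
    rw [white_succ] at hρ
    have := (h.white_good k).ge_at_nextTime hW ht' hρ.1 fun hl => hρ.2 ⟨t, ht.symm, hl⟩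
    push_cast; omega

lemma Good.jumper (h : Good x A) {k : ℕ} {t : ℝ≥0} (ht : growthTime x A (k + 1) = t) :
    growthTime x A k < t ∧
      ∃ ρ ∈ white x A k, x ρ t = k ∧ AtLeft (x ρ) ((k : ℤ) + 1) t := by
  have hle : growthTime x A k ≤ t := ht ▸ growthTime_mono x A (Nat.le_succ k)
  obtain ⟨s, hs⟩ := exists_coe_of_ne_top (ne_top_of_le_ne_top ENNReal.coe_ne_top hle)
  have ht' : nextTime x (white x A k) k s = t := by rw [hs, ← growthTime_succ, ht]
  rw [← hs, ENNReal.coe_lt_coe]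
  exact (h.white_good k).nextTime_attained (h.white_ge_at k s hs.symm) ht'

lemma Good.white_ge_of_lt_succ (h : Good x A) {k : ℕ} {u : ℝ≥0} (h1 : growthTime x A k ≤ u)
    (h2 : (u : ℝ≥0∞) < growthTime x A (k + 1)) {ρ : ι} (hρ : ρ ∈ white x A k) :
    (k : ℤ) + 1 ≤ x ρ u := by
  obtain ⟨s, hs⟩ := exists_coe_of_ne_top (ne_top_of_le_ne_top ENNReal.coe_ne_top h1)
  rw [← hs] at h1
  rw [growthTime_succ, ← hs] at h2
  exact (h.white_good k).ge_of_lt_nextTime (h.white_ge_at k s hs.symm) (ENNReal.coe_le_coe.1 h1)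
    h2 hρ

/-- A particle that is white after growth `k` was white after all earlier growths, so between two
consecutive growths it obeys the bound of that stage, which is at least the bound of stage `l`. -/
lemma Good.white_ge (h : Good x A) {k l : ℕ} (hlk : l ≤ k) {u : ℝ≥0} (h1 : growthTime x A l ≤ u)
    (h2 : (u : ℝ≥0∞) < growthTime x A (k + 1)) {ρ : ι} (hρ : ρ ∈ white x A k) :
    (l : ℤ) + 1 ≤ x ρ u := by
  induction k, hlk using Nat.le_induction with
  | base => exact h.white_ge_of_lt_succ h1 h2 hρ
  | succ k hlk ih =>
    rcases le_or_gt (growthTime x A (k + 1)) u with h3 | h3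
    · have := h.white_ge_of_lt_succ h3 h2 hρ
      push_cast at this; omega
    · exact ih h3 (white_antitone x A (Nat.le_succ k) hρ)

lemma exists_atLeft_of_not_mem_white {ρ : ι} (hρ : ρ ∈ A) {k : ℕ} (hk : ρ ∉ white x A k) :
    ∃ j < k, ρ ∈ white x A j ∧ ρ ∉ white x A (j + 1) := by
  induction k with
  | zero => exact absurd hρ hk
  | succ k ih =>
    by_cases h : ρ ∈ white x A k
    · exact ⟨k, Nat.lt_succ_self k, h, hk⟩
    · obtain ⟨j, hj, h'⟩ := ih h
      exact ⟨j, by omega, h'⟩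

lemma atLeft_of_turns_black {ρ : ι} {k : ℕ} (h1 : ρ ∈ white x A k) (h2 : ρ ∉ white x A (k + 1)) :
    ∃ s : ℝ≥0, (s : ℝ≥0∞) = growthTime x A (k + 1) ∧ AtLeft (x ρ) ((k : ℤ) + 1) s := by
  rw [white_succ] at h2
  by_contra h
  exact h2 ⟨h1, h⟩

/-- A particle that gets to `0` is absorbed by the aggregate before. -/
lemma Good.exists_turns_black (h : Good x A) {ρ : ι} (hρ : ρ ∈ A) {u T : ℝ≥0} (huT : u ≤ T)
    (hu : x ρ u ≤ 0) {K : ℕ} (hK : (T : ℝ≥0∞) < growthTime x A (K + 1)) :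
    ∃ k < K, ρ ∈ white x A k ∧ ρ ∉ white x A (k + 1) ∧ growthTime x A (k + 1) ≤ T := by
  classical
  -- The last growth up to time `T`; the cap `K` is harmless because growth `K + 1` comes after `T`.
  -- A particle that is white after growth `m` is at least at `1` at all times up to `T`.
  set m := Nat.findGreatest (fun k => growthTime x A k ≤ T) K
  have hm : growthTime x A m ≤ T :=
    Nat.findGreatest_spec (P := fun k => growthTime x A k ≤ T) (Nat.zero_le K)
      (by rw [growthTime_zero]; exact zero_le)
  have hmK : m ≤ K := Nat.findGreatest_le K
  have hm' : (T : ℝ≥0∞) < growthTime x A (m + 1) := by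
    rcases hmK.lt_or_eq with h' | h'
    · exact not_le.1 (Nat.findGreatest_is_greatest (P := fun k => growthTime x A k ≤ T)
        (Nat.lt_succ_self m) h')
    · rwa [h']
  have hρm : ρ ∉ white x A m := by
    intro hmem
    have := h.white_ge (Nat.zero_le m) (by rw [growthTime_zero]; exact zero_le)
      ((ENNReal.coe_le_coe.2 huT).trans_lt hm') hmem
    push_cast at this; omega
  obtain ⟨j, hj, h1, h2⟩ := exists_atLeft_of_not_mem_white hρ hρm
  exact ⟨j, by omega, h1, h2, (growthTime_mono x A hj).trans hm⟩

/-- Removing particles that are still white after growth number `k` does not change the first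
`k` growth times. -/
lemma Good.stage_diff (h : Good x A) {k : ℕ} {B : Set ι} (hB : B ⊆ white x A k) {m : ℕ}
    (hm : m ≤ k) :
    growthTime x (A \ B) m = growthTime x A m ∧ white x (A \ B) m = white x A m \ B := by
  induction m with
  | zero => exact ⟨rfl, rfl⟩
  | succ m ih =>
    obtain ⟨h1, h2⟩ := ih (by omega)
    have key : growthTime x (A \ B) (m + 1) = growthTime x A (m + 1) := by
      rw [growthTime_succ, h1, h2]
      refine le_antisymm ?_ (by rw [growthTime_succ]; exact nextTime_mono Set.sdiff_subset _ _)
      rcases eq_or_ne (growthTime x A (m + 1)) ⊤ with htop | htop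
      · rw [htop]; exact le_top
      obtain ⟨t, ht⟩ := exists_coe_of_ne_top htop
      obtain ⟨hlt, ρ, hρ, hxt, hl⟩ := h.jumper ht.symm
      rw [← ht]
      -- The jumper is at `m + 1` just before growth `m + 1`, so it turns black then. The particles
      -- of `B` are still white, so the jumper is not removed with `B` and causes the same growth.
      refine nextTime_le hlt (ρ := ρ) ⟨hρ, fun hρB => ?_⟩ ⟨hxt, hl.mono fun u hu => by omega⟩
      have := white_antitone x A hm (hB hρB)
      rw [white_succ] at this
      exact this.2 ⟨t, ht, hl⟩
    refine ⟨key, ?_⟩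
    rw [white_succ, white_succ, key, h2, Set.sdiff_sdiff_comm]

/-- Here the jumper may belong to `B`, so growth `k + 1` can be delayed by the removal, but not
advanced. -/
lemma Good.growthTime_succ_le_diff (h : Good x A) {k : ℕ} {B : Set ι} (hB : B ⊆ white x A k) :
    growthTime x A (k + 1) ≤ growthTime x (A \ B) (k + 1) := by
  obtain ⟨h1, h2⟩ := h.stage_diff hB le_rfl
  rw [growthTime_succ, growthTime_succ, h1, h2]
  exact nextTime_mono Set.sdiff_subset _ _

end Good

/-! ### The front at integer times -/

/-- The number of the times `τ 1, …, τ K` that are at most `n`. -/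
def frontCount (τ : ℕ → ℝ≥0∞) (K n : ℕ) : ℕ := by
  classical exact ((Finset.Icc 1 K).filter fun m => τ m ≤ (n : ℝ≥0∞)).card

lemma frontCount_le (τ : ℕ → ℝ≥0∞) (K n : ℕ) : frontCount τ K n ≤ K := by
  classical
  exact (Finset.card_filter_le _ _).trans (by simp)

lemma frontCount_mono (τ : ℕ → ℝ≥0∞) (K : ℕ) : Monotone (frontCount τ K) := by
  classical
  intro a b hab
  refine Finset.card_le_card fun m hm => ?_
  rw [Finset.mem_filter] at hm ⊢
  exact ⟨hm.1, hm.2.trans (by exact_mod_cast hab)⟩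

/-- For a monotone `τ` the count is the generalised inverse of `τ`, capped at `K`; this lemma and
the next three are its order relations with `τ`. -/
lemma le_frontCount {τ : ℕ → ℝ≥0∞} (hτ : Monotone τ) {K l n : ℕ} (hlK : l ≤ K)
    (h : τ l ≤ (n : ℝ≥0∞)) : l ≤ frontCount τ K n := by
  classical
  have : Finset.Icc 1 l ⊆ (Finset.Icc 1 K).filter fun m => τ m ≤ (n : ℝ≥0∞) := by
    intro m hm
    rw [Finset.mem_Icc] at hm
    rw [Finset.mem_filter, Finset.mem_Icc]
    exact ⟨⟨hm.1, hm.2.trans hlK⟩, (hτ hm.2).trans h⟩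
  simpa [frontCount] using Finset.card_le_card this

lemma frontCount_le_of_lt {τ : ℕ → ℝ≥0∞} (hτ : Monotone τ) {K l n : ℕ}
    (h : (n : ℝ≥0∞) < τ (l + 1)) : frontCount τ K n ≤ l := by
  classical
  have : ((Finset.Icc 1 K).filter fun m => τ m ≤ (n : ℝ≥0∞)) ⊆ Finset.Icc 1 l := by
    intro m hm
    rw [Finset.mem_filter, Finset.mem_Icc] at hm
    rw [Finset.mem_Icc]
    refine ⟨hm.1.1, ?_⟩
    by_contra! hlt
    exact absurd (h.trans_le ((hτ hlt).trans hm.2)) (lt_irrefl _)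
  simpa [frontCount] using Finset.card_le_card this

lemma apply_frontCount_le {τ : ℕ → ℝ≥0∞} (hτ : Monotone τ) (h0 : τ 0 = 0) {K n : ℕ} :
    τ (frontCount τ K n) ≤ (n : ℝ≥0∞) := by
  by_contra! hlt
  rcases Nat.eq_zero_or_pos (frontCount τ K n) with h | h
  · rw [h, h0] at hlt
    exact absurd hlt (not_lt.2 zero_le)
  · obtain ⟨l, hl⟩ := Nat.exists_eq_add_of_lt h
    have hl' : frontCount τ K n = l + 1 := by omega
    rw [hl'] at hlt
    have := frontCount_le_of_lt hτ (K := K) hlt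
    omega

lemma lt_apply_frontCount_succ {τ : ℕ → ℝ≥0∞} (hτ : Monotone τ) {K n : ℕ}
    (h : frontCount τ K n < K) : (n : ℝ≥0∞) < τ (frontCount τ K n + 1) := by
  by_contra! hle
  have := le_frontCount hτ (show frontCount τ K n + 1 ≤ K from h) hle
  omega

/-- The event that a path stays above the front `f` at the integer times up to `n`. -/
def Survives (f : ℕ → ℕ) (y : ℝ≥0 → ℤ) (n : ℕ) : Prop := ∀ m ≤ n, (f m : ℤ) < y (m : ℝ≥0)

/-- The event that a path is at `z` at some time in `[n, n + 1]`. -/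
def Visits (y : ℝ≥0 → ℤ) (n : ℕ) (z : ℤ) : Prop :=
  ∃ u : ℝ≥0, (n : ℝ≥0) ≤ u ∧ u ≤ n + 1 ∧ y u = z

/-! ### Removing particles from the system -/

section Pair

variable {x : ι → ℝ≥0 → ℤ} {A : Set ι}

/-- Before growth `k + 1` the front without `B` has made at most `k` moves, and these happen at the
same times as in the full system. So it never passes the full front, which the white particles of
`B` stay above. -/
lemma Good.survives_visits (h : Good x A) {k n K : ℕ} {B : Set ι} (hB : B ⊆ white x A k)
    (hn : (n : ℝ≥0∞) < growthTime x A (k + 1)) {s : ℝ≥0}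
    (hs : (s : ℝ≥0∞) = growthTime x A (k + 1)) (hsn : s ≤ n + 1) {ρ : ι} (hρB : ρ ∈ B)
    (hl : AtLeft (x ρ) ((k : ℤ) + 1) s) :
    Survives (frontCount (growthTime x (A \ B)) K) (x ρ) n ∧ Visits (x ρ) n ((k : ℤ) + 1) := by
  have hτ := growthTime_mono x (A \ B)
  constructor
  · intro m hm
    have hmn : (m : ℝ≥0∞) < growthTime x A (k + 1) :=
      (show (m : ℝ≥0∞) ≤ n by exact_mod_cast hm).trans_lt hn
    set l := frontCount (growthTime x (A \ B)) K m
    have hlk : l ≤ k :=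
      frontCount_le_of_lt hτ (hmn.trans_le (h.growthTime_succ_le_diff hB))
    have hlm : growthTime x (A \ B) l ≤ (m : ℝ≥0∞) := apply_frontCount_le hτ rfl
    rw [(h.stage_diff hB hlk).1] at hlm
    have := h.white_ge hlk (u := (m : ℝ≥0)) (by simpa using hlm) (by simpa using hmn) (hB hρB)
    omega
  · rw [← hs] at hn
    have hns : (n : ℝ≥0) < s := by exact_mod_cast hn
    obtain ⟨u, h1, h2, h3⟩ := hl.exists_mem hns
    exact ⟨u, h1.le, h2.le.trans hsn, h3⟩

/-- Two particles that turn black together survive, up to the integer time before, the front of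
the system without these two particles, and then meet at a site which that front leaves or is
about to reach. -/
lemma Good.pair_meets (h : Good x A) {k K T : ℕ} (hkK : k < K) {ρ σ : ι}
    (hρ : ρ ∈ white x A k) (hρ' : ρ ∉ white x A (k + 1))
    (hσ : σ ∈ white x A k) (hσ' : σ ∉ white x A (k + 1))
    (hT : growthTime x A (k + 1) ≤ (T : ℝ≥0∞)) {f : ℕ → ℕ}
    (hf : f = frontCount (growthTime x (A \ {ρ, σ})) K) :
    ∃ n < T, ∃ z, f n < z ∧ z ≤ f (n + 1) + 1 ∧ z ≤ K ∧
      (Survives f (x ρ) n ∧ Visits (x ρ) n z) ∧ (Survives f (x σ) n ∧ Visits (x σ) n z) := by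
  have hB : ({ρ, σ} : Set ι) ⊆ white x A k := by
    rintro _ (rfl | rfl)
    exacts [hρ, hσ]
  obtain ⟨s, hs, hl⟩ := atLeft_of_turns_black hρ hρ'
  obtain ⟨s', hs', hl'⟩ := atLeft_of_turns_black hσ hσ'
  have hss : s' = s := by
    have : (s' : ℝ≥0∞) = s := hs'.trans hs.symm
    exact_mod_cast this
  subst hss
  have hs0 : 0 < s' := by
    have := (h.jumper hs.symm).1
    exact_mod_cast pos_of_gt this
  -- The integer with `n < s' ≤ n + 1`, where `s'` is the common time of turning black.
  obtain ⟨n, hn⟩ : ∃ n, ⌈s'⌉₊ = n + 1 := Nat.exists_eq_succ_of_ne_zero (Nat.ceil_pos.2 hs0).ne'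
  have hns : (n : ℝ≥0) < s' := Nat.lt_ceil.1 (by omega)
  have hsn : s' ≤ n + 1 := by
    have := Nat.le_ceil s'
    rw [hn] at this
    exact_mod_cast this
  have hn' : (n : ℝ≥0∞) < growthTime x A (k + 1) := by
    rw [← hs]; exact_mod_cast hns
  have hτ := growthTime_mono x (A \ {ρ, σ})
  have hsT : s' ≤ T := by
    rw [← hs] at hT; exact_mod_cast hT
  have hnT : n < T := by
    have : ⌈s'⌉₊ ≤ T := Nat.ceil_le.2 hsT
    omega
  have e1 := h.survives_visits (K := K) hB hn' hs hsn (by simp) hl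
  have e2 := h.survives_visits (K := K) hB hn' hs hsn (by simp) hl'
  refine ⟨n, hnT, k + 1, ?_, ?_, hkK, ?_, ?_⟩
  · have := frontCount_le_of_lt hτ (K := K) (hn'.trans_le (h.growthTime_succ_le_diff hB))
    rw [hf]; omega
  -- Growth `k` happens by time `n + 1` also without the pair, but growth `k + 1` may need one of
  -- the two particles. Hence the extra `+ 1` in the range of `z`.
  · have : k ≤ f (n + 1) := by
      rw [hf]
      refine le_frontCount hτ hkK.le ?_
      rw [(h.stage_diff hB le_rfl).1]
      refine (growthTime_mono x A (Nat.le_succ k)).trans ?_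
      rw [← hs]
      exact_mod_cast hsn
    omega
  · rw [hf]; exact_mod_cast e1
  · rw [hf]; exact_mod_cast e2

/-- Removing particles that stay away from the sites up to `K` does not change the front. -/
lemma Good.frontCount_diff (h : Good x A) {B : Set ι} (hBA : B ⊆ A) {K T : ℕ}
    (hB : ∀ ρ ∈ B, ∀ u : ℝ≥0, u ≤ T → (K : ℤ) < x ρ u) {n : ℕ} (hn : n ≤ T) :
    frontCount (growthTime x (A \ B)) K n = frontCount (growthTime x A) K n := by
  have hτ := growthTime_mono x A
  set k := frontCount (growthTime x A) K n with hk
  have hkK : k ≤ K := frontCount_le _ _ _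
  have hkn : growthTime x A k ≤ (n : ℝ≥0∞) := apply_frontCount_le hτ rfl
  -- A particle turning black at one of the first `k ≤ K` growths has been at a site not exceeding
  -- `K`, which the particles of `B` avoid.
  have hBW : B ⊆ white x A k := by
    intro ρ hρ
    by_contra hnot
    obtain ⟨j, hj, h1, h2⟩ := exists_atLeft_of_not_mem_white (hBA hρ) hnot
    obtain ⟨s, hs, hl⟩ := atLeft_of_turns_black h1 h2
    have hs0 : 0 < s := by
      have := (h.jumper hs.symm).1
      exact_mod_cast pos_of_gt this
    have hsn : s ≤ n := by
      have := (hτ hj).trans hkn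
      rw [← Nat.succ_eq_add_one] at hs
      rw [← hs] at this
      exact_mod_cast this
    obtain ⟨u, -, hu, hxu⟩ := hl.exists_mem hs0
    have := hB ρ hρ u (hu.le.trans (hsn.trans (by exact_mod_cast hn)))
    omega
  apply le_antisymm
  · rcases hkK.lt_or_eq with hlt | heq
    · refine frontCount_le_of_lt (growthTime_mono _ _) ?_
      exact (lt_apply_frontCount_succ hτ hlt).trans_le (h.growthTime_succ_le_diff hBW)
    · rw [heq]; exact frontCount_le _ _ _
  · refine le_frontCount (growthTime_mono _ _) hkK ?_
    rw [(h.stage_diff hBW le_rfl).1]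
    exact hkn

end Pair

/-- If there are infinitely many growth times up to time `T`, then they have different jumpers. -/
lemma Good.jumpers {x : ι → ℝ≥0 → ℤ} {A : Set ι} (h : Good x A) {T : ℝ≥0}
    (hT : ∀ k, growthTime x A k ≤ T) :
    ∃ (ρ : ℕ → ι) (t : ℕ → ℝ≥0), Function.Injective ρ ∧ Monotone t ∧ ∀ k, ρ k ∈ A ∧ 0 < t k ∧
      t k ≤ T ∧ x (ρ k) (t k) = k ∧ AtLeft (x (ρ k)) ((k : ℤ) + 1) (t k) := by
  have ht : ∀ k, ∃ t : ℝ≥0, (t : ℝ≥0∞) = growthTime x A (k + 1) := fun k =>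
    exists_coe_of_ne_top (ne_top_of_le_ne_top ENNReal.coe_ne_top (hT (k + 1)))
  choose t ht using ht
  have hρ := fun k => (h.jumper (ht k).symm).2
  choose ρ hρ hx hl using hρ
  refine ⟨ρ, t, ?_, ?_, fun k => ⟨white_subset x A k (hρ k), ?_, ?_, hx k, hl k⟩⟩
  · have hb : ∀ k, ρ k ∉ white x A (k + 1) := by
      intro k hk
      rw [white_succ] at hk
      exact hk.2 ⟨t k, ht k, hl k⟩
    have : ∀ a b, a < b → ρ a ≠ ρ b := fun a b hab e =>
      hb a (white_antitone x A hab (e ▸ hρ b))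
    intro a b e
    by_contra hne
    rcases lt_or_gt_of_ne hne with h' | h'
    exacts [this a b h' e, this b a h' e.symm]
  · intro a b hab
    have := growthTime_mono x A (Nat.succ_le_succ hab)
    rw [Nat.succ_eq_add_one, Nat.succ_eq_add_one, ← ht, ← ht] at this
    exact_mod_cast this
  · have := (h.jumper (ht k).symm).1
    exact_mod_cast pos_of_gt this
  · have := hT (k + 1)
    rw [← ht] at this
    exact_mod_cast this

/-! ### The growth as a function of the paths at rational times -/

variable {ι : Type*}

/-- A countable dense set of times, indexed by the rational numbers. -/
def ratTime (q : ℚ) : ℝ≥0 := Real.toNNReal q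

lemma exists_ratTime_btwn {a b : ℝ≥0} (h : a < b) : ∃ q : ℚ, a < ratTime q ∧ ratTime q < b := by
  obtain ⟨q, -, h1, h2⟩ := (NNReal.lt_iff_exists_rat_btwn a b).1 h
  exact ⟨q, h1, h2⟩

/-- The first time after `τ` at which a particle of `W` is at most at `z`, computed from the
rational times only. -/
def hitTime (x : ι → ℝ≥0 → ℤ) (W : Set ι) (z : ℤ) (τ : ℝ≥0∞) : ℝ≥0∞ :=
  ⨅ (q : ℚ) (ρ : ι) (_ : ρ ∈ W ∧ τ < ratTime q ∧ x ρ (ratTime q) ≤ z), (ratTime q : ℝ≥0∞)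

/-- The path `y` is at `z` at the rational times just before `τ`. -/
def RatAtLeft (y : ℝ≥0 → ℤ) (z : ℤ) (τ : ℝ≥0∞) : Prop :=
  ∃ q : ℚ, (ratTime q : ℝ≥0∞) < τ ∧
    ∀ r : ℚ, ratTime q < ratTime r → (ratTime r : ℝ≥0∞) < τ → y (ratTime r) = z

/-- The stages of the growth, computed from the rational times only. -/
def ratStage (x : ι → ℝ≥0 → ℤ) (A : Set ι) : ℕ → ℝ≥0∞ × Set ι
  | 0 => (0, A)
  | k + 1 =>
    (hitTime x (ratStage x A k).2 (k : ℤ) (ratStage x A k).1,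
      (ratStage x A k).2 \ {ρ | hitTime x (ratStage x A k).2 (k : ℤ) (ratStage x A k).1 ≠ ⊤ ∧
        RatAtLeft (x ρ) ((k : ℤ) + 1) (hitTime x (ratStage x A k).2 (k : ℤ) (ratStage x A k).1)})

lemma RegularPath.ratAtLeft_iff {y : ℝ≥0 → ℤ} (hy : RegularPath y) {s : ℝ≥0} (hs : 0 < s) (z : ℤ) :
    RatAtLeft y z s ↔ AtLeft y z s := by
  constructor
  · rintro ⟨q, hq, h⟩
    rw [ENNReal.coe_lt_coe] at hq
    obtain ⟨l, hl⟩ := hy.left s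
    obtain ⟨a, ha, hal⟩ := (mem_nhdsLT_iff_exists_Ioo_subset' hs).1 hl
    obtain ⟨r, hr1, hr2⟩ := exists_ratTime_btwn (max_lt ha hq)
    have h1 := h r ((le_max_right _ _).trans_lt hr1) (ENNReal.coe_lt_coe.2 hr2)
    have h2 : y (ratTime r) = l := hal ⟨(le_max_left _ _).trans_lt hr1, hr2⟩
    rw [← h1, h2]
    exact hl
  · intro hl
    obtain ⟨a, ha, hal⟩ := (mem_nhdsLT_iff_exists_Ioo_subset' hs).1 hl
    obtain ⟨q, hq1, hq2⟩ := exists_ratTime_btwn ha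
    exact ⟨q, ENNReal.coe_lt_coe.2 hq2, fun r hr1 hr2 =>
      hal ⟨hq1.trans hr1, ENNReal.coe_lt_coe.1 hr2⟩⟩

/-- All particles of `W` are above `z` at time `τ`, so being at or below `z` later requires a jump
to `z` in between. Conversely, by right continuity a jump to `z` is seen at rational times
arbitrarily soon after it. -/
lemma Good.hitTime_eq {x : ι → ℝ≥0 → ℤ} {W : Set ι} (h : Good x W) {z : ℤ} {τ : ℝ≥0∞}
    (hτ : ∀ s : ℝ≥0, τ = s → ∀ ρ ∈ W, z + 1 ≤ x ρ s) : hitTime x W z τ = nextTime x W z τ := by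
  apply le_antisymm
  · refine le_sInf ?_
    rintro _ ⟨h1, u, rfl, ρ, hρ, hj⟩
    refine le_of_forall_gt fun b hb => ?_
    obtain ⟨c, hc1, hc2⟩ := ENNReal.lt_iff_exists_nnreal_btwn.1 hb
    rw [ENNReal.coe_lt_coe] at hc1
    obtain ⟨d, hd, hdx⟩ := (mem_nhdsGE_iff_exists_Ico_subset' hc1).1 ((h.regular ρ hρ).right u)
    have hd' : u < d := hd
    obtain ⟨q, hq1, hq2⟩ := exists_ratTime_btwn (lt_min hd' hc1)
    have hxq : x ρ (ratTime q) = x ρ u := hdx ⟨hq1.le, hq2.trans_le (min_le_left _ _)⟩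
    refine (iInf_le_of_le q (iInf_le_of_le ρ (iInf_le_of_le ⟨hρ, ?_, ?_⟩ le_rfl))).trans_lt
      ((ENNReal.coe_lt_coe.2 (hq2.trans_le (min_le_right _ _))).trans hc2)
    · exact h1.trans (ENNReal.coe_lt_coe.2 hq1)
    · rw [hxq, hj.1]
  · refine le_iInf fun q => le_iInf fun ρ => le_iInf fun ⟨hρ, h1, h2⟩ => ?_
    obtain ⟨s, rfl⟩ := exists_coe_of_ne_top h1.ne_top
    rw [ENNReal.coe_lt_coe] at h1
    obtain ⟨v, hv, hvu, hj⟩ := (h.regular ρ hρ).exists_jumpsTo h1.le (hτ s rfl ρ hρ) h2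
    exact (nextTime_le (ENNReal.coe_lt_coe.2 hv) hρ hj).trans (ENNReal.coe_le_coe.2 hvu)

/-- On regular systems nothing is lost by looking at rational times. Since `ratStage` involves
countably many coordinates, it is measurable with respect to any σ-algebra that makes the paths
involved measurable. -/
lemma Good.ratStage_eq {x : ι → ℝ≥0 → ℤ} {A : Set ι} (h : Good x A) (k : ℕ) :
    ratStage x A k = stage x A k := by
  induction k with
  | zero => rfl
  | succ k ih =>
    have e : hitTime x (ratStage x A k).2 (k : ℤ) (ratStage x A k).1 = growthTime x A (k + 1) := by
      rw [ih]
      exact (h.white_good k).hitTime_eq fun s hs => h.white_ge_at k s hs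
    refine Prod.ext e ?_
    change _ \ _ = white x A (k + 1)
    rw [e, white_succ, ih]
    ext ρ
    refine and_congr_right fun hρ => not_congr ⟨?_, ?_⟩
    · rintro ⟨h1, h2⟩
      obtain ⟨s, hs⟩ := exists_coe_of_ne_top h1
      have hs0 : 0 < s := by exact_mod_cast pos_of_gt (h.jumper hs.symm).1
      rw [← hs] at h2
      exact ⟨s, hs, ((h.regular ρ (white_subset x A k hρ)).ratAtLeft_iff hs0 _).1 h2⟩
    · rintro ⟨s, hs, hl⟩
      have hs0 : 0 < s := by exact_mod_cast pos_of_gt (h.jumper hs.symm).1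
      refine ⟨by rw [← hs]; exact ENNReal.coe_ne_top, ?_⟩
      rw [← hs]
      exact ((h.regular ρ (white_subset x A k hρ)).ratAtLeft_iff hs0 _).2 hl

section Measurability

variable {Ω : Type*} [MeasurableSpace Ω] [Countable ι] {x : Ω → ι → ℝ≥0 → ℤ} {A : Ω → Set ι}

/-- The first alternative in `hx` admits particles that are never in `W` and whose paths need not be
measurable. It is used for σ-algebras that ignore the walks of the removed particles. -/
lemma measurable_hitTime {W : Ω → Set ι} (hW : ∀ ρ, MeasurableSet {ω | ρ ∈ W ω})
    (hx : ∀ ρ, (∀ ω, ρ ∉ W ω) ∨ ∀ t, Measurable fun ω => x ω ρ t) (z : ℤ) {τ : Ω → ℝ≥0∞}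
    (hτ : Measurable τ) : Measurable fun ω => hitTime (x ω) (W ω) z (τ ω) := by
  refine Measurable.iInf fun q => Measurable.iInf fun ρ => ?_
  have hset : MeasurableSet {ω | ρ ∈ W ω ∧ τ ω < ratTime q ∧ x ω ρ (ratTime q) ≤ z} := by
    rcases hx ρ with h | h
    · convert MeasurableSet.empty
      ext ω
      simp [h ω]
    · exact (hW ρ).inter ((measurableSet_lt hτ measurable_const).inter
        (measurableSet_le (h _) measurable_const))
  classical
  convert Measurable.ite hset (measurable_const (a := (ratTime q : ℝ≥0∞)))
    (measurable_const (a := (⊤ : ℝ≥0∞))) using 2 with ω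
  rw [iInf_eq_if]

lemma measurable_ratStage (hA : ∀ ρ, MeasurableSet {ω | ρ ∈ A ω})
    (hx : ∀ ρ, (∀ ω, ρ ∉ A ω) ∨ ∀ t, Measurable fun ω => x ω ρ t) (k : ℕ) :
    Measurable (fun ω => (ratStage (x ω) (A ω) k).1) ∧
      (∀ ρ, MeasurableSet {ω | ρ ∈ (ratStage (x ω) (A ω) k).2}) ∧
      ∀ ω, (ratStage (x ω) (A ω) k).2 ⊆ A ω := by
  induction k with
  | zero => exact ⟨measurable_const, hA, fun ω => subset_rfl⟩
  | succ k ih =>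
    obtain ⟨h1, h2, h3⟩ := ih
    have hx' : ∀ ρ, (∀ ω, ρ ∉ (ratStage (x ω) (A ω) k).2) ∨
        ∀ t, Measurable fun ω => x ω ρ t := fun ρ =>
      (hx ρ).imp_left fun h ω hρ => h ω (h3 ω hρ)
    have hτ := measurable_hitTime h2 hx' (k : ℤ) h1
    refine ⟨hτ, fun ρ => ?_, fun ω => Set.sdiff_subset.trans (h3 ω)⟩
    rcases hx ρ with h | h
    · convert MeasurableSet.empty
      ext ω
      simp only [Set.mem_ofPred_eq, Set.mem_empty_iff_false, iff_false]
      exact fun hρ => h ω (h3 ω hρ.1)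
    · refine (h2 ρ).inter (MeasurableSet.compl ?_)
      refine MeasurableSet.inter ?_ ?_
      · exact (hτ (measurableSet_singleton ⊤)).compl
      · have : {ω | RatAtLeft (x ω ρ) ((k : ℤ) + 1)
            (hitTime (x ω) (ratStage (x ω) (A ω) k).2 (k : ℤ) (ratStage (x ω) (A ω) k).1)} =
            ⋃ q : ℚ, ({ω | (ratTime q : ℝ≥0∞) <
              hitTime (x ω) (ratStage (x ω) (A ω) k).2 (k : ℤ) (ratStage (x ω) (A ω) k).1} ∩
            ⋂ (r : ℚ) (_ : ratTime q < ratTime r), ({ω | (ratTime r : ℝ≥0∞) <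
              hitTime (x ω) (ratStage (x ω) (A ω) k).2 (k : ℤ) (ratStage (x ω) (A ω) k).1}ᶜ ∪
              {ω | x ω ρ (ratTime r) = (k : ℤ) + 1})) := by
          ext ω
          simp only [RatAtLeft, Set.mem_ofPred_eq, Set.mem_iUnion, Set.mem_inter_iff,
            Set.mem_iInter, Set.mem_union, Set.mem_compl_iff, imp_iff_not_or]
        change MeasurableSet {ω | RatAtLeft (x ω ρ) ((k : ℤ) + 1) _}
        rw [this]
        refine MeasurableSet.iUnion fun q => (measurableSet_lt measurable_const hτ).inter
          (MeasurableSet.iInter fun r => MeasurableSet.iInter fun _ =>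
            (measurableSet_lt measurable_const hτ).compl.union ?_)
        exact h _ (measurableSet_singleton _)

lemma measurable_frontCount {τ : Ω → ℕ → ℝ≥0∞} (hτ : ∀ k, Measurable fun ω => τ ω k) (K n : ℕ) :
    Measurable fun ω => frontCount (τ ω) K n := by
  classical
  have : (fun ω => frontCount (τ ω) K n) =
      fun ω => ∑ m ∈ Finset.Icc 1 K, if τ ω m ≤ (n : ℝ≥0∞) then 1 else 0 := by
    ext ω
    rw [frontCount, Finset.card_filter]
  rw [this]
  exact Finset.measurable_sum _ fun m _ =>
    Measurable.ite (measurableSet_le (hτ m) measurable_const) measurable_const measurable_const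

end Measurability

/-! ### The law of the displacement -/

lemma measurable_natSub : Measurable fun p : ℕ × ℕ => (p.1 : ℤ) - (p.2 : ℤ) :=
  measurable_of_countable _

instance (D u : ℝ≥0) : IsProbabilityMeasure (srwLaw D u) :=
  Measure.isProbabilityMeasure_map measurable_natSub.aemeasurable

lemma srwLaw_map_neg (D u : ℝ≥0) : (srwLaw D u).map (fun z => -z) = srwLaw D u := by
  rw [srwLaw, Measure.map_map (measurable_of_countable _) measurable_natSub]
  conv_rhs => rw [← Measure.prod_swap, Measure.map_map measurable_natSub measurable_swap]
  congr 1
  ext p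
  simp

lemma srwLaw_neg_preimage (D u : ℝ≥0) (B : Set ℤ) :
    srwLaw D u ((fun z => -z) ⁻¹' B) = srwLaw D u B := by
  conv_rhs => rw [← srwLaw_map_neg]
  rw [Measure.map_apply (measurable_of_countable _) (MeasurableSet.of_discrete)]

/-- By symmetry. This is the hypothesis of the Lévy type inequality `maximal_ineq_of_half`. -/
lemma srwLaw_nonneg_half (D u : ℝ≥0) : 1 / 2 ≤ srwLaw D u {z | 0 ≤ z} := by
  have h1 : (1 : ℝ≥0∞) ≤ srwLaw D u {z | 0 ≤ z} + srwLaw D u {z | 0 ≤ z} := by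
    conv_rhs => rw [← srwLaw_neg_preimage D u {z | 0 ≤ z}]
    rw [srwLaw_neg_preimage]
    calc (1 : ℝ≥0∞) = srwLaw D u ({z | 0 ≤ z} ∪ (fun z => -z) ⁻¹' {z | 0 ≤ z}) := by
          rw [← measure_univ (μ := srwLaw D u)]
          congr 1
          ext z
          simp [le_total]
      _ ≤ _ := measure_union_le _ _
      _ = _ := by rw [srwLaw_neg_preimage]
  rw [← two_mul] at h1
  exact ENNReal.div_le_of_le_mul' h1

lemma poissonMeasure_compl_zero_le (r : ℝ≥0) : poissonMeasure r {0}ᶜ ≤ r := by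
  rw [prob_compl_eq_one_sub (measurableSet_singleton 0), poissonMeasure_singleton]
  simp only [pow_zero, mul_one, Nat.factorial_zero, Nat.cast_one, div_one]
  rw [← ENNReal.ofReal_one, ← ENNReal.ofReal_sub _ (Real.exp_nonneg _), ← ENNReal.ofReal_coe_nnreal]
  apply ENNReal.ofReal_le_ofReal
  have := Real.add_one_le_exp (-(r : ℝ))
  linarith

lemma srwLaw_ne_zero_le (D u : ℝ≥0) : srwLaw D u {0}ᶜ ≤ (D * u : ℝ≥0) := by
  rw [srwLaw, Measure.map_apply measurable_natSub MeasurableSet.of_discrete]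
  set r := D / 2 * u
  have hsub : (fun p : ℕ × ℕ => (p.1 : ℤ) - (p.2 : ℤ)) ⁻¹' {0}ᶜ ⊆
      ({0}ᶜ : Set ℕ) ×ˢ Set.univ ∪ Set.univ ×ˢ ({0}ᶜ : Set ℕ) := by
    rintro ⟨a, b⟩ h
    simp only [Set.mem_preimage, Set.mem_compl_iff, Set.mem_singleton_iff] at h
    simp only [Set.mem_union, Set.mem_prod, Set.mem_compl_iff, Set.mem_singleton_iff, Set.mem_univ,
      and_true, true_and]
    by_contra! hc
    exact h (by rw [hc.1, hc.2]; simp)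
  calc _ ≤ _ := measure_mono hsub
    _ ≤ _ := measure_union_le _ _
    _ ≤ (r : ℝ≥0∞) + r := by
        rw [Measure.prod_prod, Measure.prod_prod, measure_univ, mul_one, one_mul]
        exact add_le_add (poissonMeasure_compl_zero_le r) (poissonMeasure_compl_zero_le r)
    _ = _ := by
        rw [← ENNReal.coe_add]
        congr 1
        simp only [r]
        rw [← add_mul, add_halves]

lemma srwLaw_le_neg_one_pos {D u : ℝ≥0} (hD : 0 < D) (hu : 0 < u) : 0 < srwLaw D u {z | z ≤ -1} := by
  rw [srwLaw, Measure.map_apply measurable_natSub MeasurableSet.of_discrete]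
  have hr : 0 < D / 2 * u := by positivity
  set r := D / 2 * u
  have hsub : ({0} : Set ℕ) ×ˢ ({1} : Set ℕ) ⊆
      (fun p : ℕ × ℕ => (p.1 : ℤ) - (p.2 : ℤ)) ⁻¹' {z | z ≤ -1} := by
    rintro ⟨a, b⟩ ⟨h1, h2⟩
    simp only [Set.mem_singleton_iff] at h1 h2
    simp [h1, h2]
  refine lt_of_lt_of_le ?_ (measure_mono hsub)
  rw [Measure.prod_prod, poissonMeasure_singleton, poissonMeasure_singleton]
  exact ENNReal.mul_pos (by simp; positivity) (by simp; positivity)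

lemma integrable_sq_poissonMeasure (r : ℝ≥0) :
    Integrable (fun k : ℕ => (k : ℝ) ^ 2) (poissonMeasure r) := by
  rw [integrable_poissonMeasure_iff]
  have h := (Real.summable_pow_div_factorial (Real.exp 1 * r)).mul_left (2 * Real.exp (-r))
  refine Summable.of_nonneg_of_le (fun k => by positivity) (fun k => ?_) h
  have hk : (k : ℝ) ^ 2 ≤ 2 * Real.exp 1 ^ k := by
    have := Real.quadratic_le_exp_of_nonneg (show (0 : ℝ) ≤ k by positivity)
    rw [← Real.exp_nat_mul, mul_one]
    nlinarith
  rw [Real.norm_of_nonneg (by positivity), mul_pow]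
  calc _ ≤ Real.exp (-r) * r ^ k / k.factorial * (2 * Real.exp 1 ^ k) := by gcongr
    _ = _ := by ring

lemma integrable_sq_srwLaw (D u : ℝ≥0) :
    Integrable (fun z : ℤ => (z : ℝ) ^ 2) (srwLaw D u) := by
  rw [srwLaw, integrable_map_measure (by fun_prop) measurable_natSub.aemeasurable]
  have h1 := (integrable_sq_poissonMeasure (D / 2 * u)).comp_fst (poissonMeasure (D / 2 * u))
  have h2 := (integrable_sq_poissonMeasure (D / 2 * u)).comp_snd (poissonMeasure (D / 2 * u))
  refine ((h1.add h2).const_mul 2).mono' (by fun_prop) (Eventually.of_forall fun p => ?_)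
  simp only [Function.comp, Int.cast_sub, Int.cast_natCast, Pi.add_apply]
  rw [Real.norm_of_nonneg (by positivity)]
  nlinarith [sq_nonneg ((p.1 : ℝ) + p.2)]

/-! ### Basic facts about the walk -/

section Walk

variable {Ω : Type*} [MeasurableSpace Ω] {P : Measure Ω} {D : ℝ≥0}
  {S : ℝ≥0 → Ω → ℤ}

lemma IsSimpleRandomWalk.regularPath (hS : IsSimpleRandomWalk P D S) (ω : Ω) :
    RegularPath fun t => S t ω where
  right t := by
    have := hS.rightContinuous ω t
    rw [ContinuousWithinAt, nhds_discrete, tendsto_pure] at this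
    exact this
  left t := by
    obtain ⟨l, hl⟩ := hS.leftLimit ω t
    rw [nhds_discrete, tendsto_pure] at hl
    exact ⟨l, hl⟩
  step t := hS.nearestNeighbour ω t

lemma RegularPath.const_add {x : ℝ≥0 → ℤ} (hx : RegularPath x) (a : ℤ) :
    RegularPath fun t => a + x t where
  right t := (hx.right t).mono fun s hs => by rw [hs]
  left t := (hx.left t).imp' (fun l => a + l) fun l hl => hl.mono fun s hs => by
    change a + x s = a + l; rw [hs]
  step t := (hx.step t).mono fun s hs => by rw [add_sub_add_left_eq_sub]; exact hs

lemma IsSimpleRandomWalk.neg (hS : IsSimpleRandomWalk P D S) :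
    IsSimpleRandomWalk P D (fun t ω => -S t ω) where
  measurable t := (hS.measurable t).neg
  start ω := by simp [hS.start]
  rightContinuous ω t := (hS.rightContinuous ω t).neg
  leftLimit ω t := (hS.leftLimit ω t).imp' (fun l => -l) fun l hl => hl.neg
  nearestNeighbour ω t := (hS.nearestNeighbour ω t).mono fun s hs => by
    rw [← neg_add', abs_neg, ← sub_eq_add_neg]; exact hs
  indepIncrements := hS.indepIncrements.neg
  law s t hst := by
    have h := hS.law s t hst
    refine ⟨(((hS.measurable t).neg).sub ((hS.measurable s).neg)).aemeasurable, ?_⟩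
    have hm : Measurable fun ω => S t ω - S s ω := (hS.measurable t).sub (hS.measurable s)
    rw [← srwLaw_map_neg, ← h.map_eq, Measure.map_map (measurable_of_countable _) hm]
    congr 1
    ext ω
    simp
    ring

lemma IsSimpleRandomWalk.measure_sub (hS : IsSimpleRandomWalk P D S) {s t : ℝ≥0} (hst : s ≤ t)
    (B : Set ℤ) : P {ω | S t ω - S s ω ∈ B} = srwLaw D (t - s) B := by
  have hm : Measurable fun ω => S t ω - S s ω := (hS.measurable t).sub (hS.measurable s)
  rw [← (hS.law s t hst).map_eq, Measure.map_apply hm MeasurableSet.of_discrete]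
  rfl

lemma IsSimpleRandomWalk.measure_eval (hS : IsSimpleRandomWalk P D S) (t : ℝ≥0)
    (B : Set ℤ) : P {ω | S t ω ∈ B} = srwLaw D t B := by
  have := hS.measure_sub (zero_le (a := t)) B
  simpa [hS.start] using this

/-- The values of a right continuous path are attained on all fine grids. -/
lemma RegularPath.exists_grid {y : ℝ≥0 → ℤ} (hy : RegularPath y) (a l : ℝ≥0) {u : ℝ≥0}
    (hau : a ≤ u) (hul : u ≤ a + l) :
    ∀ᶠ N : ℕ in atTop, ∃ j ≤ N + 1, y (a + j * (l / (N + 1 : ℕ))) = y u := by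
  rcases eq_or_ne l 0 with rfl | hl
  · refine Eventually.of_forall fun N => ⟨0, Nat.zero_le _, ?_⟩
    rw [le_antisymm hul (by simpa using hau)]
    simp
  obtain ⟨v, rfl⟩ := exists_add_of_le hau
  have hvl : v ≤ l := le_of_add_le_add_left hul
  obtain ⟨d, hd, hdx⟩ := (mem_nhdsGE_iff_exists_Ico_subset' (lt_add_one (a + v))).1 (hy.right (a + v))
  have hd' : a + v < d := hd
  have hlim : Tendsto (fun N : ℕ => a + v + l / ((N + 1 : ℕ) : ℝ≥0)) atTop (𝓝 (a + v + 0)) := by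
    refine tendsto_const_nhds.add ?_
    have := (tendsto_const_div_atTop_nhds_zero_nat (𝕜 := ℝ≥0) l)
    exact this.comp (tendsto_add_atTop_nat 1)
  rw [add_zero] at hlim
  filter_upwards [hlim.eventually_lt_const hd'] with N hN
  set h : ℝ≥0 := l / ((N + 1 : ℕ) : ℝ≥0)
  have hh : 0 < h := by positivity
  refine ⟨⌈v / h⌉₊, Nat.ceil_le.2 ?_, hdx ⟨?_, ?_⟩⟩
  · rw [div_le_iff₀ hh]
    refine hvl.trans (le_of_eq ?_)
    simp only [h]
    field_simp
  · gcongr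
    exact (div_le_iff₀ hh).1 (Nat.le_ceil _)
  · refine lt_of_le_of_lt ?_ hN
    rw [add_assoc]
    gcongr
    calc (⌈v / h⌉₊ : ℝ≥0) * h ≤ (v / h + 1) * h := by
          gcongr
          exact (Nat.ceil_lt_add_one zero_le).le
      _ = v + h := by rw [add_mul, div_mul_cancel₀ _ hh.ne', one_mul]

/-- A form of Fatou's lemma that carries bounds on finite time grids over to continuous time.
Neither `E` nor the sets `F N` have to be measurable. -/
lemma measure_le_of_eventually_mem {E : Set Ω} {F : ℕ → Set Ω} {c : ℝ≥0∞}
    (hE : ∀ ω ∈ E, ∀ᶠ N in atTop, ω ∈ F N) (hF : ∀ N, P (F N) ≤ c) : P E ≤ c := by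
  have hmono : Monotone fun N => ⋂ M ≥ N, F M := fun a b hab =>
    Set.iInter₂_mono' fun M hM => ⟨M, hab.trans hM, subset_rfl⟩
  calc P E ≤ P (⋃ N, ⋂ M ≥ N, F M) := by
        refine measure_mono fun ω hω => ?_
        obtain ⟨N, hN⟩ := eventually_atTop.1 (hE ω hω)
        exact Set.mem_iUnion.2 ⟨N, Set.mem_iInter₂.2 hN⟩
    _ = ⨆ N, P (⋂ M ≥ N, F M) := hmono.measure_iUnion
    _ ≤ c := iSup_le fun N =>
        (measure_mono (Set.iInter₂_subset N le_rfl)).trans (hF N)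

/-- The walk is unlikely to move during a short time interval. -/
lemma IsSimpleRandomWalk.measure_move_le (hS : IsSimpleRandomWalk P D S) (a l : ℝ≥0) :
    P {ω | ∃ u, a ≤ u ∧ u ≤ a + l ∧ S u ω ≠ S a ω} ≤ (D * l : ℝ≥0) := by
  refine measure_le_of_eventually_mem
    (F := fun N => {ω | ∃ j ≤ N + 1, S (a + j * (l / (N + 1 : ℕ))) ω ≠ S a ω}) ?_ ?_
  · rintro ω ⟨u, h1, h2, h3⟩
    filter_upwards [(hS.regularPath ω).exists_grid a l h1 h2] with N hN
    obtain ⟨j, hj, h⟩ := hN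
    exact ⟨j, hj, h ▸ h3⟩
  · intro N
    set h : ℝ≥0 := l / ((N + 1 : ℕ) : ℝ≥0)
    have hsub : {ω | ∃ j ≤ N + 1, S (a + j * h) ω ≠ S a ω} ⊆
        ⋃ j ∈ Finset.range (N + 1), {ω | S (a + (j + 1 : ℕ) * h) ω - S (a + j * h) ω ∈ ({0}ᶜ : Set ℤ)} := by
      rintro ω ⟨j, hj, hne⟩
      by_contra hnot
      simp only [Set.mem_iUnion, Finset.mem_range, not_exists] at hnot
      have : ∀ i ≤ N + 1, S (a + i * h) ω = S a ω := by
        intro i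
        induction i with
        | zero => simp
        | succ i ih =>
          intro hi
          have := hnot i (by omega)
          simp only [Set.mem_compl_iff, Set.mem_singleton_iff, Set.mem_ofPred_eq, not_not] at this
          rw [← ih (by omega)]
          omega
      exact hne (this j hj)
    calc _ ≤ _ := measure_mono hsub
      _ ≤ _ := measure_biUnion_finset_le _ _
      _ ≤ ∑ j ∈ Finset.range (N + 1), ((D * h : ℝ≥0) : ℝ≥0∞) := by
          refine Finset.sum_le_sum fun j _ => ?_
          rw [hS.measure_sub (by gcongr; simp)]
          have : a + (j + 1 : ℕ) * h - (a + j * h) = h := by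
            rw [add_tsub_add_eq_tsub_left]
            push_cast
            rw [add_mul, one_mul, add_tsub_cancel_left]
          rw [this]
          exact srwLaw_ne_zero_le D h
      _ = _ := by
          rw [Finset.sum_const, Finset.card_range, nsmul_eq_mul, ← ENNReal.coe_natCast,
            ← ENNReal.coe_mul]
          congr 1
          simp only [h]
          field_simp

end Walk

/-! ### A maximal inequality -/

section Maximal

variable {Ω : Type*}

/-- The σ-algebra of the first `n` variables of a sequence. -/
@[reducible] def pastOf (ξ : ℕ → Ω → ℤ) (n : ℕ) : MeasurableSpace Ω :=
  ⨆ i ∈ {i | i < n}, MeasurableSpace.comap (ξ i) ⊤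

/-- The σ-algebra of all the variables of a sequence but the first `n`. -/
@[reducible] def futureOf (ξ : ℕ → Ω → ℤ) (n : ℕ) : MeasurableSpace Ω :=
  ⨆ i ∈ {i | n ≤ i}, MeasurableSpace.comap (ξ i) ⊤

variable {ξ : ℕ → Ω → ℤ}

lemma pastOf_mono (ξ : ℕ → Ω → ℤ) : Monotone (pastOf ξ) := fun _ _ hab =>
  biSup_mono fun _ hi => lt_of_lt_of_le hi hab

lemma futureOf_anti (ξ : ℕ → Ω → ℤ) : Antitone (futureOf ξ) := fun _ _ hab =>
  biSup_mono fun _ hi => le_trans hab hi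

lemma measurable_sum_range_pastOf {j n : ℕ} (hj : j ≤ n) :
    Measurable[pastOf ξ n] fun ω => ∑ i ∈ Finset.range j, ξ i ω := by
  refine Finset.measurable_sum _ fun i hi => ?_
  have : MeasurableSpace.comap (ξ i) ⊤ ≤ pastOf ξ n :=
    le_iSup₂ (f := fun i (_ : i ∈ {i | i < n}) => MeasurableSpace.comap (ξ i) ⊤) i
      ((Finset.mem_range.1 hi).trans_le hj)
  exact Measurable.mono (comap_measurable (ξ i)) this le_rfl

lemma measurable_sum_Ico_futureOf (n j : ℕ) :
    Measurable[futureOf ξ n] fun ω => ∑ i ∈ Finset.Ico n j, ξ i ω := by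
  refine Finset.measurable_sum _ fun i hi => ?_
  have : MeasurableSpace.comap (ξ i) ⊤ ≤ futureOf ξ n :=
    le_iSup₂ (f := fun i (_ : i ∈ {i | n ≤ i}) => MeasurableSpace.comap (ξ i) ⊤) i
      (Finset.mem_Ico.1 hi).1
  exact Measurable.mono (comap_measurable (ξ i)) this le_rfl

variable [mΩ : MeasurableSpace Ω] {P : Measure Ω}

lemma pastOf_le (hξ : ∀ i, Measurable (ξ i)) (n : ℕ) : pastOf ξ n ≤ mΩ :=
  iSup₂_le fun i _ => (hξ i).comap_le

lemma futureOf_le (hξ : ∀ i, Measurable (ξ i)) (n : ℕ) : futureOf ξ n ≤ mΩ :=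
  iSup₂_le fun i _ => (hξ i).comap_le

lemma indep_pastOf_futureOf (hξ : ∀ i, Measurable (ξ i)) (h : iIndepFun ξ P) (n : ℕ) :
    Indep (pastOf ξ n) (futureOf ξ n) P :=
  indep_iSup_of_disjoint (fun i => (hξ i).comap_le) h
    (Set.disjoint_left.2 fun _ (h1 : _ < n) (h2 : n ≤ _) => absurd h1 (not_lt.2 h2))

lemma measure_pastOf_inter_futureOf (hξ : ∀ i, Measurable (ξ i)) (h : iIndepFun ξ P) {n : ℕ}
    {B F : Set Ω} (hB : MeasurableSet[pastOf ξ n] B) (hF : MeasurableSet[futureOf ξ n] F) :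
    P (B ∩ F) = P B * P F :=
  (Indep_iff _ _ _).1 (indep_pastOf_futureOf hξ h n) B F hB hF

/-- A Lévy type maximal inequality, on an event of the past. -/
lemma maximal_ineq_of_half (hξ : ∀ i, Measurable (ξ i)) (h : iIndepFun ξ P) {n M : ℕ}
    (hhalf : ∀ j, n ≤ j → j ≤ M → 1 / 2 ≤ P {ω | 0 ≤ ∑ i ∈ Finset.Ico j M, ξ i ω})
    {B : Set Ω} (hB : MeasurableSet[pastOf ξ n] B) (d : ℤ) :
    P (B ∩ {ω | ∃ j, n ≤ j ∧ j ≤ M ∧ d ≤ ∑ i ∈ Finset.Ico n j, ξ i ω}) ≤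
      2 * (P B * P {ω | d ≤ ∑ i ∈ Finset.Ico n M, ξ i ω}) := by
  classical
  -- `F j`: the partial sum reaches `d` for the first time at `j`. These events are disjoint.
  set F : ℕ → Set Ω := fun j => {ω | d ≤ ∑ i ∈ Finset.Ico n j, ξ i ω} ∩
    ⋂ i ∈ Finset.Ico n j, {ω | ∑ i ∈ Finset.Ico n i, ξ i ω < d}
  have hIco : ∀ j, Measurable[pastOf ξ j] fun ω => ∑ i ∈ Finset.Ico n j, ξ i ω := fun j => by
    rcases le_or_gt n j with hnj | hnj
    · simp_rw [Finset.sum_Ico_eq_sub _ hnj]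
      exact (measurable_sum_range_pastOf le_rfl).sub (measurable_sum_range_pastOf hnj)
    · simp only [Finset.Ico_eq_empty_of_le hnj.le, Finset.sum_empty]
      exact measurable_const
  have hIco' : ∀ i j, i ≤ j → Measurable[pastOf ξ j] fun ω => ∑ i ∈ Finset.Ico n i, ξ i ω :=
    fun i j hij => (hIco i).mono (pastOf_mono ξ hij) le_rfl
  have hF : ∀ j, MeasurableSet[pastOf ξ j] (F j) := fun j => by
    refine MeasurableSet.inter (hIco j (MeasurableSet.of_discrete (s := {z | d ≤ z}))) ?_
    refine Finset.measurableSet_biInter _ fun i hi => ?_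
    exact hIco' i j (Finset.mem_Ico.1 hi).2.le (MeasurableSet.of_discrete (s := {z | z < d}))
  have hpast : ∀ j, n ≤ j → MeasurableSet[pastOf ξ j] (B ∩ F j) := fun j hj =>
    MeasurableSet.inter (pastOf_mono ξ hj _ hB) (hF j)
  have hfut : ∀ j, MeasurableSet[futureOf ξ j] {ω | 0 ≤ ∑ i ∈ Finset.Ico j M, ξ i ω} := fun j =>
    measurable_sum_Ico_futureOf j M (MeasurableSet.of_discrete (s := {z | 0 ≤ z}))
  have hcover : B ∩ {ω | ∃ j, n ≤ j ∧ j ≤ M ∧ d ≤ ∑ i ∈ Finset.Ico n j, ξ i ω} ⊆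
      ⋃ j ∈ Finset.Icc n M, B ∩ F j := by
    rintro ω ⟨hωB, hex⟩
    set j := Nat.find hex
    obtain ⟨h1, h2, h3⟩ := Nat.find_spec hex
    refine Set.mem_iUnion₂.2 ⟨j, Finset.mem_Icc.2 ⟨h1, h2⟩, hωB, h3, ?_⟩
    refine Set.mem_iInter₂.2 fun i hi => ?_
    rw [Finset.mem_Ico] at hi
    have := Nat.find_min hex hi.2
    simp only [not_and, not_le] at this
    exact this hi.1 (hi.2.le.trans h2)
  have hdisj : Set.PairwiseDisjoint (Finset.Icc n M : Set ℕ)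
      fun j => (B ∩ F j) ∩ {ω | 0 ≤ ∑ i ∈ Finset.Ico j M, ξ i ω} := by
    have key : ∀ a b, n ≤ a → a < b → ∀ ω, ω ∈ F a → ω ∉ F b := by
      intro a b hna hab ω ha hb
      have := Set.mem_iInter₂.1 hb.2 a (Finset.mem_Ico.2 ⟨hna, hab⟩)
      have h2 : d ≤ ∑ i ∈ Finset.Ico n a, ξ i ω := ha.1
      exact absurd h2 (not_le.2 this)
    intro a ha b hb hab
    rw [Finset.mem_coe, Finset.mem_Icc] at ha hb
    refine Set.disjoint_left.2 fun ω h1 h2 => ?_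
    rcases lt_or_gt_of_ne hab with h' | h'
    · exact key a b ha.1 h' ω h1.1.2 h2.1.2
    · exact key b a hb.1 h' ω h2.1.2 h1.1.2
  -- After the first passage the remaining sum is independent of the past and nonnegative with
  -- probability at least `1 / 2`. This costs the factor `2` and keeps the final sum at `d` or
  -- above.
  have hterm : ∀ j ∈ Finset.Icc n M, P (B ∩ F j) ≤
      2 * P ((B ∩ F j) ∩ {ω | 0 ≤ ∑ i ∈ Finset.Ico j M, ξ i ω}) := by
    intro j hj
    rw [Finset.mem_Icc] at hj
    rw [measure_pastOf_inter_futureOf hξ h (hpast j hj.1) (hfut j)]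
    calc P (B ∩ F j) = 2 * (P (B ∩ F j) * (1 / 2)) := by
          rw [mul_left_comm, one_div, ENNReal.mul_inv_cancel two_ne_zero ENNReal.ofNat_ne_top,
            mul_one]
      _ ≤ _ := by gcongr; exact hhalf j hj.1 hj.2
  calc _ ≤ _ := measure_mono hcover
    _ ≤ ∑ j ∈ Finset.Icc n M, P (B ∩ F j) := measure_biUnion_finset_le _ _
    _ ≤ ∑ j ∈ Finset.Icc n M, 2 * P ((B ∩ F j) ∩ {ω | 0 ≤ ∑ i ∈ Finset.Ico j M, ξ i ω}) :=
        Finset.sum_le_sum hterm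
    _ = 2 * P (⋃ j ∈ Finset.Icc n M, (B ∩ F j) ∩ {ω | 0 ≤ ∑ i ∈ Finset.Ico j M, ξ i ω}) := by
        rw [← Finset.mul_sum, measure_biUnion_finset hdisj fun j hj =>
          (pastOf_le hξ j _ (hpast j (Finset.mem_Icc.1 hj).1)).inter (futureOf_le hξ j _ (hfut j))]
    _ ≤ 2 * P (B ∩ {ω | d ≤ ∑ i ∈ Finset.Ico n M, ξ i ω}) := by
        gcongr
        refine Set.iUnion₂_subset fun j hj ω hω => ⟨hω.1.1, ?_⟩
        rw [Finset.mem_Icc] at hj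
        have h1 : d ≤ ∑ i ∈ Finset.Ico n j, ξ i ω := hω.1.2.1
        have h2 : 0 ≤ ∑ i ∈ Finset.Ico j M, ξ i ω := hω.2
        have h3 := Finset.sum_Ico_consecutive (fun i => ξ i ω) hj.1 hj.2
        change d ≤ ∑ i ∈ Finset.Ico n M, ξ i ω
        omega
    _ = _ := by
        have hm : MeasurableSet[futureOf ξ n] {ω | d ≤ ∑ i ∈ Finset.Ico n M, ξ i ω} :=
          measurable_sum_Ico_futureOf n M (MeasurableSet.of_discrete (s := {z | d ≤ z}))
        rw [measure_pastOf_inter_futureOf hξ h hB hm]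

end Maximal

/-- The increments of a process at the integer times. -/
def incr {Ω : Type*} (S : ℝ≥0 → Ω → ℤ) (i : ℕ) (ω : Ω) : ℤ :=
  S ((i + 1 : ℕ) : ℝ≥0) ω - S (i : ℝ≥0) ω

lemma sum_Ico_sub_of_le (a : ℕ → ℤ) {n m : ℕ} (h : n ≤ m) :
    ∑ i ∈ Finset.Ico n m, (a (i + 1) - a i) = a m - a n := by
  rw [Finset.sum_Ico_eq_sub _ h, Finset.sum_range_sub, Finset.sum_range_sub]
  ring

lemma sum_Ico_incr {Ω : Type*} (S : ℝ≥0 → Ω → ℤ) {n m : ℕ} (h : n ≤ m) (ω : Ω) :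
    ∑ i ∈ Finset.Ico n m, incr S i ω = S (m : ℝ≥0) ω - S (n : ℝ≥0) ω :=
  sum_Ico_sub_of_le (fun i => S (i : ℝ≥0) ω) h

lemma pastOf_congr {Ω : Type*} {ξ ξ' : ℕ → Ω → ℤ} {n : ℕ} (h : ∀ i < n, ξ i = ξ' i) :
    pastOf ξ n = pastOf ξ' n :=
  biSup_congr fun i (hi : i < n) => by rw [h i hi]

lemma pastOf_neg_le {Ω : Type*} (ξ : ℕ → Ω → ℤ) (n : ℕ) :
    pastOf (fun i ω => -ξ i ω) n ≤ pastOf ξ n := by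
  refine iSup₂_mono fun i _ => ?_
  change MeasurableSpace.comap (fun ω => -ξ i ω) ⊤ ≤ _
  rw [show (fun ω => -ξ i ω) = (fun z : ℤ => -z) ∘ ξ i from rfl, ← MeasurableSpace.comap_comp]
  exact MeasurableSpace.comap_mono le_top

section Walk

variable {Ω : Type*} [MeasurableSpace Ω] {P : Measure Ω} {D : ℝ≥0} {S : ℝ≥0 → Ω → ℤ}

lemma IsSimpleRandomWalk.measurable_incr (hS : IsSimpleRandomWalk P D S) (i : ℕ) :
    Measurable (incr S i) :=
  (hS.measurable _).sub (hS.measurable _)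

lemma IsSimpleRandomWalk.iIndepFun_incr (hS : IsSimpleRandomWalk P D S) :
    iIndepFun (incr S) P :=
  hS.indepIncrements.nat (t := fun i : ℕ => (i : ℝ≥0)) Nat.mono_cast

lemma IsSimpleRandomWalk.eval_eq_sum (hS : IsSimpleRandomWalk P D S) (n : ℕ) (ω : Ω) :
    S (n : ℝ≥0) ω = ∑ i ∈ Finset.range n, incr S i ω := by
  rw [Finset.range_eq_Ico, sum_Ico_incr S (Nat.zero_le n)]
  simp [hS.start]

lemma IsSimpleRandomWalk.measurable_eval_past (hS : IsSimpleRandomWalk P D S) {m n : ℕ}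
    (hmn : m ≤ n) : Measurable[pastOf (incr S) n] (S (m : ℝ≥0)) := by
  have : S (m : ℝ≥0) = fun ω => ∑ i ∈ Finset.range m, incr S i ω :=
    funext fun ω => hS.eval_eq_sum m ω
  rw [this]
  exact measurable_sum_range_pastOf hmn

/-- Events of the past are independent of the later increments at integer times. -/
lemma IsSimpleRandomWalk.measure_past_inter (hS : IsSimpleRandomWalk P D S) {n l : ℕ}
    {B : Set Ω} (hB : MeasurableSet[pastOf (incr S) n] B) (E : Set ℤ) :
    P (B ∩ {ω | S ((n + l : ℕ) : ℝ≥0) ω - S (n : ℝ≥0) ω ∈ E}) = P B * srwLaw D l E := by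
  have h1 : MeasurableSet[futureOf (incr S) n]
      {ω | S ((n + l : ℕ) : ℝ≥0) ω - S (n : ℝ≥0) ω ∈ E} := by
    have := measurable_sum_Ico_futureOf (ξ := incr S) n (n + l)
    simp_rw [sum_Ico_incr S (Nat.le_add_right n l)] at this
    exact this (MeasurableSet.of_discrete (s := E))
  rw [measure_pastOf_inter_futureOf hS.measurable_incr hS.iIndepFun_incr hB h1,
    hS.measure_sub (by gcongr; omega)]
  congr 2
  push_cast
  rw [add_tsub_cancel_left]

/-- The maximal inequality for the walk, on an event of the past. -/
lemma IsSimpleRandomWalk.maximal_ineq (hS : IsSimpleRandomWalk P D S) (n : ℕ) (l : ℝ≥0)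
    {B : Set Ω} (hB : MeasurableSet[pastOf (incr S) n] B) (d : ℤ) :
    P (B ∩ {ω | ∃ u : ℝ≥0, (n : ℝ≥0) ≤ u ∧ u ≤ n + l ∧ d ≤ S u ω - S (n : ℝ≥0) ω}) ≤
      2 * (P B * srwLaw D l {z | d ≤ z}) := by
  -- The grid goes through the integers up to `n` and then has mesh `l / (N + 1)`. So its first `n`
  -- increments are those of `incr S`, and the past σ-algebra is the same for all `N`.
  set g : ℕ → ℕ → ℝ≥0 := fun N i => (min i n : ℕ) + (i - n : ℕ) * (l / (N + 1 : ℕ))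
  have hg : ∀ N, Monotone (g N) := fun N a b hab => by
    simp only [g]
    gcongr
  have hgn : ∀ N, g N n = n := fun N => by simp [g]
  have hgj : ∀ N j, g N (n + j) = n + j * (l / (N + 1 : ℕ)) := fun N j => by simp [g]
  set ξ : ℕ → ℕ → Ω → ℤ := fun N i ω => S (g N (i + 1)) ω - S (g N i) ω
  have hsum : ∀ N {a b : ℕ} (_ : a ≤ b) ω,
      ∑ i ∈ Finset.Ico a b, ξ N i ω = S (g N b) ω - S (g N a) ω := fun N a b hab ω =>
    sum_Ico_sub_of_le (fun i => S (g N i) ω) hab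
  refine measure_le_of_eventually_mem (F := fun N => B ∩ {ω | ∃ j, n ≤ j ∧ j ≤ n + (N + 1) ∧
      d ≤ ∑ i ∈ Finset.Ico n j, ξ N i ω}) ?_ ?_
  · rintro ω ⟨hωB, u, h1, h2, h3⟩
    filter_upwards [(hS.regularPath ω).exists_grid n l h1 h2] with N hN
    obtain ⟨j, hj, h⟩ := hN
    refine ⟨hωB, n + j, by omega, by omega, ?_⟩
    rw [hsum N (by omega), hgn, hgj, h]
    exact h3
  · intro N
    have hpast : pastOf (ξ N) n = pastOf (incr S) n := by
      refine pastOf_congr fun i hi => ?_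
      have e1 : g N i = (i : ℝ≥0) := by
        simp only [g, min_eq_left hi.le, Nat.sub_eq_zero_of_le hi.le, Nat.cast_zero, zero_mul,
          add_zero]
      have e2 : g N (i + 1) = ((i + 1 : ℕ) : ℝ≥0) := by
        have h' : i + 1 ≤ n := hi
        simp only [g, min_eq_left h', Nat.sub_eq_zero_of_le h', Nat.cast_zero, zero_mul, add_zero]
      ext ω
      simp only [ξ, incr, e1, e2]
    have hmax := maximal_ineq_of_half (P := P) (ξ := ξ N) (n := n) (M := n + (N + 1))
      (fun i => (hS.measurable _).sub (hS.measurable _)) (hS.indepIncrements.nat (hg N))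
      (fun j h1 h2 => ?_) (hpast ▸ hB) d
    · refine hmax.trans ?_
      gcongr
      have : ∀ ω, ∑ i ∈ Finset.Ico n (n + (N + 1)), ξ N i ω = S (n + l) ω - S n ω := fun ω => by
        rw [hsum N (by omega), hgn, hgj]
        congr 3
        field_simp
      simp_rw [this]
      refine (hS.measure_sub (s := n) (t := n + l) (by simp) {z | d ≤ z}).le.trans ?_
      rw [add_tsub_cancel_left]
    · simp_rw [hsum N h2]
      exact (srwLaw_nonneg_half D _).trans (hS.measure_sub (hg N h2) {z | 0 ≤ z}).ge

/-- A bound for the probability that the walk makes a displacement `d` within one unit of time. -/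
def visitBound (D : ℝ≥0) (d : ℤ) : ℝ≥0∞ := 2 * srwLaw D 1 {z | z ≤ -|d|}

lemma srwLaw_le_neg (D u : ℝ≥0) (d : ℤ) : srwLaw D u {z | d ≤ z} = srwLaw D u {z | z ≤ -d} := by
  rw [← srwLaw_neg_preimage]
  congr 1
  ext z
  simp only [Set.mem_preimage, Set.mem_ofPred_eq]
  omega

/-- The maximal inequality is applied to the walk or to its negative, according to the sign of `d`;
by symmetry of the law both cases give `visitBound`. -/
lemma IsSimpleRandomWalk.measure_past_visit_le (hS : IsSimpleRandomWalk P D S) (n : ℕ)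
    {B : Set Ω} (hB : MeasurableSet[pastOf (incr S) n] B) (d : ℤ) :
    P (B ∩ {ω | ∃ u : ℝ≥0, (n : ℝ≥0) ≤ u ∧ u ≤ n + 1 ∧ S u ω - S (n : ℝ≥0) ω = d}) ≤
      P B * visitBound D d := by
  rw [visitBound, mul_left_comm]
  rcases le_total 0 d with hd | hd
  · rw [abs_of_nonneg hd, ← srwLaw_le_neg]
    refine (measure_mono ?_).trans (hS.maximal_ineq n 1 hB d)
    exact Set.inter_subset_inter_right _ fun ω ⟨u, h1, h2, h3⟩ => ⟨u, h1, h2, h3.ge⟩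
  · rw [abs_of_nonpos hd, ← srwLaw_le_neg]
    have hB' : MeasurableSet[pastOf (incr fun t ω => -S t ω) n] B := by
      have h := pastOf_neg_le (incr fun t ω => -S t ω) n
      have e : (fun i ω => -incr (fun t ω => -S t ω) i ω) = incr S := by
        ext i ω
        simp only [incr]
        ring
      rw [e] at h
      exact h _ hB
    refine (measure_mono ?_).trans (hS.neg.maximal_ineq n 1 hB' (-d))
    refine Set.inter_subset_inter_right _ fun ω ⟨u, h1, h2, h3⟩ => ⟨u, h1, h2, ?_⟩
    omega

lemma IsSimpleRandomWalk.measure_exists_le [IsProbabilityMeasure P] (hS : IsSimpleRandomWalk P D S)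
    (T : ℝ≥0) (d : ℤ) : P {ω | ∃ u ≤ T, S u ω ≤ -d} ≤ 2 * srwLaw D T {z | z ≤ -d} := by
  have h := hS.neg.maximal_ineq 0 T (B := Set.univ) MeasurableSet.univ d
  rw [measure_univ, one_mul, Set.univ_inter, srwLaw_le_neg] at h
  refine (measure_mono ?_).trans h
  rintro ω ⟨u, h1, h2⟩
  refine ⟨u, by simp, by simpa using h1, ?_⟩
  have h0 := hS.start ω
  simp only [Nat.cast_zero, h0]
  omega

/-! ### Second moments and the central limit theorem -/

lemma srwLaw_integral_eq_zero (D u : ℝ≥0) : ∫ z : ℤ, (z : ℝ) ∂srwLaw D u = 0 := by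
  have h : ∫ z : ℤ, (z : ℝ) ∂srwLaw D u = ∫ z : ℤ, -(z : ℝ) ∂srwLaw D u := by
    conv_lhs => rw [← srwLaw_map_neg]
    rw [integral_map (measurable_of_countable _).aemeasurable (by fun_prop)]
    simp
  rw [integral_neg] at h
  linarith

lemma IsSimpleRandomWalk.identDistrib_incr (hS : IsSimpleRandomWalk P D S) (i : ℕ) :
    HasLaw (incr S i) (srwLaw D 1) P := by
  have h := hS.law (i : ℝ≥0) ((i + 1 : ℕ) : ℝ≥0) (by gcongr; omega)
  have e : ((i + 1 : ℕ) : ℝ≥0) - (i : ℝ≥0) = 1 := by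
    push_cast
    rw [add_tsub_cancel_left]
  rw [e] at h
  exact h

/-- The variance of the displacement of the walk in a unit of time. -/
def unitVariance (D : ℝ≥0) : ℝ := ∫ z : ℤ, (z : ℝ) ^ 2 ∂srwLaw D 1

lemma unitVariance_nonneg (D : ℝ≥0) : 0 ≤ unitVariance D :=
  integral_nonneg fun _ => sq_nonneg _

lemma unitVariance_pos (hD : 0 < D) : 0 < unitVariance D := by
  refine (integral_pos_iff_support_of_nonneg (fun _ => sq_nonneg _)
    (integrable_sq_srwLaw D 1)).2 ((srwLaw_le_neg_one_pos hD one_pos).trans_le (measure_mono ?_))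
  intro z hz
  have hz' : z ≤ -1 := hz
  have : (z : ℝ) ≠ 0 := by
    intro h
    have : z = 0 := by exact_mod_cast h
    omega
  simpa using this

lemma IsSimpleRandomWalk.memLp_incr [IsProbabilityMeasure P] (hS : IsSimpleRandomWalk P D S)
    (i : ℕ) : MemLp (fun ω => (incr S i ω : ℝ)) 2 P := by
  have hm : Measurable fun ω => (incr S i ω : ℝ) :=
    (measurable_of_countable (fun z : ℤ => (z : ℝ))).comp (hS.measurable_incr i)
  rw [memLp_two_iff_integrable_sq hm.aestronglyMeasurable]
  have h := integrable_sq_srwLaw D 1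
  rw [← (hS.identDistrib_incr i).map_eq, integrable_map_measure (by fun_prop)
    (hS.measurable_incr i).aemeasurable] at h
  exact h

lemma IsSimpleRandomWalk.integral_incr (hS : IsSimpleRandomWalk P D S) (i : ℕ) :
    ∫ ω, (incr S i ω : ℝ) ∂P = 0 := by
  rw [← srwLaw_integral_eq_zero D 1, ← (hS.identDistrib_incr i).map_eq,
    integral_map (hS.measurable_incr i).aemeasurable (by fun_prop)]

lemma IsSimpleRandomWalk.variance_incr (hS : IsSimpleRandomWalk P D S) (i : ℕ) :
    Var[fun ω => (incr S i ω : ℝ); P] = unitVariance D := by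
  have hm : Measurable fun ω => (incr S i ω : ℝ) :=
    (measurable_of_countable (fun z : ℤ => (z : ℝ))).comp (hS.measurable_incr i)
  rw [variance_of_integral_eq_zero hm.aemeasurable (hS.integral_incr i), unitVariance,
    ← (hS.identDistrib_incr i).map_eq,
    integral_map (hS.measurable_incr i).aemeasurable (by fun_prop)]

lemma IsSimpleRandomWalk.iIndepFun_incr_real (hS : IsSimpleRandomWalk P D S) :
    iIndepFun (fun i ω => (incr S i ω : ℝ)) P :=
  hS.iIndepFun_incr.comp (fun _ (z : ℤ) => (z : ℝ)) fun _ => measurable_of_countable _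

lemma IsSimpleRandomWalk.chebyshev [IsProbabilityMeasure P] (hS : IsSimpleRandomWalk P D S)
    (n : ℕ) {d : ℝ} (hd : 0 < d) :
    srwLaw D n {z | d ≤ |(z : ℝ)|} ≤ ENNReal.ofReal (n * unitVariance D / d ^ 2) := by
  have hsum : ∀ ω, (S (n : ℝ≥0) ω : ℝ) = (∑ i ∈ Finset.range n, fun ω => (incr S i ω : ℝ)) ω := by
    intro ω
    rw [hS.eval_eq_sum, Finset.sum_apply]
    push_cast
    rfl
  have hmem : MemLp (∑ i ∈ Finset.range n, fun ω => (incr S i ω : ℝ)) 2 P :=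
    memLp_finsetSum' _ fun i _ => hS.memLp_incr i
  have hvar : Var[∑ i ∈ Finset.range n, fun ω => (incr S i ω : ℝ); P] = n * unitVariance D := by
    rw [IndepFun.variance_sum (fun i _ => hS.memLp_incr i)
      fun i _ j _ hij => hS.iIndepFun_incr_real.indepFun hij]
    simp [hS.variance_incr]
  have hmean : ∫ ω, (∑ i ∈ Finset.range n, fun ω => (incr S i ω : ℝ)) ω ∂P = 0 := by
    simp_rw [Finset.sum_apply]
    rw [integral_finsetSum _ fun i _ => (hS.memLp_incr i).integrable (by norm_num)]
    simp [hS.integral_incr]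
  have h := meas_ge_le_variance_div_sq hmem hd
  rw [hvar, hmean] at h
  rw [← hS.measure_eval]
  refine (measure_mono ?_).trans h
  intro ω hω
  have hω' : d ≤ |(S (n : ℝ≥0) ω : ℝ)| := hω
  rw [hsum] at hω'
  simpa using hω'

/-- The walk is below `-b √n` at time `n` with a probability that is bounded below. -/
lemma IsSimpleRandomWalk.exists_lower_bound [IsProbabilityMeasure P]
    (hS : IsSimpleRandomWalk P D S) (hD : 0 < D) (b : ℝ) :
    ∃ c : ℝ≥0∞, 0 < c ∧ ∀ᶠ n : ℕ in atTop, c ≤ srwLaw D n {z | (z : ℝ) ≤ -(b * √n)} := by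
  have hV := unitVariance_pos hD
  set v : ℝ≥0 := (unitVariance D).toNNReal
  have hv : v ≠ 0 := by
    simp only [v, ne_eq, Real.toNNReal_eq_zero, not_le]
    exact hV
  have hclt := tendstoInDistribution_inv_sqrt_mul_sum_sub (P := P) (P' := gaussianReal 0 v)
    (X := fun i ω => (incr S i ω : ℝ)) (Y := id) (by rw [hS.variance_incr]; exact HasLaw.id)
    (hS.memLp_incr 0) hS.iIndepFun_incr_real
    (fun i => ((hS.identDistrib_incr i).identDistrib (hS.identDistrib_incr 0)).comp
      (measurable_of_countable (fun z : ℤ => (z : ℝ))))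
  -- The portmanteau theorem on an open half-line; any constant strictly below its Gaussian mass,
  -- which is positive, serves as `c`.
  have hlim := ProbabilityMeasure.le_liminf_measure_open_of_tendsto hclt.tendsto
    (isOpen_Iio (a := -b))
  simp only [ProbabilityMeasure.coe_mk, Measure.map_id] at hlim
  have hpos : 0 < gaussianReal 0 v (Set.Iio (-b)) := by
    rw [pos_iff_ne_zero]
    intro h0
    have := gaussianReal_absolutelyContinuous' 0 hv h0
    simp at this
  obtain ⟨c, hc0, hc⟩ := exists_between hpos
  refine ⟨c, hc0, ?_⟩
  filter_upwards [eventually_lt_of_lt_liminf (hc.trans_le hlim), eventually_gt_atTop 0] with n hn hn0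
  refine hn.le.trans ?_
  rw [← hS.measure_eval, Measure.map_apply_of_aemeasurable (hclt.forall_aemeasurable n)
    measurableSet_Iio]
  refine measure_mono fun ω hω => ?_
  rw [Set.mem_preimage, Set.mem_Iio, hS.integral_incr, mul_zero, sub_zero] at hω
  have hs : 0 < √(n : ℝ) := Real.sqrt_pos.2 (by exact_mod_cast hn0)
  rw [inv_mul_lt_iff₀ hs] at hω
  change (S (n : ℝ≥0) ω : ℝ) ≤ _
  rw [hS.eval_eq_sum]
  push_cast
  linarith

/-! ### The reversed walk does not stay bounded above -/

/-- The probability that the walk has only increments at most `d` over the integer intervals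
`[n - j, n]`, `j ≤ L`, tends to zero with `L → ∞`, uniformly in `n`. -/
lemma IsSimpleRandomWalk.exists_reversed_le [IsProbabilityMeasure P]
    (hS : IsSimpleRandomWalk P D S) (hD : 0 < D) (d : ℤ) {ε : ℝ} (hε : 0 < ε) :
    ∃ L : ℕ, ∀ n ≥ L, P.real {ω | ∀ j ≤ L,
      S (n : ℝ≥0) ω - S ((n - j : ℕ) : ℝ≥0) ω ≤ d} ≤ ε := by
  obtain ⟨c', hc0', hc'⟩ := hS.exists_lower_bound hD 1
  have hc1' : c' ≤ 1 := by
    obtain ⟨n, hn⟩ := hc'.exists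
    exact hn.trans prob_le_one
  set c := c'.toReal
  have hc0 : 0 < c := ENNReal.toReal_pos hc0'.ne' (ne_top_of_le_ne_top ENNReal.one_ne_top hc1')
  have hc1 : c ≤ 1 := ENNReal.toReal_le_of_le_ofReal zero_le_one (by simpa using hc1')
  have hc : ∀ᶠ n : ℕ in atTop, c ≤ (srwLaw D n).real {z | (z : ℝ) ≤ -(1 * √n)} :=
    hc'.mono fun n hn => ENNReal.toReal_mono (measure_ne_top _ _) hn
  -- Each further block of time multiplies the probability by at most `1 - c / 2`, uniformly in `n`.
  have key : ∀ J : ℕ, ∃ L : ℕ, ∀ n ≥ L, P.real {ω | ∀ j ≤ L,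
      S (n : ℝ≥0) ω - S ((n - j : ℕ) : ℝ≥0) ω ≤ d} ≤ (1 - c / 2) ^ J := by
    intro J
    induction J with
    | zero => exact ⟨0, fun n _ => by simp⟩
    | succ J ih =>
      obtain ⟨L, hL⟩ := ih
      set q := (1 - c / 2) ^ J
      have hq : 0 < q := pow_pos (by linarith) J
      -- `M` is such that the walk rarely moves by `M` or more in the last `L` units of time. Then
      -- `l` is such that an increment over the preceding `l` units exceeds `d + M` with probability
      -- at least `c`.
      obtain ⟨M, hM0, hM⟩ : ∃ M : ℕ, 0 < M ∧
          (srwLaw D L).real {z | (M : ℝ) ≤ |(z : ℝ)|} ≤ c / 2 * q := by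
        have hlim : Tendsto (fun M : ℕ => L * unitVariance D / (M : ℝ) ^ 2) atTop (𝓝 0) :=
          Tendsto.div_atTop tendsto_const_nhds
            ((tendsto_pow_atTop two_ne_zero).comp tendsto_natCast_atTop_atTop)
        obtain ⟨M, hM, hM0⟩ := ((hlim.eventually_le_const
          (show (0 : ℝ) < c / 2 * q by positivity)).and (eventually_gt_atTop 0)).exists
        refine ⟨M, hM0, le_trans ?_ hM⟩
        refine ENNReal.toReal_le_of_le_ofReal ?_ (hS.chebyshev L (by exact_mod_cast hM0))
        exact div_nonneg (mul_nonneg (by positivity) (unitVariance_nonneg D)) (by positivity)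
      obtain ⟨l, hl, hlM⟩ : ∃ l : ℕ, c ≤ (srwLaw D l).real {z | (z : ℝ) ≤ -(1 * √l)} ∧
          (d : ℝ) + M + 1 ≤ √l :=
        (hc.and ((Real.tendsto_sqrt_atTop.comp tendsto_natCast_atTop_atTop).eventually_ge_atTop
          ((d : ℝ) + M + 1))).exists
      refine ⟨L + l, fun n hn => ?_⟩
      have hnl : n = (n - L - l) + l + L := by omega
      set m := n - L - l
      have e1 : n - L = m + l := by omega
      set B : Set Ω := {ω | S ((m + l : ℕ) : ℝ≥0) ω - S (m : ℝ≥0) ω ∈ {z : ℤ | z ≤ d + M}}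
      set F : Set Ω := {ω | ∀ j ≤ L, S (n : ℝ≥0) ω - S ((n - j : ℕ) : ℝ≥0) ω ≤ d}
      set G : Set Ω := {ω | S ((m + l + L : ℕ) : ℝ≥0) ω - S ((m + l : ℕ) : ℝ≥0) ω ∈
        {z : ℤ | (M : ℝ) ≤ |(z : ℝ)|}}
      -- Off `G`, the constraint at `j = L + l` forces the increment over the earlier block to be at
      -- most `d + M`. That event is independent of the constraints over the last `L` units, whence
      -- the bound `(1 - c) * q + c / 2 * q`.
      have hsub : {ω | ∀ j ≤ L + l, S (n : ℝ≥0) ω - S ((n - j : ℕ) : ℝ≥0) ω ≤ d} ⊆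
          (B ∩ F) ∪ G := by
        intro ω hω
        by_cases hG : ω ∈ G
        · exact Or.inr hG
        refine Or.inl ⟨?_, fun j hj => hω j (by omega)⟩
        have h1 := hω (L + l) le_rfl
        rw [← Nat.sub_sub] at h1
        change S (n : ℝ≥0) ω - S (m : ℝ≥0) ω ≤ d at h1
        have h2 : ¬ ((M : ℝ) ≤ |((S ((m + l + L : ℕ) : ℝ≥0) ω - S ((m + l : ℕ) : ℝ≥0) ω : ℤ) : ℝ)|) :=
          hG
        rw [not_le, abs_lt, ← hnl] at h2
        have h3 : -(M : ℤ) < S (n : ℝ≥0) ω - S ((m + l : ℕ) : ℝ≥0) ω := by exact_mod_cast h2.1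
        change S ((m + l : ℕ) : ℝ≥0) ω - S (m : ℝ≥0) ω ≤ d + M
        omega
      have hBpast : MeasurableSet[pastOf (incr S) (m + l)] B :=
        ((hS.measurable_eval_past le_rfl).sub (hS.measurable_eval_past (Nat.le_add_right m l)))
          (MeasurableSet.of_discrete (s := {z : ℤ | z ≤ d + M}))
      have hFfut : MeasurableSet[futureOf (incr S) (m + l)] F := by
        have : F = ⋂ j ∈ Finset.range (L + 1),
            {ω | ∑ i ∈ Finset.Ico (n - j) n, incr S i ω ≤ d} := by
          ext ω
          simp only [F, Set.mem_ofPred_eq, Set.mem_iInter, Finset.mem_range, Nat.lt_succ_iff,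
            sum_Ico_incr S (Nat.sub_le n _)]
        rw [this]
        refine Finset.measurableSet_biInter _ fun j hj => ?_
        rw [Finset.mem_range] at hj
        refine futureOf_anti (incr S) (show m + l ≤ n - j by omega) _ ?_
        exact measurable_sum_Ico_futureOf (n - j) n (MeasurableSet.of_discrete (s := {z | z ≤ d}))
      have hBF : P.real (B ∩ F) = P.real B * P.real F := by
        simp only [measureReal_def]
        rw [measure_pastOf_inter_futureOf hS.measurable_incr hS.iIndepFun_incr hBpast hFfut,
          ENNReal.toReal_mul]
      have hPB : P.real B ≤ 1 - c := by
        have e : P.real B = (srwLaw D l).real {z : ℤ | z ≤ d + M} := by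
          simp only [measureReal_def]
          congr 1
          refine (hS.measure_sub (by gcongr; omega) _).trans ?_
          congr 2
          push_cast
          rw [add_tsub_cancel_left]
        have e2 : (srwLaw D l).real {z : ℤ | z ≤ d + M} +
            (srwLaw D l).real {z : ℤ | d + M + 1 ≤ z} = 1 := by
          rw [← measureReal_union _ MeasurableSet.of_discrete]
          · convert probReal_univ (μ := srwLaw D l)
            ext z
            simp only [Set.mem_union, Set.mem_ofPred_eq, Set.mem_univ, iff_true]
            omega
          · refine Set.disjoint_left.2 fun z (h1 : z ≤ d + M) (h2 : d + M + 1 ≤ z) => by omega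
        have e3 : c ≤ (srwLaw D l).real {z : ℤ | d + M + 1 ≤ z} := by
          refine hl.trans ?_
          rw [measureReal_def, measureReal_def, srwLaw_le_neg]
          refine ENNReal.toReal_mono (measure_ne_top _ _) (measure_mono fun z hz => ?_)
          have hz' : (z : ℝ) ≤ -(1 * √l) := hz
          have : (z : ℝ) ≤ ((-(d + M + 1) : ℤ) : ℝ) := by
            push_cast
            linarith
          exact_mod_cast this
        rw [e]
        linarith
      have hPF : P.real F ≤ q := hL n (by omega)
      have hPG : P.real G ≤ c / 2 * q := by
        refine le_trans (le_of_eq ?_) hM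
        simp only [measureReal_def]
        congr 1
        refine (hS.measure_sub (Nat.cast_le.2 (by omega)) _).trans ?_
        congr 2
        push_cast
        rw [add_tsub_cancel_left]
      calc _ ≤ P.real (B ∩ F ∪ G) := measureReal_mono hsub
        _ ≤ P.real (B ∩ F) + P.real G := measureReal_union_le _ _
        _ ≤ (1 - c) * q + c / 2 * q := by
            rw [hBF]
            gcongr
        _ = (1 - c / 2) ^ (J + 1) := by
            rw [pow_succ]
            simp only [q]
            ring
  obtain ⟨J, hJ⟩ := exists_pow_lt_of_lt_one hε (show 1 - c / 2 < 1 by linarith)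
  obtain ⟨L, hL⟩ := key J
  exact ⟨L, fun n hn => (hL n hn).trans hJ.le⟩

end Walk

/-- Two walks have the same law at the integer times. -/
lemma IsSimpleRandomWalk.measure_skeleton_eq {Ω : Type*} [MeasurableSpace Ω] {P : Measure Ω}
    [IsProbabilityMeasure P] {D : ℝ≥0} {S S' : ℝ≥0 → Ω → ℤ} (hS : IsSimpleRandomWalk P D S)
    (hS' : IsSimpleRandomWalk P D S') {B : Set (ℕ → ℤ)} (hB : MeasurableSet B) :
    P {ω | (fun m : ℕ => S (m : ℝ≥0) ω) ∈ B} = P {ω | (fun m : ℕ => S' (m : ℝ≥0) ω) ∈ B} := by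
  set Φ : (ℕ → ℤ) → ℕ → ℤ := fun y m => ∑ i ∈ Finset.range m, y i
  have hΦ : Measurable Φ := measurable_pi_lambda _ fun m =>
    Finset.measurable_sum _ fun i _ => measurable_pi_apply i
  have key : ∀ {U : ℝ≥0 → Ω → ℤ}, IsSimpleRandomWalk P D U →
      P {ω | (fun m : ℕ => U (m : ℝ≥0) ω) ∈ B} =
        Measure.infinitePi (fun _ : ℕ => srwLaw D 1) (Φ ⁻¹' B) := by
    intro U hU
    have h := hU.iIndepFun_incr.map_fun_eq_infinitePi_map hU.measurable_incr
    simp_rw [fun i => (hU.identDistrib_incr i).map_eq] at h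
    rw [← h, Measure.map_apply (measurable_pi_lambda _ hU.measurable_incr) (hΦ hB)]
    congr 1
    ext ω
    simp only [Set.mem_ofPred_eq, Set.mem_preimage, Φ, hU.eval_eq_sum]
  rw [key hS, key hS']

/-! ### Combinatorics of a monotone front -/

/-- The sum telescopes to the last `L` values of `f (T + ·)` minus the first `L` values of `f`. -/
lemma sum_sub_shift_le {f : ℕ → ℕ} (hf : Monotone f) {K : ℕ} (hK : ∀ n, f n ≤ K) (L T : ℕ) :
    ∑ n ∈ Finset.range T, (f (L + n) - f n) ≤ L * K := by
  have h1 : ∑ n ∈ Finset.range T, (f (L + n) - f n) + ∑ n ∈ Finset.range T, f n =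
      ∑ n ∈ Finset.range T, f (L + n) := by
    rw [← Finset.sum_add_distrib]
    exact Finset.sum_congr rfl fun n _ => Nat.sub_add_cancel (hf (Nat.le_add_left n L))
  have h2 := Finset.sum_range_add f L T
  have h3 := Finset.sum_range_add f T L
  rw [add_comm T L] at h3
  have h4 : ∑ j ∈ Finset.range L, f (T + j) ≤ L * K := by
    simpa using Finset.sum_le_card_nsmul (Finset.range L) (fun j => f (T + j)) K fun j _ => hK _
  omega

open Classical in
/-- The integer times at which the front has moved during the last `L` units of time are few. -/
lemma card_recently_moved_le {f : ℕ → ℕ} (hf : Monotone f) {K : ℕ} (hK : ∀ n, f n ≤ K)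
    (L T : ℕ) :
    ((Finset.range T).filter fun n => n < L ∨ f (n - L) < f n).card ≤ L + L * K := by
  rw [Finset.card_filter]
  calc ∑ n ∈ Finset.range T, (if n < L ∨ f (n - L) < f n then 1 else 0)
      ≤ ∑ n ∈ Finset.range (L + T), (if n < L ∨ f (n - L) < f n then 1 else 0) :=
        Finset.sum_le_sum_of_subset (Finset.range_mono (Nat.le_add_left T L))
    _ = ∑ n ∈ Finset.range L, (if n < L ∨ f (n - L) < f n then 1 else 0) +
        ∑ n ∈ Finset.range T, (if L + n < L ∨ f (L + n - L) < f (L + n) then 1 else 0) :=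
        Finset.sum_range_add _ L T
    -- The first `L` times are counted trivially; afterwards the indicator of a move is at most the
    -- size of the move.
    _ ≤ L + ∑ n ∈ Finset.range T, (f (L + n) - f n) := by
        gcongr with n _
        · refine (Finset.sum_le_card_nsmul _ _ 1 fun n _ => ?_).trans (by simp)
          split_ifs <;> simp
        · rw [Nat.add_sub_cancel_left]
          split_ifs with h <;> omega
    _ ≤ L + L * K := by gcongr; exact sum_sub_shift_le hf hK L T

/-! ### Walks surviving a deterministic front -/

section Walk

variable {Ω : Type*} [MeasurableSpace Ω] {P : Measure Ω} {D : ℝ≥0}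
  {S : ℝ≥0 → Ω → ℤ}

/-- The event that the walk started at `a` survives the front `f` up to time `n` and is then
at `y`. -/
def surviveAt (S : ℝ≥0 → Ω → ℤ) (a : ℤ) (f : ℕ → ℕ) (n : ℕ) (y : ℤ) : Set Ω :=
  {ω | Survives f (fun t => a + S t ω) n ∧ a + S (n : ℝ≥0) ω = y}

/-- The event that the walk started at `a` survives the front `f` up to time `n` and then
visits `z` within one unit of time. -/
def surviveVisit (S : ℝ≥0 → Ω → ℤ) (a : ℤ) (f : ℕ → ℕ) (n : ℕ) (z : ℤ) : Set Ω :=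
  {ω | Survives f (fun t => a + S t ω) n ∧ Visits (fun t => a + S t ω) n z}

lemma IsSimpleRandomWalk.measurableSet_survives (hS : IsSimpleRandomWalk P D S) (a : ℤ)
    (f : ℕ → ℕ) (n : ℕ) :
    MeasurableSet[pastOf (incr S) n] {ω | Survives f (fun t => a + S t ω) n} := by
  have : {ω | Survives f (fun t => a + S t ω) n} =
      ⋂ m ∈ Finset.range (n + 1), {ω | S (m : ℝ≥0) ω ∈ {z : ℤ | (f m : ℤ) < a + z}} := by
    ext ω
    simp [Survives]
  rw [this]
  refine Finset.measurableSet_biInter _ fun m hm => ?_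
  exact hS.measurable_eval_past (Nat.lt_succ_iff.1 (Finset.mem_range.1 hm))
    (MeasurableSet.of_discrete (s := {z : ℤ | (f m : ℤ) < a + z}))

lemma IsSimpleRandomWalk.measurableSet_surviveAt_past (hS : IsSimpleRandomWalk P D S) (a : ℤ)
    (f : ℕ → ℕ) (n : ℕ) (y : ℤ) : MeasurableSet[pastOf (incr S) n] (surviveAt S a f n y) :=
  MeasurableSet.inter (hS.measurableSet_survives a f n)
    (hS.measurable_eval_past le_rfl (MeasurableSet.of_discrete (s := {z : ℤ | a + z = y})))

lemma IsSimpleRandomWalk.measurableSet_surviveAt (hS : IsSimpleRandomWalk P D S) (a : ℤ)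
    (f : ℕ → ℕ) (n : ℕ) (y : ℤ) : MeasurableSet (surviveAt S a f n y) :=
  pastOf_le hS.measurable_incr n _ (hS.measurableSet_surviveAt_past a f n y)

lemma surviveAt_eq_empty {Ω : Type*} {S : ℝ≥0 → Ω → ℤ} {a : ℤ} {f : ℕ → ℕ} {n : ℕ} {y : ℤ} (hy : y ≤ f n) :
    surviveAt S a f n y = ∅ := by
  refine Set.eq_empty_of_forall_notMem fun ω ⟨h1, h2⟩ => ?_
  have := h1 n le_rfl
  simp only at this
  omega

/-- Decomposition according to the position `y` at time `n`; the motion after `n` is independent of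
the survival up to `n`. -/
lemma IsSimpleRandomWalk.measure_surviveVisit_le (hS : IsSimpleRandomWalk P D S) (a : ℤ)
    (f : ℕ → ℕ) (n : ℕ) (z : ℤ) :
    P (surviveVisit S a f n z) ≤ ∑' y : ℤ, P (surviveAt S a f n y) * visitBound D (z - y) := by
  have hsub : surviveVisit S a f n z ⊆ ⋃ y : ℤ, surviveAt S a f n y ∩
      {ω | ∃ u : ℝ≥0, (n : ℝ≥0) ≤ u ∧ u ≤ n + 1 ∧ S u ω - S (n : ℝ≥0) ω = z - y} := by
    rintro ω ⟨h1, u, h2, h3, h4⟩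
    refine Set.mem_iUnion.2 ⟨a + S (n : ℝ≥0) ω, ⟨h1, rfl⟩, u, h2, h3, ?_⟩
    simp only at h4
    omega
  refine (measure_mono hsub).trans ((measure_iUnion_le _).trans ?_)
  exact ENNReal.tsum_le_tsum fun y =>
    hS.measure_past_visit_le n (hS.measurableSet_surviveAt_past a f n y) (z - y)

/-- Chebyshev's inequality gives a decay of order `1 / d ^ 2`; only `d = 0` needs the trivial bound.
-/
lemma IsSimpleRandomWalk.visitBound_summable [IsProbabilityMeasure P] (hS : IsSimpleRandomWalk P D S) :
    ∑' d : ℤ, visitBound D d ≠ ⊤ := by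
  have hb : ∀ d : ℤ, visitBound D d ≤
      ENNReal.ofReal (2 * unitVariance D * (1 / (d : ℝ) ^ 2)) + if d = 0 then 2 else 0 := by
    intro d
    split_ifs with hd
    · refine le_add_left ?_
      calc visitBound D d ≤ 2 * 1 := by
            rw [visitBound]
            gcongr
            exact prob_le_one
        _ = 2 := mul_one 2
    · rw [add_zero, visitBound, mul_assoc, ENNReal.ofReal_mul zero_le_two]
      have hd' : (0 : ℝ) < |(d : ℝ)| := abs_pos.2 (by exact_mod_cast hd)
      have h := hS.chebyshev 1 hd'
      rw [sq_abs, Nat.cast_one, Nat.cast_one, one_mul, div_eq_mul_one_div] at h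
      rw [ENNReal.ofReal_ofNat]
      gcongr
      refine (measure_mono fun z hz => ?_).trans h
      have hz' : z ≤ -|d| := hz
      have : |d| ≤ |z| := by
        rw [le_abs]
        right
        linarith
      change |(d : ℝ)| ≤ |(z : ℝ)|
      exact_mod_cast this
  refine ne_top_of_le_ne_top ?_ (ENNReal.tsum_le_tsum hb)
  rw [ENNReal.tsum_add, ENNReal.add_ne_top]
  refine ⟨?_, by rw [tsum_ite_eq]; exact ENNReal.ofNat_ne_top⟩
  exact Summable.tsum_ofReal_ne_top
    ((Real.summable_one_div_int_pow.2 one_lt_two).mul_left _)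

/-! ### The number of survivors near the front -/

section Family

variable {κ : Type*} {U : κ → ℝ≥0 → Ω → ℤ} {a : κ → ℤ}

/-- Walks with distinct starting points need distinct displacements to end at `y`, and these
displacements are disjoint events for a single walk. -/
lemma sum_surviveAt_le_one (hU : ∀ i, IsSimpleRandomWalk P D (U i)) (ha : Function.Injective a)
    (G : Finset κ) (f : ℕ → ℕ) (n : ℕ) (y : ℤ) :
    ∑ i ∈ G, P (surviveAt (U i) (a i) f n y) ≤ 1 := by
  classical
  have hinj : Set.InjOn (fun i => y - a i) G := fun i _ j _ hij => ha (by simpa using hij)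
  calc ∑ i ∈ G, P (surviveAt (U i) (a i) f n y) ≤ ∑ i ∈ G, srwLaw D n {y - a i} := by
        refine Finset.sum_le_sum fun i _ => ?_
        rw [← (hU i).measure_eval]
        refine measure_mono fun ω hω => ?_
        have := hω.2
        simp only [Set.mem_singleton_iff, Set.mem_ofPred_eq]
        omega
    _ = srwLaw D n (G.image fun i => y - a i) := by
        rw [← sum_measure_singleton, Finset.sum_image hinj]
    _ ≤ 1 := prob_le_one

lemma tsum_sub_left (g : ℤ → ℝ≥0∞) (z : ℤ) : ∑' y : ℤ, g (z - y) = ∑' d : ℤ, g d :=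
  (Equiv.subLeft z).tsum_eq g

lemma sum_surviveVisit_le (hU : ∀ i, IsSimpleRandomWalk P D (U i)) (G : Finset κ) (f : ℕ → ℕ)
    (n : ℕ) (z : ℤ) :
    ∑ i ∈ G, P (surviveVisit (U i) (a i) f n z) ≤
      ∑' y : ℤ, (∑ i ∈ G, P (surviveAt (U i) (a i) f n y)) * visitBound D (z - y) := by
  refine (Finset.sum_le_sum fun i _ => (hU i).measure_surviveVisit_le (a i) f n z).trans ?_
  rw [← Summable.tsum_finsetSum fun _ _ => ENNReal.summable]
  simp_rw [Finset.sum_mul]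
  exact le_rfl

lemma sum_surviveVisit_le_total [IsProbabilityMeasure P] (hU : ∀ i, IsSimpleRandomWalk P D (U i))
    (ha : Function.Injective a) (G : Finset κ) (f : ℕ → ℕ) (n : ℕ) (z : ℤ) :
    ∑ i ∈ G, P (surviveVisit (U i) (a i) f n z) ≤ ∑' d : ℤ, visitBound D d := by
  refine (sum_surviveVisit_le hU G f n z).trans ?_
  rw [← tsum_sub_left (visitBound D) z]
  refine ENNReal.tsum_le_tsum fun y => ?_
  exact mul_le_of_le_one_left' (sum_surviveAt_le_one hU ha G f n y)

/-- Every walk is replaced by the same walk `S`. Ending at `y` from different starting points gives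
disjoint events, so the sum becomes one probability. As the front is at `f n` throughout the last
`L` units of time, survival means that the path, read backwards from `y`, stays above `f n`. This is
a bound on the backward increments of `S` that does not involve the starting point. -/
lemma sum_surviveAt_le_reversed [IsProbabilityMeasure P] (hU : ∀ i, IsSimpleRandomWalk P D (U i))
    (ha : Function.Injective a) (hS : IsSimpleRandomWalk P D S)
    (G : Finset κ) {f : ℕ → ℕ} (hf : Monotone f) {n L : ℕ} (hfL : f (n - L) = f n)
    (y : ℤ) :
    ∑ i ∈ G, P (surviveAt (U i) (a i) f n y) ≤
      P {ω | ∀ j ≤ L, S (n : ℝ≥0) ω - S ((n - j : ℕ) : ℝ≥0) ω ≤ y - f n - 1} := by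
  set B : κ → Set (ℕ → ℤ) := fun i =>
    {s | (∀ j ≤ L, s n - s (n - j) ≤ y - f n - 1) ∧ s n = y - a i}
  have hB : ∀ i, MeasurableSet (B i) := fun i => by
    refine MeasurableSet.inter ?_ ?_
    · have : {s : ℕ → ℤ | ∀ j ≤ L, s n - s (n - j) ≤ y - f n - 1} =
          ⋂ j ∈ Finset.range (L + 1), {s | s n - s (n - j) ≤ y - f n - 1} := by
        ext s
        simp
      change MeasurableSet {s : ℕ → ℤ | ∀ j ≤ L, s n - s (n - j) ≤ y - f n - 1}
      rw [this]
      refine Finset.measurableSet_biInter _ fun j _ => ?_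
      have hm : Measurable fun s : ℕ → ℤ => s n - s (n - j) :=
        (measurable_pi_apply n).sub (measurable_pi_apply (n - j))
      exact hm (MeasurableSet.of_discrete (s := {z : ℤ | z ≤ y - f n - 1}))
    · have hm : Measurable fun s : ℕ → ℤ => s n := measurable_pi_apply n
      exact hm (MeasurableSet.of_discrete (s := {z : ℤ | z = y - a i}))
  have hBm : ∀ i, MeasurableSet {ω | (fun m : ℕ => S (m : ℝ≥0) ω) ∈ B i} := fun i =>
    (measurable_pi_lambda (fun ω (m : ℕ) => S (m : ℝ≥0) ω) fun m => hS.measurable _) (hB i)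
  have hdisj : Set.PairwiseDisjoint (G : Set κ)
      fun i => {ω | (fun m : ℕ => S (m : ℝ≥0) ω) ∈ B i} := by
    intro i _ j _ hij
    refine Set.disjoint_left.2 fun ω h1 h2 => hij (ha ?_)
    have e1 : S (n : ℝ≥0) ω = y - a i := h1.2
    have e2 : S (n : ℝ≥0) ω = y - a j := h2.2
    omega
  calc ∑ i ∈ G, P (surviveAt (U i) (a i) f n y)
      ≤ ∑ i ∈ G, P {ω | (fun m : ℕ => S (m : ℝ≥0) ω) ∈ B i} := by
        refine Finset.sum_le_sum fun i _ => ?_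
        rw [← (hU i).measure_skeleton_eq hS (hB i)]
        refine measure_mono fun ω hω => ⟨fun j hj => ?_, ?_⟩
        · have h1 := hω.1 (n - j) (Nat.sub_le n j)
          have h2 : f n ≤ f (n - j) := hfL ▸ hf (by omega)
          have h3 := hω.2
          simp only at h1 ⊢
          omega
        · have := hω.2
          simp only
          omega
    _ = P (⋃ i ∈ G, {ω | (fun m : ℕ => S (m : ℝ≥0) ω) ∈ B i}) :=
        (measure_biUnion_finset hdisj fun i _ => hBm i).symm
    _ ≤ _ := measure_mono (Set.iUnion₂_subset fun i _ ω hω => hω.1)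

open Classical in
lemma exists_tail_le {g : ℤ → ℝ≥0∞} (hg : ∑' d, g d ≠ ⊤) {δ : ℝ≥0∞} (hδ : 0 < δ) :
    ∃ m : ℕ, ∑' d : ℤ, (if (m : ℤ) < |d| then g d else 0) ≤ δ := by
  obtain ⟨s, hs⟩ := ((ENNReal.tendsto_tsum_compl_atTop_zero hg).eventually_le_const hδ).exists
  refine ⟨s.sup Int.natAbs, le_trans ?_ hs⟩
  refine le_trans ?_ (tsum_subtype {x | x ∉ s} g).ge
  refine ENNReal.tsum_le_tsum fun d => ?_
  split_ifs with h
  · rw [Set.indicator_of_mem]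
    intro hd
    have : d.natAbs ≤ s.sup Int.natAbs := Finset.le_sup (f := Int.natAbs) hd
    rw [Int.abs_eq_natAbs] at h
    omega
  · exact zero_le

/-- Long after the last move of the front, the survivors near the front are few. -/
lemma exists_sum_surviveVisit_le [IsProbabilityMeasure P] (hU : ∀ i, IsSimpleRandomWalk P D (U i))
    (ha : Function.Injective a) (hS : IsSimpleRandomWalk P D S) (hD : 0 < D) {δ : ℝ≥0∞}
    (hδ : 0 < δ) : ∃ L : ℕ, ∀ (G : Finset κ) (f : ℕ → ℕ), Monotone f → ∀ n ≥ L,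
      f (n - L) = f n → ∑ i ∈ G, P (surviveVisit (U i) (a i) f n ((f n : ℤ) + 1)) ≤ δ := by
  classical
  have hC := hS.visitBound_summable
  have hδ2 : 0 < δ / 2 := ENNReal.half_pos hδ.ne'
  -- Positions at distance more than `m` from the site contribute at most `δ / 2` through the tail
  -- of `visitBound`. At the nearer ones the density of survivors is at most `e`, which contributes
  -- the other `δ / 2`.
  obtain ⟨m, hm⟩ := exists_tail_le hC hδ2
  obtain ⟨e, he0, he⟩ := ENNReal.exists_nnreal_pos_mul_lt hC hδ2.ne'
  obtain ⟨L, hL⟩ := hS.exists_reversed_le hD m (ε := e) (by exact_mod_cast he0)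
  refine ⟨L, fun G f hf n hn hfL => ?_⟩
  set z : ℤ := (f n : ℤ) + 1
  have hrev : ∀ d : ℤ, d ≤ m →
      P {ω | ∀ j ≤ L, S (n : ℝ≥0) ω - S ((n - j : ℕ) : ℝ≥0) ω ≤ d} ≤ e := fun d hd => by
    have h1 := hL n hn
    rw [measureReal_def] at h1
    have h2 : P {ω | ∀ j ≤ L, S (n : ℝ≥0) ω - S ((n - j : ℕ) : ℝ≥0) ω ≤ (m : ℤ)} ≤ e := by
      rw [← ENNReal.ofReal_coe_nnreal]
      exact ENNReal.le_ofReal_iff_toReal_le (measure_ne_top _ _) e.2 |>.2 h1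
    exact (measure_mono fun ω hω j hj => (hω j hj).trans hd).trans h2
  have hterm : ∀ y : ℤ, (∑ i ∈ G, P (surviveAt (U i) (a i) f n y)) * visitBound D (z - y) ≤
      e * visitBound D (z - y) + if (m : ℤ) < |z - y| then visitBound D (z - y) else 0 := by
    intro y
    rcases le_or_gt y (f n) with hy | hy
    · simp [surviveAt_eq_empty hy]
    rcases le_or_gt (y - z) m with hym | hym
    · refine le_add_right ?_
      gcongr
      refine (sum_surviveAt_le_reversed hU ha hS G hf hfL y).trans (hrev _ ?_)
      omega
    · refine le_add_left ?_
      rw [if_pos (by rw [abs_sub_comm]; exact hym.trans_le (le_abs_self _))]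
      exact mul_le_of_le_one_left' (sum_surviveAt_le_one hU ha G f n y)
  calc _ ≤ _ := sum_surviveVisit_le hU G f n z
    _ ≤ _ := ENNReal.tsum_le_tsum hterm
    _ = e * ∑' d : ℤ, visitBound D d +
        ∑' d : ℤ, (if (m : ℤ) < |d| then visitBound D d else 0) := by
        rw [ENNReal.tsum_add, ENNReal.tsum_mul_left, tsum_sub_left,
          tsum_sub_left (fun d => if (m : ℤ) < |d| then visitBound D d else 0)]
    _ ≤ δ / 2 + δ / 2 := add_le_add he.le hm
    _ = δ := ENNReal.add_halves δ

end Family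

/-! ### The expected time near the front -/

/-- One more unit of time for one more step down: it turns reaching the site just above the front
into ending at or below the front, at the cost of a constant factor. -/
lemma IsSimpleRandomWalk.srwLaw_two_ge (hS : IsSimpleRandomWalk P D S) (e : ℤ) :
    srwLaw D 1 {z | z ≤ -e} * srwLaw D 1 {z | z ≤ -1} ≤ srwLaw D 2 {z | z ≤ -e - 1} := by
  have hB : MeasurableSet[pastOf (incr S) 1] {ω | S ((1 : ℕ) : ℝ≥0) ω ∈ {z : ℤ | z ≤ -e}} :=
    hS.measurable_eval_past le_rfl (MeasurableSet.of_discrete (s := {z : ℤ | z ≤ -e}))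
  have h := hS.measure_past_inter (l := 1) hB {z | z ≤ -1}
  rw [hS.measure_eval, Nat.cast_one] at h
  rw [← h, ← hS.measure_eval]
  refine measure_mono fun ω ⟨h1, h2⟩ => ?_
  have h1' : S (1 : ℝ≥0) ω ≤ -e := by simpa using h1
  have h2' : S ((1 + 1 : ℕ) : ℝ≥0) ω - S (1 : ℝ≥0) ω ≤ -1 := by simpa using h2
  rw [show ((1 + 1 : ℕ) : ℝ≥0) = 2 by norm_num] at h2'
  change S 2 ω ≤ _
  omega

/-- The event that the walk started at `a` survives the front `f` up to time `n` and is not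
above its level at time `n + 2`. -/
def killedAfter (S : ℝ≥0 → Ω → ℤ) (a : ℤ) (f : ℕ → ℕ) (n : ℕ) : Set Ω :=
  {ω | Survives f (fun t => a + S t ω) n ∧ a + S ((n + 2 : ℕ) : ℝ≥0) ω ≤ f n}

lemma IsSimpleRandomWalk.measurableSet_killedAfter (hS : IsSimpleRandomWalk P D S) (a : ℤ)
    (f : ℕ → ℕ) (n : ℕ) : MeasurableSet (killedAfter S a f n) :=
  (pastOf_le hS.measurable_incr n _ (hS.measurableSet_survives a f n)).inter
    (hS.measurable _ (MeasurableSet.of_discrete (s := {z : ℤ | a + z ≤ f n})))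

/-- A visit next to the front has a probability comparable with that of being at or below the level
`f n` at time `n + 2`. The `2` is the factor of the maximal inequality in `visitBound`. -/
lemma IsSimpleRandomWalk.surviveVisit_mul_le (hS : IsSimpleRandomWalk P D S) (a : ℤ)
    (f : ℕ → ℕ) (n : ℕ) :
    P (surviveVisit S a f n ((f n : ℤ) + 1)) * srwLaw D 1 {z | z ≤ -1} ≤
      2 * P (killedAfter S a f n) := by
  set E : ℤ → Set Ω := fun y => surviveAt S a f n y ∩
    {ω | S ((n + 2 : ℕ) : ℝ≥0) ω - S (n : ℝ≥0) ω ∈ {z : ℤ | z ≤ f n - y}}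
  have hE : ∀ y, P (E y) = P (surviveAt S a f n y) * srwLaw D 2 {z | z ≤ f n - y} := fun y => by
    have := hS.measure_past_inter (l := 2) (hS.measurableSet_surviveAt_past a f n y)
      {z : ℤ | z ≤ f n - y}
    rw [this]
    norm_num
  have hEm : ∀ y, MeasurableSet (E y) := fun y =>
    (hS.measurableSet_surviveAt a f n y).inter
      (((hS.measurable _).sub (hS.measurable _))
        (MeasurableSet.of_discrete (s := {z : ℤ | z ≤ f n - y})))
  have hdisj : Pairwise (Function.onFun Disjoint E) := fun y y' hyy => by
    refine Set.disjoint_left.2 fun ω h1 h2 => hyy ?_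
    exact h1.1.2.symm.trans h2.1.2
  have hterm : ∀ y : ℤ, P (surviveAt S a f n y) * visitBound D ((f n : ℤ) + 1 - y) *
      srwLaw D 1 {z | z ≤ -1} ≤ 2 * P (E y) := fun y => by
    rcases le_or_gt y (f n) with hy | hy
    · simp [surviveAt_eq_empty hy]
    rw [hE, visitBound, mul_assoc, mul_assoc, mul_left_comm]
    gcongr
    rw [abs_of_nonpos (by omega)]
    refine (hS.srwLaw_two_ge _).trans (measure_mono fun z hz => ?_)
    have hz' : z ≤ -(-((f n : ℤ) + 1 - y)) - 1 := hz
    change z ≤ _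
    omega
  calc _ ≤ (∑' y : ℤ, P (surviveAt S a f n y) * visitBound D ((f n : ℤ) + 1 - y)) *
        srwLaw D 1 {z | z ≤ -1} := by
        gcongr
        exact hS.measure_surviveVisit_le a f n _
    _ = ∑' y : ℤ, P (surviveAt S a f n y) * visitBound D ((f n : ℤ) + 1 - y) *
        srwLaw D 1 {z | z ≤ -1} := ENNReal.tsum_mul_right.symm
    _ ≤ ∑' y : ℤ, 2 * P (E y) := ENNReal.tsum_le_tsum hterm
    _ = 2 * P (⋃ y, E y) := by rw [ENNReal.tsum_mul_left, measure_iUnion hdisj hEm]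
    _ ≤ _ := by
        gcongr
        refine Set.iUnion_subset fun y ω hω => ⟨hω.1.1, ?_⟩
        have h1 := hω.1.2
        have h2 : S ((n + 2 : ℕ) : ℝ≥0) ω - S (n : ℝ≥0) ω ≤ f n - y := hω.2
        omega

/-- If the event occurs first at `k`, then at time `k + 2` the walk is not above the monotone front,
so it does not survive up to any later time. Only `k` and `k + 1` can count. -/
lemma IsSimpleRandomWalk.sum_killedAfter_le [IsProbabilityMeasure P] (hS : IsSimpleRandomWalk P D S) (a : ℤ)
    {f : ℕ → ℕ} (hf : Monotone f) (T : ℕ) :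
    ∑ n ∈ Finset.range T, P (killedAfter S a f n) ≤ 2 := by
  classical
  have hpt : ∀ ω, ∑ n ∈ Finset.range T, (killedAfter S a f n).indicator (1 : Ω → ℝ≥0∞) ω ≤ 2 := by
    intro ω
    have e : ∑ n ∈ Finset.range T, (killedAfter S a f n).indicator (1 : Ω → ℝ≥0∞) ω =
        (((Finset.range T).filter fun n => ω ∈ killedAfter S a f n).card : ℝ≥0∞) := by
      rw [Finset.card_filter, Nat.cast_sum]
      refine Finset.sum_congr rfl fun n _ => ?_
      simp [Set.indicator_apply]
    rw [e]
    rcases ((Finset.range T).filter fun n => ω ∈ killedAfter S a f n).eq_empty_or_nonempty with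
      h | h
    · simp [h]
    · set k := ((Finset.range T).filter fun n => ω ∈ killedAfter S a f n).min' h
      have hk : ω ∈ killedAfter S a f k := (Finset.mem_filter.1 (Finset.min'_mem _ h)).2
      have hsub : ((Finset.range T).filter fun n => ω ∈ killedAfter S a f n) ⊆ {k, k + 1} := by
        intro n hn
        have hkn : k ≤ n := Finset.min'_le _ _ hn
        have hlt : n < k + 2 := by
          by_contra! hge
          have h1 := (Finset.mem_filter.1 hn).2.1 (k + 2) hge
          have h2 := hk.2
          have h3 : f k ≤ f (k + 2) := hf (by omega)
          simp only at h1
          omega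
        simp only [Finset.mem_insert, Finset.mem_singleton]
        omega
      exact_mod_cast (Finset.card_le_card hsub).trans Finset.card_le_two
  calc ∑ n ∈ Finset.range T, P (killedAfter S a f n)
      = ∑ n ∈ Finset.range T, ∫⁻ ω, (killedAfter S a f n).indicator (1 : Ω → ℝ≥0∞) ω ∂P := by
        refine Finset.sum_congr rfl fun n _ => ?_
        rw [lintegral_indicator_one (hS.measurableSet_killedAfter a f n)]
    _ = ∫⁻ ω, ∑ n ∈ Finset.range T, (killedAfter S a f n).indicator (1 : Ω → ℝ≥0∞) ω ∂P :=
        (lintegral_finsetSum _ fun n _ =>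
          measurable_one.indicator (hS.measurableSet_killedAfter a f n)).symm
    _ ≤ ∫⁻ _, 2 ∂P := lintegral_mono hpt
    _ = 2 := by simp

/-- The expected time that one walk spends next to the front is bounded whatever the front, the
starting point and `T`. -/
lemma IsSimpleRandomWalk.sum_surviveVisit_front_le [IsProbabilityMeasure P] (hS : IsSimpleRandomWalk P D S) (hD : 0 < D)
    (a : ℤ) {f : ℕ → ℕ} (hf : Monotone f) (T : ℕ) :
    ∑ n ∈ Finset.range T, P (surviveVisit S a f n ((f n : ℤ) + 1)) ≤
      4 / srwLaw D 1 {z | z ≤ -1} := by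
  rw [ENNReal.le_div_iff_mul_le (Or.inl (srwLaw_le_neg_one_pos hD one_pos).ne')
    (Or.inl (measure_ne_top _ _)), Finset.sum_mul]
  calc _ ≤ ∑ n ∈ Finset.range T, 2 * P (killedAfter S a f n) :=
        Finset.sum_le_sum fun n _ => hS.surviveVisit_mul_le a f n
    _ ≤ 2 * 2 := by
        rw [← Finset.mul_sum]
        gcongr
        exact hS.sum_killedAfter_le a hf T
    _ = 4 := by norm_num

/-- For a deterministic front that makes few moves, few pairs of independent walks survive and
then meet at the front. -/
lemma exists_sum_sq_le [IsProbabilityMeasure P] {κ : Type*} {U : κ → ℝ≥0 → Ω → ℤ} {a : κ → ℤ}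
    (hU : ∀ i, IsSimpleRandomWalk P D (U i)) (ha : Function.Injective a)
    (hS : IsSimpleRandomWalk P D S) (hD : 0 < D) {δ : ℝ≥0∞} (hδ : 0 < δ) :
    ∃ L : ℕ, ∀ (G : Finset κ) (f : ℕ → ℕ) (K T : ℕ), Monotone f → (∀ n, f n ≤ K) →
      ∑ n ∈ Finset.range T, ∑ z ∈ Finset.Ioc (f n) (f (n + 1) + 1),
        (∑ i ∈ G, P (surviveVisit (U i) (a i) f n z)) ^ 2 ≤
      (∑' d : ℤ, visitBound D d) ^ 2 * (K + (L + L * K) : ℕ) +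
        δ * (G.card * (4 / srwLaw D 1 {z | z ≤ -1})) := by
  classical
  obtain ⟨L, hL⟩ := exists_sum_surviveVisit_le hU ha hS hD hδ
  refine ⟨L, fun G f K T hf hK => ?_⟩
  set C := ∑' d : ℤ, visitBound D d
  set A : ℕ → ℕ → ℝ≥0∞ := fun n z => ∑ i ∈ G, P (surviveVisit (U i) (a i) f n z)
  have hAC : ∀ n z, A n z ≤ C := fun n z => sum_surviveVisit_le_total hU ha G f n z
  -- Sites beyond `f n + 1` enter only when the front moves, as many as it advances, so over all
  -- times there are at most `K` of them.
  have hsplit : ∀ n, ∑ z ∈ Finset.Ioc (f n) (f (n + 1) + 1), A n z ^ 2 ≤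
      A n (f n + 1) ^ 2 + (f (n + 1) - f n : ℕ) * C ^ 2 := by
    intro n
    have hle : f n ≤ f (n + 1) := hf (Nat.le_succ n)
    have : Finset.Ioc (f n) (f (n + 1) + 1) =
        insert (f n + 1) (Finset.Ioc (f n + 1) (f (n + 1) + 1)) := by
      ext z
      simp only [Finset.mem_Ioc, Finset.mem_insert]
      omega
    rw [this, Finset.sum_insert (by simp)]
    gcongr
    refine (Finset.sum_le_card_nsmul _ _ (C ^ 2) fun z _ => ?_).trans ?_
    · gcongr
      exact hAC n z
    · rw [Nat.card_Ioc, nsmul_eq_mul, Nat.add_sub_add_right]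
  -- At the site next to the front, both factors are bounded by `C` if the front has moved recently;
  -- otherwise one factor is at most `δ`, and the other is kept to be summed over time.
  have hfront : ∀ n, A n (f n + 1) ^ 2 ≤
      (if n < L ∨ f (n - L) < f n then 1 else 0 : ℕ) * C ^ 2 + δ * A n (f n + 1) := by
    intro n
    split_ifs with h
    · rw [Nat.cast_one, one_mul]
      refine le_add_right ?_
      gcongr
      exact hAC n _
    · push Not at h
      refine le_add_left ?_
      rw [sq]
      gcongr
      have := hL G f hf n h.1 (le_antisymm (hf (Nat.sub_le n L)) h.2)
      simpa [A] using this
  have hmoves : ∑ n ∈ Finset.range T, (f (n + 1) - f n) ≤ K := by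
    rw [Finset.sum_range_tsub hf]
    exact (Nat.sub_le _ _).trans (hK T)
  have hrec := card_recently_moved_le hf hK L T
  rw [Finset.card_filter] at hrec
  have hlast : ∑ n ∈ Finset.range T, A n (f n + 1) ≤
      G.card * (4 / srwLaw D 1 {z | z ≤ -1}) := by
    simp only [A]
    rw [Finset.sum_comm, ← nsmul_eq_mul]
    refine Finset.sum_le_card_nsmul _ _ _ fun i _ => ?_
    push_cast
    exact (hU i).sum_surviveVisit_front_le hD (a i) hf T
  calc ∑ n ∈ Finset.range T, ∑ z ∈ Finset.Ioc (f n) (f (n + 1) + 1), A n z ^ 2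
      ≤ ∑ n ∈ Finset.range T, (((if n < L ∨ f (n - L) < f n then 1 else 0 : ℕ) * C ^ 2 +
          δ * A n (f n + 1)) + (f (n + 1) - f n : ℕ) * C ^ 2) := by
        refine Finset.sum_le_sum fun n _ => (hsplit n).trans ?_
        gcongr
        exact hfront n
    _ = ((∑ n ∈ Finset.range T, (if n < L ∨ f (n - L) < f n then 1 else 0) : ℕ) : ℝ≥0∞) * C ^ 2 +
        δ * ∑ n ∈ Finset.range T, A n (f n + 1) +
        ((∑ n ∈ Finset.range T, (f (n + 1) - f n) : ℕ) : ℝ≥0∞) * C ^ 2 := by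
        rw [Finset.sum_add_distrib, Finset.sum_add_distrib, Nat.cast_sum, Nat.cast_sum,
          Finset.sum_mul, Finset.sum_mul, Finset.mul_sum]
    _ ≤ ((L + L * K : ℕ) : ℝ≥0∞) * C ^ 2 + δ * (G.card * (4 / srwLaw D 1 {z | z ≤ -1})) +
        (K : ℝ≥0∞) * C ^ 2 := by
        gcongr
    _ = _ := by
        push_cast
        ring

end Walk

/-! ### The particle system -/

/-- The hypotheses on the particle system. -/
structure IsSystem {Ω : Type*} [MeasurableSpace Ω] (P : Measure Ω) (D : ℝ≥0) (N : ℕ+ → Ω → ℕ)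
    (S : ℕ+ × ℕ → ℝ≥0 → Ω → ℤ) : Prop where
  rate_pos : 0 < D
  measurable_N : ∀ i, Measurable (N i)
  indep_N : iIndepFun N P
  ident_N : ∀ i j, IdentDistrib (N i) (N j) P P
  sq_N : ∀ i, Integrable (fun ω => (N i ω : ℝ) ^ 2) P
  pos_N : ∀ i, 0 < ∫ ω, (N i ω : ℝ) ^ 2 ∂P
  walk : ∀ ρ, IsSimpleRandomWalk P D (S ρ)
  indep_S : iIndepFun (fun (ρ : ℕ+ × ℕ) (ω : Ω) (t : ℝ≥0) => S ρ t ω) P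
  indep_NS : IndepFun (fun (ω : Ω) (i : ℕ+) => N i ω)
    (fun (ω : Ω) (ρ : ℕ+ × ℕ) (t : ℝ≥0) => S ρ t ω) P

/-- The particles that are present. -/
def present {Ω : Type*} (N : ℕ+ → Ω → ℕ) (ω : Ω) : Set (ℕ+ × ℕ) := {ρ | ρ.2 < N ρ.1 ω}

/-- The positions of the particles. -/
def position {Ω : Type*} (S : ℕ+ × ℕ → ℝ≥0 → Ω → ℤ) (ω : Ω) (ρ : ℕ+ × ℕ) (s : ℝ≥0) : ℤ :=
  ((ρ.1 : ℕ) : ℤ) + S ρ s ω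

/-- The σ-algebras of the independent sources of randomness. -/
@[reducible] def sourceAlg {Ω : Type*} (N : ℕ+ → Ω → ℕ) (S : ℕ+ × ℕ → ℝ≥0 → Ω → ℤ) :
    ℕ+ ⊕ (ℕ+ × ℕ) → MeasurableSpace Ω
  | Sum.inl i => MeasurableSpace.comap (N i) inferInstance
  | Sum.inr ρ => MeasurableSpace.comap (fun ω t => S ρ t ω) inferInstance

/-- The σ-algebra generated by a set of sources of randomness. -/
@[reducible] def algOn {Ω : Type*} (N : ℕ+ → Ω → ℕ) (S : ℕ+ × ℕ → ℝ≥0 → Ω → ℤ)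
    (I : Set (ℕ+ ⊕ (ℕ+ × ℕ))) : MeasurableSpace Ω :=
  ⨆ s ∈ I, sourceAlg N S s

lemma sourceAlg_le_algOn {Ω : Type*} (N : ℕ+ → Ω → ℕ) (S : ℕ+ × ℕ → ℝ≥0 → Ω → ℤ)
    {I : Set (ℕ+ ⊕ (ℕ+ × ℕ))} {s : ℕ+ ⊕ (ℕ+ × ℕ)} (hs : s ∈ I) :
    sourceAlg N S s ≤ algOn N S I :=
  le_iSup₂ (f := fun s (_ : s ∈ I) => sourceAlg N S s) s hs

lemma measurable_N_algOn {Ω : Type*} (N : ℕ+ → Ω → ℕ) (S : ℕ+ × ℕ → ℝ≥0 → Ω → ℤ)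
    {I : Set (ℕ+ ⊕ (ℕ+ × ℕ))} {i : ℕ+} (hi : Sum.inl i ∈ I) : Measurable[algOn N S I] (N i) :=
  (comap_measurable (N i)).mono (sourceAlg_le_algOn N S hi) le_rfl

lemma measurable_S_algOn {Ω : Type*} (N : ℕ+ → Ω → ℕ) (S : ℕ+ × ℕ → ℝ≥0 → Ω → ℤ)
    {I : Set (ℕ+ ⊕ (ℕ+ × ℕ))} {ρ : ℕ+ × ℕ} (hρ : Sum.inr ρ ∈ I) (t : ℝ≥0) :
    Measurable[algOn N S I] (S ρ t) := by
  have h : Measurable[sourceAlg N S (Sum.inr ρ)] fun ω t => S ρ t ω :=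
    comap_measurable _
  exact ((measurable_pi_apply t).comp h).mono (sourceAlg_le_algOn N S hρ) le_rfl

/-! ### Measurability of path events -/

section Measurability

variable {Ω : Type*} [MeasurableSpace Ω] {S : ℝ≥0 → Ω → ℤ}

lemma measurableSet_exists_mem (hS : ∀ t, Measurable (S t))
    (hreg : ∀ ω, RegularPath fun t => S t ω) (a b : ℝ≥0) (E : Set ℤ) :
    MeasurableSet {ω | ∃ u, a ≤ u ∧ u ≤ b ∧ S u ω ∈ E} := by
  rcases lt_or_ge b a with hab | hab
  · convert MeasurableSet.empty
    ext ω
    simp only [Set.mem_ofPred_eq, Set.mem_empty_iff_false, iff_false]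
    rintro ⟨u, h1, h2, -⟩
    exact absurd (h1.trans h2) (not_le.2 hab)
  have : {ω | ∃ u, a ≤ u ∧ u ≤ b ∧ S u ω ∈ E} = {ω | S b ω ∈ E} ∪
      ⋃ (q : ℚ) (_ : a ≤ ratTime q ∧ ratTime q ≤ b), {ω | S (ratTime q) ω ∈ E} := by
    ext ω
    simp only [Set.mem_ofPred_eq, Set.mem_union, Set.mem_iUnion]
    constructor
    · rintro ⟨u, h1, h2, h3⟩
      rcases h2.lt_or_eq with h | rfl
      · obtain ⟨d, hd, hdx⟩ := (mem_nhdsGE_iff_exists_Ico_subset' h).1 ((hreg ω).right u)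
        have hd' : u < d := hd
        obtain ⟨q, hq1, hq2⟩ := exists_ratTime_btwn (lt_min hd' h)
        have e : S (ratTime q) ω = S u ω := hdx ⟨hq1.le, hq2.trans_le (min_le_left _ _)⟩
        exact Or.inr ⟨q, ⟨h1.trans hq1.le, (hq2.trans_le (min_le_right _ _)).le⟩, e ▸ h3⟩
      · exact Or.inl h3
    · rintro (h | ⟨q, ⟨h1, h2⟩, h3⟩)
      · exact ⟨b, hab, le_rfl, h⟩
      · exact ⟨_, h1, h2, h3⟩
  rw [this]
  exact (hS b MeasurableSet.of_discrete).union (MeasurableSet.iUnion fun q =>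
    MeasurableSet.iUnion fun _ => hS _ MeasurableSet.of_discrete)

/-- The event that a process moves during `[a, a + l]`. -/
def moves (S : ℝ≥0 → Ω → ℤ) (a l : ℝ≥0) : Set Ω := {ω | ∃ u, a ≤ u ∧ u ≤ a + l ∧ S u ω ≠ S a ω}

lemma measurableSet_moves (hS : ∀ t, Measurable (S t))
    (hreg : ∀ ω, RegularPath fun t => S t ω) (a l : ℝ≥0) : MeasurableSet (moves S a l) := by
  have : moves S a l = ⋃ z : ℤ, {ω | S a ω = z} ∩ {ω | ∃ u, a ≤ u ∧ u ≤ a + l ∧ S u ω ∈ ({z}ᶜ : Set ℤ)} := by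
    ext ω
    simp [moves]
  rw [this]
  exact MeasurableSet.iUnion fun z => (hS a (MeasurableSet.of_discrete (s := {z}))).inter
    (measurableSet_exists_mem hS hreg a (a + l) _)

lemma measurableSet_surviveVisit (hS : ∀ t, Measurable (S t))
    (hreg : ∀ ω, RegularPath fun t => S t ω) (a : ℤ) (f : ℕ → ℕ) (n : ℕ) (z : ℤ) :
    MeasurableSet (surviveVisit S a f n z) := by
  refine MeasurableSet.inter ?_ ?_
  · have : {ω | Survives f (fun t => a + S t ω) n} =
        ⋂ m ∈ Finset.range (n + 1), {ω | S (m : ℝ≥0) ω ∈ {z : ℤ | (f m : ℤ) < a + z}} := by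
      ext ω
      simp [Survives]
    change MeasurableSet {ω | Survives f (fun t => a + S t ω) n}
    rw [this]
    exact Finset.measurableSet_biInter _ fun m _ => hS m MeasurableSet.of_discrete
  · exact measurableSet_exists_mem hS hreg n (n + 1) {y | a + y = z}

end Measurability

section System

variable {Ω : Type*} [mΩ : MeasurableSpace Ω] {P : Measure Ω} {D : ℝ≥0} {N : ℕ+ → Ω → ℕ}
  {S : ℕ+ × ℕ → ℝ≥0 → Ω → ℤ}

lemma IsSystem.sourceAlg_le (h : IsSystem P D N S) (s : ℕ+ ⊕ (ℕ+ × ℕ)) :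
    sourceAlg N S s ≤ mΩ := by
  rcases s with i | ρ
  · exact (h.measurable_N i).comap_le
  · exact (measurable_pi_lambda _ fun t => (h.walk ρ).measurable t).comap_le

lemma IsSystem.algOn_le (h : IsSystem P D N S) (I : Set (ℕ+ ⊕ (ℕ+ × ℕ))) :
    algOn N S I ≤ mΩ :=
  iSup₂_le fun s _ => h.sourceAlg_le s

/-- The numbers and the walks form one independent family, so σ-algebras over disjoint sets of
sources are independent. This separates a pair of walks from the rest of the system. -/
lemma IsSystem.iIndep (h : IsSystem P D N S) : iIndep (sourceAlg N S) P := by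
  rw [iIndep_iff]
  intro s f hf
  have hl : MeasurableSet[MeasurableSpace.comap (fun ω i => N i ω) inferInstance]
      (⋂ i ∈ s.toLeft, f (Sum.inl i)) := by
    refine Finset.measurableSet_biInter _ fun i hi => ?_
    obtain ⟨B, hB, hfB⟩ := hf _ (Finset.mem_toLeft.1 hi)
    exact ⟨(fun y => y i) ⁻¹' B, measurable_pi_apply i hB, hfB⟩
  have hr : MeasurableSet[MeasurableSpace.comap (fun ω ρ t => S ρ t ω) inferInstance]
      (⋂ ρ ∈ s.toRight, f (Sum.inr ρ)) := by
    refine Finset.measurableSet_biInter _ fun ρ hρ => ?_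
    obtain ⟨B, hB, hfB⟩ := hf _ (Finset.mem_toRight.1 hρ)
    exact ⟨(fun y => y ρ) ⁻¹' B, measurable_pi_apply ρ hB, hfB⟩
  have hsplit : ⋂ i ∈ s, f i =
      (⋂ i ∈ s.toLeft, f (Sum.inl i)) ∩ ⋂ ρ ∈ s.toRight, f (Sum.inr ρ) := by
    ext ω
    simp only [Set.mem_iInter, Set.mem_inter_iff, Finset.mem_toLeft, Finset.mem_toRight,
      Sum.forall]
  rw [hsplit, (Indep_iff _ _ _).1 h.indep_NS _ _ hl hr,
    (iIndepFun_iff _ _ _).1 h.indep_N s.toLeft (f' := fun i => f (Sum.inl i))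
      (fun i hi => hf _ (Finset.mem_toLeft.1 hi)),
    (iIndepFun_iff _ _ _).1 h.indep_S s.toRight (f' := fun ρ => f (Sum.inr ρ))
      (fun ρ hρ => hf _ (Finset.mem_toRight.1 hρ)),
    Finset.prod_sum_eq_prod_toLeft_mul_prod_toRight]

lemma IsSystem.indep (h : IsSystem P D N S) {I J : Set (ℕ+ ⊕ (ℕ+ × ℕ))} (hIJ : Disjoint I J) :
    Indep (algOn N S I) (algOn N S J) P :=
  indep_iSup_of_disjoint h.sourceAlg_le h.iIndep hIJ

lemma IsSystem.measure_inter (h : IsSystem P D N S) {I J : Set (ℕ+ ⊕ (ℕ+ × ℕ))}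
    (hIJ : Disjoint I J) {A B : Set Ω} (hA : MeasurableSet[algOn N S I] A)
    (hB : MeasurableSet[algOn N S J] B) : P (A ∩ B) = P A * P B :=
  (Indep_iff _ _ _).1 (h.indep hIJ) A B hA hB

lemma IsSystem.measurableSet_mem_present_algOn (_h : IsSystem P D N S)
    {I : Set (ℕ+ ⊕ (ℕ+ × ℕ))} {ρ : ℕ+ × ℕ} (hρ : Sum.inl ρ.1 ∈ I) :
    MeasurableSet[algOn N S I] {ω | ρ ∈ present N ω} :=
  measurable_N_algOn N S hρ (MeasurableSet.of_discrete (s := {k | ρ.2 < k}))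

lemma IsSystem.measurableSet_moves_algOn (h : IsSystem P D N S) {I : Set (ℕ+ ⊕ (ℕ+ × ℕ))}
    {ρ : ℕ+ × ℕ} (hρ : Sum.inr ρ ∈ I) (a l : ℝ≥0) :
    MeasurableSet[algOn N S I] (moves (S ρ) a l) := by
  have hreg := fun ω => (h.walk ρ).regularPath ω
  exact @measurableSet_moves Ω (algOn N S I) (S ρ) (fun t => measurable_S_algOn N S hρ t) hreg a l

lemma IsSystem.measurableSet_exists_mem_algOn (h : IsSystem P D N S) {I : Set (ℕ+ ⊕ (ℕ+ × ℕ))}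
    {ρ : ℕ+ × ℕ} (hρ : Sum.inr ρ ∈ I) (a b : ℝ≥0) (E : Set ℤ) :
    MeasurableSet[algOn N S I] {ω | ∃ u, a ≤ u ∧ u ≤ b ∧ S ρ u ω ∈ E} := by
  have hreg := fun ω => (h.walk ρ).regularPath ω
  exact @measurableSet_exists_mem Ω (algOn N S I) (S ρ) (fun t => measurable_S_algOn N S hρ t)
    hreg a b E

/-! ### The mean number of particles at a site -/

lemma lintegral_natCast_eq_tsum {Y : Ω → ℕ} (hY : Measurable Y) :
    ∫⁻ ω, (Y ω : ℝ≥0∞) ∂P = ∑' j : ℕ, P {ω | j < Y ω} := by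
  have e : ∀ ω, (Y ω : ℝ≥0∞) = ∑' j : ℕ, {ω | j < Y ω}.indicator (1 : Ω → ℝ≥0∞) ω := fun ω => by
    rw [tsum_eq_sum (s := Finset.range (Y ω))]
    · rw [Finset.sum_congr rfl (g := fun _ => (1 : ℝ≥0∞))]
      · simp
      · intro j hj
        have hω : ω ∈ {ω | j < Y ω} := Finset.mem_range.1 hj
        rw [Set.indicator_of_mem hω]
        rfl
    · intro j hj
      rw [Finset.mem_range] at hj
      have hω : ω ∉ {ω | j < Y ω} := hj
      exact Set.indicator_of_notMem hω _
  have hm : ∀ j, MeasurableSet {ω | j < Y ω} := fun j =>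
    hY (MeasurableSet.of_discrete (s := {k | j < k}))
  simp_rw [e]
  rw [lintegral_tsum fun j => (measurable_one.indicator (hm j)).aemeasurable]
  exact tsum_congr fun j => lintegral_indicator_one (hm j)

/-- The mean number of particles at a site. -/
def meanNumber (P : Measure Ω) (N : ℕ+ → Ω → ℕ) : ℝ≥0∞ := ∫⁻ ω, (N 1 ω : ℝ≥0∞) ∂P

lemma IsSystem.tsum_measure_present (h : IsSystem P D N S) (i : ℕ+) :
    ∑' j : ℕ, P {ω | (i, j) ∈ present N ω} = meanNumber P N := by
  refine (lintegral_natCast_eq_tsum (h.measurable_N i)).symm.trans ?_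
  exact ((h.ident_N i 1).comp (u := fun n : ℕ => (n : ℝ≥0∞)) (measurable_of_countable _)).lintegral_eq

lemma IsSystem.meanNumber_ne_top (h : IsSystem P D N S) : meanNumber P N ≠ ⊤ := by
  have h2 : ∫⁻ ω, ENNReal.ofReal ((N 1 ω : ℝ) ^ 2) ∂P ≠ ⊤ :=
    ((hasFiniteIntegral_iff_ofReal (Eventually.of_forall fun _ => sq_nonneg _)).1
      (h.sq_N 1).hasFiniteIntegral).ne
  refine ne_top_of_le_ne_top h2 (lintegral_mono fun ω => ?_)
  change (N 1 ω : ℝ≥0∞) ≤ ENNReal.ofReal ((N 1 ω : ℝ) ^ 2)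
  rw [← ENNReal.ofReal_natCast]
  apply ENNReal.ofReal_le_ofReal
  exact_mod_cast Nat.le_self_pow two_ne_zero (N 1 ω)

/-! ### Chebyshev's inequality for sums of independent variables -/

lemma measure_sum_deviation_le [IsProbabilityMeasure P] {κ : Type*} {Y : κ → Ω → ℝ}
    (hY : ∀ i, MemLp (Y i) 2 P) (hind : Pairwise fun i j => IndepFun (Y i) (Y j) P) {v : ℝ}
    (hv : ∀ i, ∫ ω, Y i ω ^ 2 ∂P ≤ v) (G : Finset κ) {c : ℝ} (hc : 0 < c) :
    P {ω | c ≤ |∑ i ∈ G, Y i ω - ∑ i ∈ G, ∫ ω, Y i ω ∂P|} ≤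
      ENNReal.ofReal (G.card * v / c ^ 2) := by
  have hmem : MemLp (∑ i ∈ G, Y i) 2 P := memLp_finsetSum' _ fun i _ => hY i
  have hmean : ∫ ω, (∑ i ∈ G, Y i) ω ∂P = ∑ i ∈ G, ∫ ω, Y i ω ∂P := by
    simp_rw [Finset.sum_apply]
    exact integral_finsetSum _ fun i _ => (hY i).integrable (by norm_num)
  have hvar : Var[∑ i ∈ G, Y i; P] ≤ G.card * v := by
    rw [IndepFun.variance_sum (fun i _ => hY i) fun i _ j _ hij => hind hij, ← nsmul_eq_mul]
    refine Finset.sum_le_card_nsmul _ _ _ fun i _ => ?_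
    exact (variance_le_expectation_sq (hY i).1).trans (hv i)
  have := meas_ge_le_variance_div_sq hmem hc
  rw [hmean] at this
  simp_rw [Finset.sum_apply] at this
  exact this.trans (ENNReal.ofReal_le_ofReal (by gcongr))

/-! ### Regularity of the system -/

/-- Almost surely, only finitely many particles get up to time `T` further than half of their
distance to the origin. -/
lemma IsSystem.ae_finite_far [IsProbabilityMeasure P] (h : IsSystem P D N S) (T : ℕ) :
    ∀ᵐ ω ∂P, {ρ | ρ ∈ present N ω ∧ ∃ u ≤ (T : ℝ≥0), 2 * S ρ u ω ≤ -((ρ.1 : ℕ) : ℤ)}.Finite := by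
  set g : ℕ+ → ℝ := fun i => 2 * (T * unitVariance D / ((i : ℕ) / 2 : ℝ) ^ 2)
  have hb : ∀ ρ : ℕ+ × ℕ, P {ω | ρ ∈ present N ω ∧ ∃ u ≤ (T : ℝ≥0), 2 * S ρ u ω ≤ -((ρ.1 : ℕ) : ℤ)} ≤
      P {ω | ρ ∈ present N ω} * ENNReal.ofReal (g ρ.1) := by
    intro ρ
    have h1 := h.measure_inter (I := {Sum.inl ρ.1}) (J := {Sum.inr ρ}) (by simp)
      (h.measurableSet_mem_present_algOn (Set.mem_singleton _))
      (h.measurableSet_exists_mem_algOn (Set.mem_singleton _) 0 T {z | 2 * z ≤ -((ρ.1 : ℕ) : ℤ)})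
    have e : {ω | ρ ∈ present N ω ∧ ∃ u ≤ (T : ℝ≥0), 2 * S ρ u ω ≤ -((ρ.1 : ℕ) : ℤ)} =
        {ω | ρ ∈ present N ω} ∩
          {ω | ∃ u, 0 ≤ u ∧ u ≤ (T : ℝ≥0) ∧ S ρ u ω ∈ {z | 2 * z ≤ -((ρ.1 : ℕ) : ℤ)}} := by
      ext ω
      simp
    rw [e, h1]
    gcongr
    set d : ℤ := (((ρ.1 : ℕ) : ℤ) + 1) / 2
    have hpos : (0 : ℝ) < (ρ.1 : ℕ) / 2 := by
      have := ρ.1.pos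
      positivity
    calc _ ≤ P {ω | ∃ u ≤ (T : ℝ≥0), S ρ u ω ≤ -d} := by
          refine measure_mono fun ω ⟨u, _, h2, h3⟩ => ⟨u, h2, ?_⟩
          have h3' : 2 * S ρ u ω ≤ -((ρ.1 : ℕ) : ℤ) := h3
          omega
      _ ≤ 2 * srwLaw D T {z | z ≤ -d} := (h.walk ρ).measure_exists_le T d
      _ ≤ 2 * ENNReal.ofReal (T * unitVariance D / ((ρ.1 : ℕ) / 2 : ℝ) ^ 2) := by
          gcongr
          refine (measure_mono fun z hz => ?_).trans ((h.walk ρ).chebyshev T hpos)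
          have hz' : z ≤ -d := hz
          have : ((ρ.1 : ℕ) : ℤ) ≤ 2 * |z| := by
            have := neg_le_abs z
            omega
          have h' : ((ρ.1 : ℕ) : ℝ) ≤ 2 * |(z : ℝ)| := by exact_mod_cast this
          change ((ρ.1 : ℕ) : ℝ) / 2 ≤ |(z : ℝ)|
          linarith
      _ = ENNReal.ofReal (g ρ.1) := by
          rw [ENNReal.ofReal_mul zero_le_two, ENNReal.ofReal_ofNat]
  -- Borel–Cantelli: the mean number of particles per site is finite, and the probability of going
  -- that far decays like the inverse square of the starting site.
  refine ae_finite_setOfPred_mem (s := fun ρ : ℕ+ × ℕ =>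
    {ω | ρ ∈ present N ω ∧ ∃ u ≤ (T : ℝ≥0), 2 * S ρ u ω ≤ -((ρ.1 : ℕ) : ℤ)}) ?_
  refine ne_top_of_le_ne_top ?_ (ENNReal.tsum_le_tsum hb)
  rw [ENNReal.tsum_prod']
  simp_rw [ENNReal.tsum_mul_right, h.tsum_measure_present]
  rw [ENNReal.tsum_mul_left]
  refine ENNReal.mul_ne_top h.meanNumber_ne_top ?_
  refine Summable.tsum_ofReal_ne_top ?_
  have hs : Summable fun n : ℕ => 8 * (T * unitVariance D) * (1 / (n : ℝ) ^ 2) :=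
    (Real.summable_one_div_nat_pow.2 one_lt_two).mul_left _
  refine (hs.comp_injective PNat.coe_injective).congr fun i => ?_
  have : ((i : ℕ) : ℝ) ≠ 0 := by exact_mod_cast i.ne_zero
  simp only [Function.comp, g]
  field_simp
  ring

/-- Almost surely, two given walks do not jump at the same time. -/
lemma IsSystem.ae_noSimultaneous [IsProbabilityMeasure P] (h : IsSystem P D N S) {ρ σ : ℕ+ × ℕ}
    (hρσ : ρ ≠ σ) (T : ℕ) : ∀ᵐ ω ∂P, ∀ t, 0 < t → t ≤ (T : ℝ≥0) →
      AtLeft (fun s => S ρ s ω) (S ρ t ω) t ∨ AtLeft (fun s => S σ s ω) (S σ t ω) t := by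
  set E : Set Ω := {ω | ¬ ∀ t, 0 < t → t ≤ (T : ℝ≥0) →
      AtLeft (fun s => S ρ s ω) (S ρ t ω) t ∨ AtLeft (fun s => S σ s ω) (S σ t ω) t}
  -- Cut `(0, T]` into `n` intervals. Both independent walks move in one of them with probability of
  -- order at most `n * (1 / n) ^ 2`, which tends to `0`.
  have key : ∀ n : ℕ, 0 < n → P E ≤ (n * ((D * (T / n)) * (D * (T / n))) : ℝ≥0) := by
    intro n hn
    set l : ℝ≥0 := (T : ℝ≥0) / n
    have hn' : (0 : ℝ≥0) < n := by exact_mod_cast hn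
    have hsub : E ⊆ ⋃ m ∈ Finset.range n, moves (S ρ) (m * l) l ∩ moves (S σ) (m * l) l := by
      intro ω hω
      have hω' : ∃ t, 0 < t ∧ t ≤ (T : ℝ≥0) ∧ ¬ AtLeft (fun s => S ρ s ω) (S ρ t ω) t ∧
          ¬ AtLeft (fun s => S σ s ω) (S σ t ω) t := by
        by_contra hcon
        push Not at hcon
        exact hω fun t h1 h2 => or_iff_not_imp_left.2 (hcon t h1 h2)
      obtain ⟨t, ht0, htT, h1, h2⟩ := hω'
      have hl : 0 < l := div_pos (ht0.trans_le htT) hn'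
      obtain ⟨m, hm⟩ : ∃ m, ⌈t / l⌉₊ = m + 1 :=
        Nat.exists_eq_succ_of_ne_zero (Nat.ceil_pos.2 (div_pos ht0 hl)).ne'
      have hmt : m * l < t := (lt_div_iff₀ hl).1 (Nat.lt_ceil.1 (by omega))
      have htm : t ≤ m * l + l := by
        have := Nat.le_ceil (t / l)
        rw [hm, div_le_iff₀ hl] at this
        push_cast at this
        rwa [add_mul, one_mul] at this
      have hmn : m < n := by
        have : ⌈t / l⌉₊ ≤ n := by
          refine Nat.ceil_le.2 ((div_le_iff₀ hl).2 (htT.trans (le_of_eq ?_)))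
          simp only [l]
          field_simp
        omega
      have hmove : ∀ τ, ¬ AtLeft (fun s => S τ s ω) (S τ t ω) t → ω ∈ moves (S τ) (m * l) l := by
        intro τ hτ
        by_contra hno
        have hc : ∀ u, m * l ≤ u → u ≤ m * l + l → S τ u ω = S τ (m * l) ω := by
          intro u hu1 hu2
          by_contra hne
          exact hno ⟨u, hu1, hu2, hne⟩
        apply hτ
        filter_upwards [Ioo_mem_nhdsLT hmt] with s hs
        rw [hc s hs.1.le (hs.2.le.trans htm), hc t hmt.le htm]
      exact Set.mem_iUnion₂.2 ⟨m, Finset.mem_range.2 hmn, hmove ρ h1, hmove σ h2⟩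
    calc P E ≤ _ := measure_mono hsub
      _ ≤ _ := measure_biUnion_finset_le _ _
      _ ≤ ∑ _m ∈ Finset.range n, ((D * l : ℝ≥0) : ℝ≥0∞) * ((D * l : ℝ≥0) : ℝ≥0∞) := by
          refine Finset.sum_le_sum fun m _ => ?_
          rw [h.measure_inter (I := {Sum.inr ρ}) (J := {Sum.inr σ}) (by simpa using hρσ)
            (h.measurableSet_moves_algOn (Set.mem_singleton _) _ _) (h.measurableSet_moves_algOn (Set.mem_singleton _) _ _)]
          exact mul_le_mul' ((h.walk ρ).measure_move_le _ _) ((h.walk σ).measure_move_le _ _)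
      _ = _ := by
          rw [Finset.sum_const, Finset.card_range, nsmul_eq_mul]
          push_cast
          rfl
  have hlim : Tendsto (fun n : ℕ => ((n * ((D * (T / n)) * (D * (T / n))) : ℝ≥0) : ℝ≥0∞)) atTop
      (𝓝 0) := by
    rw [← ENNReal.coe_zero, ENNReal.tendsto_coe]
    have : Tendsto (fun n : ℕ => (D * T) ^ 2 / (n : ℝ≥0)) atTop (𝓝 0) :=
      tendsto_const_div_atTop_nhds_zero_nat _
    refine this.congr' ?_
    filter_upwards [eventually_gt_atTop 0] with n hn
    have : (n : ℝ≥0) ≠ 0 := by exact_mod_cast hn.ne'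
    field_simp
  have hE : P E = 0 := le_antisymm (ge_of_tendsto hlim
    ((eventually_gt_atTop 0).mono fun n hn => key n hn)) zero_le
  exact hE

lemma exists_nat_ge_nnreal (t : ℝ≥0) : ∃ n : ℕ, t ≤ n := exists_nat_ge t

/-- Almost surely, the system is regular. -/
lemma IsSystem.ae_good [IsProbabilityMeasure P] (h : IsSystem P D N S) :
    ∀ᵐ ω ∂P, Good (position S ω) (present N ω) := by
  have h1 : ∀ᵐ ω ∂P, ∀ T : ℕ, {ρ | ρ ∈ present N ω ∧
      ∃ u ≤ (T : ℝ≥0), 2 * S ρ u ω ≤ -((ρ.1 : ℕ) : ℤ)}.Finite :=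
    ae_all_iff.2 fun T => h.ae_finite_far T
  have h2 : ∀ᵐ ω ∂P, ∀ (ρ σ : ℕ+ × ℕ) (T : ℕ), ρ ≠ σ → ∀ t, 0 < t → t ≤ (T : ℝ≥0) →
      AtLeft (fun s => S ρ s ω) (S ρ t ω) t ∨ AtLeft (fun s => S σ s ω) (S σ t ω) t := by
    refine ae_all_iff.2 fun ρ => ae_all_iff.2 fun σ => ae_all_iff.2 fun T => ?_
    by_cases hρσ : ρ = σ
    · exact Eventually.of_forall fun ω hne => absurd hρσ hne
    · filter_upwards [h.ae_noSimultaneous hρσ T] with ω hω _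
      exact hω
  filter_upwards [h1, h2] with ω h1 h2
  refine ⟨fun ρ _ => ((h.walk ρ).regularPath ω).const_add _, fun ρ _ => ?_, fun z T => ?_, ?_⟩
  · have := ρ.1.pos
    simp only [position, (h.walk ρ).start]
    omega
  · obtain ⟨T', hT'⟩ := exists_nat_ge_nnreal T
    -- A particle starting beyond `2 * z` that gets to `z` has gone more than half of its distance
    -- to the origin; the others are finitely many.
    have hfin : {ρ : ℕ+ × ℕ | ρ ∈ present N ω ∧ (ρ.1 : ℕ) ≤ 2 * z.toNat}.Finite := by
      have : {i : ℕ+ | (i : ℕ) ≤ 2 * z.toNat}.Finite :=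
        (Set.finite_le_nat (2 * z.toNat)).preimage PNat.coe_injective.injOn
      refine (this.biUnion (t := fun i => Prod.mk i '' {j | j < N i ω})
        fun i _ => (Set.finite_lt_nat _).image _).subset ?_
      rintro ⟨i, j⟩ ⟨hρ1, hρ2⟩
      exact Set.mem_iUnion₂.2 ⟨i, hρ2, j, hρ1, rfl⟩
    refine (hfin.union (h1 T')).subset ?_
    rintro ρ ⟨hρ, u, hu, hx⟩
    by_cases hle : (ρ.1 : ℕ) ≤ 2 * z.toNat
    · exact Or.inl ⟨hρ, hle⟩
    · refine Or.inr ⟨hρ, u, hu.trans hT', ?_⟩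
      simp only [position] at hx
      omega
  · intro ρ _ σ _ hρσ t ht
    obtain ⟨T, hT⟩ := exists_nat_ge_nnreal t
    refine (h2 ρ σ T hρσ t ht hT).imp (fun hl => ?_) (fun hl => ?_)
    · exact hl.mono fun s hs => by simp only [position, hs]
    · exact hl.mono fun s hs => by simp only [position, hs]

end System

/-! ### The aggregate does not explode -/

section Explosion

open scoped Classical in
/-- The number of the particles starting at `i` that move during `[a, a + l]`. -/
def numMovers {Ω : Type*} (N : ℕ+ → Ω → ℕ) (S : ℕ+ × ℕ → ℝ≥0 → Ω → ℤ) (a l : ℝ≥0) (i : ℕ+)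
    (ω : Ω) : ℕ :=
  ((Finset.range (N i ω)).filter fun j => ω ∈ moves (S (i, j)) a l).card

open scoped Classical in
lemma measurable_card_filter_range {Ω : Type*} [MeasurableSpace Ω] {n : Ω → ℕ} (hn : Measurable n)
    {B : ℕ → Set Ω} (hB : ∀ j, MeasurableSet (B j)) :
    Measurable fun ω => ((Finset.range (n ω)).filter fun j => ω ∈ B j).card := by
  have h : ∀ k : ℕ, Measurable fun ω => ((Finset.range k).filter fun j => ω ∈ B j).card := by
    intro k
    simp_rw [Finset.card_filter]
    refine Finset.measurable_fun_sum _ fun j _ => ?_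
    exact Measurable.ite (hB j) measurable_const measurable_const
  have h2 : Measurable fun p : ℕ × Ω => ((Finset.range p.1).filter fun j => p.2 ∈ B j).card :=
    measurable_from_prod_countable_right h
  exact h2.comp (hn.prodMk measurable_id)

lemma numMovers_le {Ω : Type*} {N : ℕ+ → Ω → ℕ} {S : ℕ+ × ℕ → ℝ≥0 → Ω → ℤ} (a l : ℝ≥0) (i : ℕ+) (ω : Ω) : numMovers N S a l i ω ≤ N i ω := by
  classical
  exact (Finset.card_filter_le _ _).trans (Finset.card_range _).le

/-- The index of the grid interval containing `t k` is nondecreasing and bounded in `k`, hence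
eventually constant. -/
lemma exists_eventually_mem_grid {t : ℕ → ℝ≥0} (ht : Monotone t) {T : ℝ≥0} {M : ℕ}
    (hpos : ∀ k, 0 < t k) (hT : ∀ k, t k ≤ T) (hM : 0 < M) :
    ∃ m < M, ∃ k₀, ∀ k, k₀ ≤ k → m * (T / M) < t k ∧ t k ≤ m * (T / M) + T / M := by
  have hM' : (0 : ℝ≥0) < M := by exact_mod_cast hM
  set l := T / M
  have hl : 0 < l := div_pos ((hpos 0).trans_le (hT 0)) hM'
  have hle : ∀ k, ⌈t k / l⌉₊ ≤ M := fun k => by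
    refine Nat.ceil_le.2 ((div_le_iff₀ hl).2 ((hT k).trans (le_of_eq ?_)))
    simp only [l]
    field_simp
  have hmono : Monotone fun k => ⌈t k / l⌉₊ := fun k k' hk =>
    Nat.ceil_mono (div_le_div_of_nonneg_right (ht hk) hl.le)
  have htend := tendsto_atTop_ciSup hmono ⟨M, by rintro _ ⟨k, rfl⟩; exact hle k⟩
  rw [nhds_discrete, tendsto_pure] at htend
  obtain ⟨k₀, hk₀⟩ := eventually_atTop.1 htend
  have hp := Nat.ceil_pos.2 (div_pos (hpos k₀) hl)
  obtain ⟨m, hm⟩ : ∃ m, ⌈t k₀ / l⌉₊ = m + 1 := Nat.exists_eq_succ_of_ne_zero hp.ne'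
  refine ⟨m, by have := hle k₀; omega, k₀, fun k hk => ?_⟩
  have hkm : ⌈t k / l⌉₊ = m + 1 := by
    rw [← hm]
    exact (hk₀ k hk).trans (hk₀ k₀ le_rfl).symm
  refine ⟨(lt_div_iff₀ hl).1 (Nat.lt_ceil.1 (by omega)), ?_⟩
  have := Nat.le_ceil (t k / l)
  rw [hkm, div_le_iff₀ hl] at this
  push_cast at this
  rwa [add_mul, one_mul] at this

/-- On an explosion before time `T`, many particles move during one of the intervals of a grid. -/
lemma eventually_numMovers_ge {Ω : Type*} {N : ℕ+ → Ω → ℕ} {S : ℕ+ × ℕ → ℝ≥0 → Ω → ℤ} {ω : Ω} (hg : Good (position S ω) (present N ω)) {T M : ℕ}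
    (hM : 0 < M)
    (hfar : {ρ | ρ ∈ present N ω ∧ ∃ u ≤ (T : ℝ≥0), 2 * S ρ u ω ≤ -((ρ.1 : ℕ) : ℤ)}.Finite)
    (hT : ∀ k, growthTime (position S ω) (present N ω) k ≤ (T : ℝ≥0)) :
    ∀ᶠ n : ℕ in atTop, ∃ m < M, (n.succPNat : ℝ) / 2 ≤
      ∑ i ∈ Finset.Icc 1 (2 * n.succPNat), (numMovers N S (m * ((T : ℝ≥0) / M)) (T / M) i ω : ℝ) := by
  classical
  obtain ⟨ρ, t, hρ, ht, hk⟩ := hg.jumpers hT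
  obtain ⟨m, hm, k₀, hgrid⟩ := exists_eventually_mem_grid ht (fun k => (hk k).2.1)
    (fun k => (hk k).2.2.1) hM
  -- At least half of the first `n + 1` jumpers must remain after discarding the first `k₀` and
  -- those that travel far.
  filter_upwards [eventually_ge_atTop (2 * (k₀ + hfar.toFinset.card))] with n hn
  refine ⟨m, hm, ?_⟩
  set q := n.succPNat
  have hq : (q : ℕ) = n + 1 := rfl
  set a := (m : ℝ≥0) * ((T : ℝ≥0) / M)
  set l := (T : ℝ≥0) / M
  -- The jumper of growth `k < q` gets to `k`. Unless it travels far, it starts at most at `2 * q`,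
  -- so it is counted among the movers of these sites.
  have hsub : (((Finset.Ico k₀ q).image ρ) \ hfar.toFinset) ⊆
      ((Finset.Icc 1 (2 * q)).sigma fun i =>
        (Finset.range (N i ω)).filter fun j => ω ∈ moves (S (i, j)) a l).image
          fun p => (p.1, p.2) := by
    intro σ hσ
    rw [Finset.mem_sdiff, Finset.mem_image] at hσ
    obtain ⟨⟨k, hkq, rfl⟩, hnf⟩ := hσ
    rw [Finset.mem_Ico] at hkq
    obtain ⟨hA, h0, htT, hx, hleft⟩ := hk k
    obtain ⟨hg1, hg2⟩ := hgrid k hkq.1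
    have hx' : (((ρ k).1 : ℕ) : ℤ) + S (ρ k) (t k) ω = k := hx
    refine Finset.mem_image.2 ⟨⟨(ρ k).1, (ρ k).2⟩, ?_, rfl⟩
    rw [Finset.mem_sigma, Finset.mem_Icc, Finset.mem_filter, Finset.mem_range]
    refine ⟨⟨one_le, ?_⟩, hA, ?_⟩
    · rw [Set.Finite.mem_toFinset] at hnf
      by_contra hcon
      refine hnf ⟨hA, t k, htT, ?_⟩
      have : 2 * (q : ℕ) < ((ρ k).1 : ℕ) := by
        have := PNat.coe_lt_coe _ _ |>.2 (not_le.1 hcon)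
        simpa using this
      omega
    -- The jumper is at `k + 1` just before the growth and at `k` at the growth, so at one of these
    -- times it differs from its position at `a`.
    · have hleft' : ∀ᶠ s in 𝓝[<] (t k), (((ρ k).1 : ℕ) : ℤ) + S (ρ k) s ω = k + 1 := hleft
      have hne : (𝓝[<] (t k)).NeBot := nhdsLT_neBot_of_exists_lt ⟨_, h0⟩
      obtain ⟨s, hs1, hs2⟩ := (hleft'.and (Ioo_mem_nhdsLT hg1)).exists
      by_cases hc : S (ρ k) s ω = S (ρ k) a ω
      · exact ⟨t k, hg1.le, hg2, by change S (ρ k) _ ω ≠ S (ρ k) _ ω; omega⟩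
      · exact ⟨s, hs2.1.le, hs2.2.le.trans hg2, hc⟩
  have hcard := (Finset.card_le_card hsub).trans Finset.card_image_le
  rw [Finset.card_sigma] at hcard
  have h1 := Finset.le_card_sdiff hfar.toFinset ((Finset.Ico k₀ q).image ρ)
  rw [Finset.card_image_of_injective _ hρ, Nat.card_Ico] at h1
  have h2 : (q : ℕ) ≤ 2 * ∑ i ∈ Finset.Icc 1 (2 * q), numMovers N S a l i ω := by
    have : ∑ i ∈ Finset.Icc 1 (2 * q), numMovers N S a l i ω = _ := rfl
    simp only [numMovers] at this ⊢
    omega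
  have h3 : (q : ℝ) ≤ 2 * ∑ i ∈ Finset.Icc 1 (2 * q), (numMovers N S a l i ω : ℝ) := by
    exact_mod_cast h2
  linarith

variable {Ω : Type*} [mΩ : MeasurableSpace Ω] {P : Measure Ω} {D : ℝ≥0} {N : ℕ+ → Ω → ℕ}
  {S : ℕ+ × ℕ → ℝ≥0 → Ω → ℤ}

lemma IsSystem.measurable_numMovers (h : IsSystem P D N S) (a l : ℝ≥0) (i : ℕ+) :
    Measurable[algOn N S ({Sum.inl i} ∪ Set.range fun j => Sum.inr (i, j))]
      (numMovers N S a l i) := by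
  have hN := measurable_N_algOn N S (i := i)
    (I := {Sum.inl i} ∪ Set.range fun j => Sum.inr (i, j)) (Or.inl rfl)
  have hB : ∀ j, MeasurableSet[algOn N S ({Sum.inl i} ∪ Set.range fun j => Sum.inr (i, j))]
      (moves (S (i, j)) a l) := fun j => h.measurableSet_moves_algOn (Or.inr ⟨j, rfl⟩) a l
  exact @measurable_card_filter_range Ω (algOn N S _) _ hN _ hB

lemma IsSystem.indepFun_numMovers (h : IsSystem P D N S) (a l : ℝ≥0) {i i' : ℕ+} (hi : i ≠ i') :
    IndepFun (fun ω => (numMovers N S a l i ω : ℝ)) (fun ω => (numMovers N S a l i' ω : ℝ)) P := by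
  have hd : Disjoint ({Sum.inl i} ∪ Set.range fun j => Sum.inr (i, j) : Set (ℕ+ ⊕ (ℕ+ × ℕ)))
      ({Sum.inl i'} ∪ Set.range fun j => Sum.inr (i', j)) := by
    rw [Set.disjoint_left]
    rintro s (rfl | ⟨j, rfl⟩) (hs | ⟨j', hs⟩)
    · exact hi (Sum.inl.inj hs)
    · cases hs
    · cases hs
    · exact hi (congrArg Prod.fst (Sum.inr.inj hs)).symm
  have : IndepFun (numMovers N S a l i) (numMovers N S a l i') P :=
    indep_of_indep_of_le_left (indep_of_indep_of_le_right (h.indep hd)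
      (h.measurable_numMovers a l i').comap_le) (h.measurable_numMovers a l i).comap_le
  exact this.comp (φ := fun n : ℕ => (n : ℝ)) (ψ := fun n : ℕ => (n : ℝ))
    (measurable_of_countable _) (measurable_of_countable _)

lemma IsSystem.memLp_N (h : IsSystem P D N S) (i : ℕ+) : MemLp (fun ω => (N i ω : ℝ)) 2 P :=
  (memLp_two_iff_integrable_sq
    ((measurable_of_countable fun n : ℕ => (n : ℝ)).comp
      (h.measurable_N i)).aestronglyMeasurable).2 (h.sq_N i)

lemma IsSystem.memLp_numMovers (h : IsSystem P D N S) (a l : ℝ≥0) (i : ℕ+) :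
    MemLp (fun ω => (numMovers N S a l i ω : ℝ)) 2 P := by
  refine (h.memLp_N i).mono ?_ (Eventually.of_forall fun ω => ?_)
  · exact ((measurable_of_countable fun n : ℕ => (n : ℝ)).comp
      ((h.measurable_numMovers a l i).mono (h.algOn_le _) le_rfl)).aestronglyMeasurable
  · simp only [Real.norm_natCast]
    exact Nat.cast_le.2 (numMovers_le a l i ω)

lemma IsSystem.integral_sq_eq (h : IsSystem P D N S) (i : ℕ+) :
    ∫ ω, (N i ω : ℝ) ^ 2 ∂P = ∫ ω, (N 1 ω : ℝ) ^ 2 ∂P :=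
  ((h.ident_N i 1).comp (u := fun n : ℕ => (n : ℝ) ^ 2) (measurable_of_countable _)).integral_eq

lemma IsSystem.integral_numMovers_sq_le (h : IsSystem P D N S) (a l : ℝ≥0) (i : ℕ+) :
    ∫ ω, (numMovers N S a l i ω : ℝ) ^ 2 ∂P ≤ ∫ ω, (N 1 ω : ℝ) ^ 2 ∂P := by
  rw [← h.integral_sq_eq i]
  refine integral_mono (h.memLp_numMovers a l i).integrable_sq (h.sq_N i) fun ω => ?_
  exact pow_le_pow_left₀ (Nat.cast_nonneg _) (Nat.cast_le.2 (numMovers_le a l i ω)) 2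

lemma IsSystem.lintegral_numMovers_le [IsProbabilityMeasure P] (h : IsSystem P D N S)
    (a l : ℝ≥0) (i : ℕ+) :
    ∫⁻ ω, (numMovers N S a l i ω : ℝ≥0∞) ∂P ≤ meanNumber P N * (D * l : ℝ≥0) := by
  have e : ∀ ω, (numMovers N S a l i ω : ℝ≥0∞) = ∑' j : ℕ,
      ({ω | (i, j) ∈ present N ω} ∩ moves (S (i, j)) a l).indicator (1 : Ω → ℝ≥0∞) ω := by
    intro ω
    classical
    rw [tsum_eq_sum (s := (Finset.range (N i ω)).filter fun j => ω ∈ moves (S (i, j)) a l)]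
    · rw [Finset.sum_congr rfl (g := fun _ => (1 : ℝ≥0∞))]
      · simp [numMovers]
      · intro j hj
        rw [Finset.mem_filter, Finset.mem_range] at hj
        exact Set.indicator_of_mem (s := {ω | (i, j) ∈ present N ω} ∩ moves (S (i, j)) a l) hj _
    · intro j hj
      rw [Finset.mem_filter, Finset.mem_range] at hj
      exact Set.indicator_of_notMem (s := {ω | (i, j) ∈ present N ω} ∩ moves (S (i, j)) a l) hj _
  have hm1 : ∀ j, MeasurableSet[algOn N S {Sum.inl i}] {ω | (i, j) ∈ present N ω} := fun j =>
    h.measurableSet_mem_present_algOn (Set.mem_singleton _)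
  have hm2 : ∀ j, MeasurableSet[algOn N S {Sum.inr (i, j)}] (moves (S (i, j)) a l) := fun j =>
    h.measurableSet_moves_algOn (Set.mem_singleton _) a l
  have hm : ∀ j, MeasurableSet ({ω | (i, j) ∈ present N ω} ∩ moves (S (i, j)) a l) := fun j =>
    (h.algOn_le _ _ (hm1 j)).inter (h.algOn_le _ _ (hm2 j))
  simp_rw [e]
  rw [lintegral_tsum fun j => (measurable_one.indicator (hm j)).aemeasurable]
  calc _ = ∑' j, P {ω | (i, j) ∈ present N ω} * P (moves (S (i, j)) a l) := by
        refine tsum_congr fun j => ?_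
        rw [lintegral_indicator_one (hm j), h.measure_inter (by simp) (hm1 j) (hm2 j)]
    _ ≤ ∑' j, P {ω | (i, j) ∈ present N ω} * (D * l : ℝ≥0) :=
        ENNReal.tsum_le_tsum fun j => mul_le_mul' le_rfl ((h.walk _).measure_move_le a l)
    _ = _ := by rw [ENNReal.tsum_mul_right, h.tsum_measure_present]

/-- The mean over `2 * q` sites is at most `q / 4`, so the sum must deviate by `q / 4`; Chebyshev's
inequality uses the finite second moment of the numbers of particles. -/
lemma IsSystem.measure_numMovers_ge [IsProbabilityMeasure P] (h : IsSystem P D N S)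
    (a : ℝ≥0) {l : ℝ≥0} (hl : meanNumber P N * (D * l : ℝ≥0) ≤ ENNReal.ofReal (1 / 8)) (q : ℕ+) :
    P {ω | (q : ℝ) / 2 ≤ ∑ i ∈ Finset.Icc 1 (2 * q), (numMovers N S a l i ω : ℝ)} ≤
      ENNReal.ofReal (32 * (∫ ω, (N 1 ω : ℝ) ^ 2 ∂P) / q) := by
  have hq : (0 : ℝ) < q := by exact_mod_cast q.pos
  have hmean : ∀ i, ∫ ω, (numMovers N S a l i ω : ℝ) ∂P ≤ 1 / 8 := by
    intro i
    rw [integral_eq_lintegral_of_nonneg_ae (Eventually.of_forall fun ω => Nat.cast_nonneg _)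
      (h.memLp_numMovers a l i).1]
    refine ENNReal.toReal_le_of_le_ofReal (by norm_num) ?_
    simp_rw [ENNReal.ofReal_natCast]
    exact (h.lintegral_numMovers_le a l i).trans hl
  have hcard : (Finset.Icc 1 (2 * q)).card = 2 * (q : ℕ) := by
    rw [PNat.card_Icc]
    simp
  have hdev := measure_sum_deviation_le (fun i => h.memLp_numMovers a l i)
    (fun i i' hi => h.indepFun_numMovers a l hi) (fun i => h.integral_numMovers_sq_le a l i)
    (Finset.Icc 1 (2 * q)) (c := (q : ℝ) / 4) (by positivity)
  refine (measure_mono fun ω hω => ?_).trans (hdev.trans_eq ?_)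
  · have h1 : ∑ i ∈ Finset.Icc 1 (2 * q), ∫ ω, (numMovers N S a l i ω : ℝ) ∂P ≤ (q : ℝ) / 4 := by
      refine (Finset.sum_le_card_nsmul _ _ _ fun i _ => hmean i).trans_eq ?_
      rw [hcard, nsmul_eq_mul]
      push_cast
      ring
    have h2 : (q : ℝ) / 2 ≤ ∑ i ∈ Finset.Icc 1 (2 * q), (numMovers N S a l i ω : ℝ) := hω
    have h3 : (q : ℝ) / 4 ≤ ∑ i ∈ Finset.Icc 1 (2 * q), (numMovers N S a l i ω : ℝ) -
        ∑ i ∈ Finset.Icc 1 (2 * q), ∫ ω, (numMovers N S a l i ω : ℝ) ∂P := by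
      linarith
    exact h3.trans (le_abs_self _)
  · rw [hcard]
    congr 1
    push_cast
    field_simp
    ring

/-- Almost surely, there are only finitely many growth times up to a given time. -/
lemma IsSystem.ae_exists_lt_growthTime [IsProbabilityMeasure P] (h : IsSystem P D N S) (T : ℕ) :
    ∀ᵐ ω ∂P, ∃ k, ((T : ℝ≥0) : ℝ≥0∞) < growthTime (position S ω) (present N ω) k := by
  obtain ⟨M, hM, hl⟩ : ∃ M : ℕ, 0 < M ∧
      meanNumber P N * (D * ((T : ℝ≥0) / M) : ℝ≥0) ≤ ENNReal.ofReal (1 / 8) := by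
    obtain ⟨M, hM⟩ := exists_nat_ge (8 * ((meanNumber P N).toNNReal * (D * T)))
    refine ⟨M + 1, M.succ_pos, ?_⟩
    rw [← ENNReal.coe_toNNReal h.meanNumber_ne_top, ← ENNReal.coe_mul, ENNReal.ofReal,
      ENNReal.coe_le_coe]
    have e : (1 / 8 : ℝ).toNNReal = 1 / 8 := by
      rw [Real.toNNReal_div zero_le_one]
      simp
    rw [e, ← mul_div_assoc, ← mul_div_assoc, div_le_div_iff₀ (by positivity) (by norm_num)]
    rw [mul_comm _ (8 : ℝ≥0), one_mul]
    refine hM.trans ?_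
    push_cast
    exact le_add_of_nonneg_right zero_le_one
  set E : Set Ω := {ω | Good (position S ω) (present N ω) ∧
    {ρ | ρ ∈ present N ω ∧ ∃ u ≤ (T : ℝ≥0), 2 * S ρ u ω ≤ -((ρ.1 : ℕ) : ℤ)}.Finite ∧
    ∀ k, growthTime (position S ω) (present N ω) k ≤ (T : ℝ≥0)}
  set v : ℝ := ∫ ω, (N 1 ω : ℝ) ^ 2 ∂P
  set F : ℕ → Set Ω := fun n => ⋃ m ∈ Finset.range M, {ω | (n.succPNat : ℝ) / 2 ≤
    ∑ i ∈ Finset.Icc 1 (2 * n.succPNat), (numMovers N S (m * ((T : ℝ≥0) / M)) (T / M) i ω : ℝ)}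
  have hF : ∀ n, P (F n) ≤ M * ENNReal.ofReal (32 * v * (1 / ((n : ℝ) + 1))) := by
    intro n
    refine (measure_biUnion_finset_le _ _).trans ?_
    refine (Finset.sum_le_card_nsmul _ _ _ fun m _ => h.measure_numMovers_ge _ hl _).trans_eq ?_
    rw [Finset.card_range, nsmul_eq_mul]
    congr 2
    rw [mul_one_div]
    simp
    rfl
  have hlim : Tendsto (fun n : ℕ => (M : ℝ≥0∞) * ENNReal.ofReal (32 * v * (1 / ((n : ℝ) + 1))))
      atTop (𝓝 0) := by
    have h1 : Tendsto (fun n : ℕ => 32 * v * (1 / ((n : ℝ) + 1))) atTop (𝓝 0) := by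
      simpa using tendsto_one_div_add_atTop_nhds_zero_nat.const_mul (32 * v)
    have h2 := ENNReal.tendsto_ofReal h1
    rw [ENNReal.ofReal_zero] at h2
    simpa using ENNReal.Tendsto.const_mul h2 (Or.inr (ENNReal.natCast_ne_top M))
  -- On an explosion the events `F n` hold for all large `n`, while their probabilities tend to `0`.
  have hE : P E = 0 := by
    refine le_antisymm (le_of_forall_gt fun c hc => ?_) zero_le
    obtain ⟨c', hc'0, hc'⟩ := exists_between hc
    obtain ⟨n₀, hn₀⟩ := eventually_atTop.1 (hlim.eventually (gt_mem_nhds hc'0))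
    refine (measure_le_of_eventually_mem (F := fun n => F (n + n₀)) (fun ω hω => ?_)
      fun n => (hF _).trans (hn₀ _ (Nat.le_add_left _ _)).le).trans_lt hc'
    obtain ⟨hg, hfar, hT⟩ := hω
    filter_upwards [(tendsto_add_atTop_nat n₀).eventually
      (eventually_numMovers_ge hg hM hfar hT)] with n hn
    obtain ⟨m, hm, hmn⟩ := hn
    exact Set.mem_iUnion₂.2 ⟨m, Finset.mem_range.2 hm, hmn⟩
  filter_upwards [h.ae_good, h.ae_finite_far T, measure_eq_zero_iff_ae_notMem.1 hE]
    with ω h1 h2 h3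
  by_contra hcon
  push Not at hcon
  exact h3 ⟨h1, h2, hcon⟩

end Explosion

/-! ### Counting pairs of particles that turn black together -/

/-- A class of `m` elements has `m * (m - 1)` ordered pairs of distinct elements, which is at least
`m - 1`; sum over the at most `K` classes. -/
lemma card_le_add_card_pairs {κ : Type*} [DecidableEq κ] (s : Finset κ) {c : κ → ℕ} {K : ℕ}
    (hc : ∀ i ∈ s, c i < K) :
    s.card ≤ K + (s.offDiag.filter fun p => c p.1 = c p.2).card := by
  have h1 : s.card = ∑ k ∈ Finset.range K, (s.filter fun i => c i = k).card :=
    Finset.card_eq_sum_card_fiberwise fun i hi => Finset.mem_coe.2 (Finset.mem_range.2 (hc i hi))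
  have h2 : (s.offDiag.filter fun p => c p.1 = c p.2).card =
      ∑ k ∈ Finset.range K, ((s.offDiag.filter fun p => c p.1 = c p.2).filter
        fun p => c p.1 = k).card :=
    Finset.card_eq_sum_card_fiberwise fun p hp => Finset.mem_coe.2 (Finset.mem_range.2
      (hc _ (Finset.mem_offDiag.1 (Finset.mem_filter.1 hp).1).1))
  have h3 : ∀ k, (s.filter fun i => c i = k).card ≤ 1 +
      ((s.offDiag.filter fun p => c p.1 = c p.2).filter fun p => c p.1 = k).card := by
    intro k
    have hsub : (s.filter fun i => c i = k).offDiag ⊆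
        (s.offDiag.filter fun p => c p.1 = c p.2).filter fun p => c p.1 = k := by
      intro p hp
      simp only [Finset.mem_offDiag, Finset.mem_filter] at hp ⊢
      exact ⟨⟨⟨hp.1.1, hp.2.1.1, hp.2.2⟩, hp.1.2.trans hp.2.1.2.symm⟩, hp.1.2⟩
    have := Finset.card_le_card hsub
    rw [Finset.offDiag_card] at this
    set n := (s.filter fun i => c i = k).card
    rcases Nat.lt_or_ge n 2 with hn | hn
    · omega
    · have : 2 * n ≤ n * n := Nat.mul_le_mul_right n hn
      omega
  rw [h1, h2]
  refine (Finset.sum_le_sum fun k _ => h3 k).trans_eq ?_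
  rw [Finset.sum_add_distrib]
  simp

/-! ### The front as a finite-valued random object -/

section Front

variable {ι : Type*}

/-- The front at the integer times up to `T`, computed from rational times. -/
def front (x : ι → ℝ≥0 → ℤ) (A : Set ι) (K T : ℕ) : Fin (T + 1) → Fin (K + 1) := fun n =>
  ⟨frontCount (fun k => (ratStage x A k).1) K n, Nat.lt_succ_of_le (frontCount_le _ _ _)⟩

/-- The extension of a finite sequence by a constant. -/
def extend {K T : ℕ} (g : Fin (T + 1) → Fin (K + 1)) (n : ℕ) : ℕ :=
  g ⟨min n T, Nat.lt_succ_of_le (min_le_right _ _)⟩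

lemma extend_le {K T : ℕ} (g : Fin (T + 1) → Fin (K + 1)) (n : ℕ) : extend g n ≤ K :=
  Nat.le_of_lt_succ (g _).2

lemma extend_front_mono (x : ι → ℝ≥0 → ℤ) (A : Set ι) (K T : ℕ) :
    Monotone (extend (front x A K T)) := fun _ _ hab =>
  frontCount_mono _ K (min_le_min_right T hab)

lemma Good.extend_front {x : ι → ℝ≥0 → ℤ} {A : Set ι} (h : Good x A) (K : ℕ) {T n : ℕ}
    (hn : n ≤ T) : extend (front x A K T) n = frontCount (growthTime x A) K n := by
  simp only [extend, front, min_eq_left hn, h.ratStage_eq]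
  rfl

/-- Two paths meet above the front `f` before time `T`. -/
def meet (f : ℕ → ℕ) (T : ℕ) (y y' : ℝ≥0 → ℤ) : Prop :=
  ∃ n < T, ∃ z ∈ Finset.Ioc (f n) (f (n + 1) + 1),
    (Survives f y n ∧ Visits y n z) ∧ (Survives f y' n ∧ Visits y' n z)

lemma Good.meet_of_turn_black {x : ι → ℝ≥0 → ℤ} {A : Set ι} (h : Good x A) {k K T : ℕ}
    (hkK : k < K) {ρ σ : ι} (hρ : ρ ∈ white x A k) (hρ' : ρ ∉ white x A (k + 1))
    (hσ : σ ∈ white x A k) (hσ' : σ ∉ white x A (k + 1))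
    (hT : growthTime x A (k + 1) ≤ (T : ℝ≥0∞)) :
    meet (extend (front x (A \ {ρ, σ}) K T)) T (x ρ) (x σ) := by
  have hg : Good x (A \ {ρ, σ}) := h.mono Set.sdiff_subset
  have he : ∀ n ≤ T, extend (front x (A \ {ρ, σ}) K T) n = _ := fun n hn => hg.extend_front K hn
  obtain ⟨n, hn, z, h1, h2, -, ⟨h4, h5⟩, h6, h7⟩ := h.pair_meets hkK hρ hρ' hσ hσ' hT rfl
  refine ⟨n, hn, z, ?_, ⟨fun m hm => ?_, h5⟩, fun m hm => ?_, h7⟩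
  · rw [Finset.mem_Ioc, he n hn.le, he (n + 1) hn]
    exact ⟨h1, h2⟩
  · rw [he m (hm.trans hn.le)]
    exact h4 m hm
  · rw [he m (hm.trans hn.le)]
    exact h6 m hm

open scoped Classical in
/-- If growth number `K + 1` happens after time `T`, then the number of the particles that get to
`0` by time `T` is bounded by the number of pairs that meet. -/
lemma Good.card_le_add_card_meet {x : ι → ℝ≥0 → ℤ} {A : Set ι} (h : Good x A) {K T : ℕ}
    (hK : (T : ℝ≥0∞) < growthTime x A (K + 1)) {κ : Type*} (e : κ → ι) (s : Finset κ)
    (hs : ∀ i ∈ s, e i ∈ A ∧ x (e i) T ≤ 0) :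
    s.card ≤ K + (s.offDiag.filter fun p =>
      meet (extend (front x (A \ {e p.1, e p.2}) K T)) T (x (e p.1)) (x (e p.2))).card := by
  have hex : ∀ i : κ, ∃ k : ℕ, i ∈ s → k < K ∧ e i ∈ white x A k ∧ e i ∉ white x A (k + 1) ∧
      growthTime x A (k + 1) ≤ (T : ℝ≥0∞) := by
    intro i
    by_cases hi : i ∈ s
    · obtain ⟨k, hk⟩ := h.exists_turns_black (hs i hi).1 (le_refl (T : ℝ≥0)) (hs i hi).2
        (by simpa using hK)
      exact ⟨k, fun _ => by simpa using hk⟩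
    · exact ⟨0, fun h => absurd h hi⟩
  choose c hc using hex
  refine (card_le_add_card_pairs s fun i hi => (hc i hi).1).trans ?_
  refine Nat.add_le_add_left (Finset.card_le_card fun p hp => ?_) K
  rw [Finset.mem_filter, Finset.mem_offDiag] at hp
  rw [Finset.mem_filter, Finset.mem_offDiag]
  refine ⟨hp.1, ?_⟩
  obtain ⟨h1, h2, h3, h4⟩ := hc _ hp.1.1
  obtain ⟨-, h2', h3', -⟩ := hc _ hp.1.2.1
  rw [← hp.2] at h2' h3'
  exact h.meet_of_turn_black h1 h2 h3 h2' h3' h4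

end Front

/-! ### The expected number of pairs that meet -/

section Pairs

lemma measurable_front {Ω ι : Type*} [MeasurableSpace Ω] [Countable ι] {x : Ω → ι → ℝ≥0 → ℤ}
    {A : Ω → Set ι} (hA : ∀ ρ, MeasurableSet {ω | ρ ∈ A ω})
    (hx : ∀ ρ, (∀ ω, ρ ∉ A ω) ∨ ∀ t, Measurable fun ω => x ω ρ t) {K T : ℕ}
    (g : Fin (T + 1) → Fin (K + 1)) : MeasurableSet {ω | front (x ω) (A ω) K T = g} := by
  have : {ω | front (x ω) (A ω) K T = g} =
      ⋂ n, {ω | frontCount (fun k => (ratStage (x ω) (A ω) k).1) K n ∈ ({(g n : ℕ)} : Set ℕ)} := by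
    ext ω
    simp [front, funext_iff, Fin.ext_iff]
  rw [this]
  exact MeasurableSet.iInter fun n =>
    measurable_frontCount (fun k => (measurable_ratStage hA hx k).1) K n (MeasurableSet.of_discrete)

/-- The event that two particles meet above the front of the aggregate of the other ones. -/
def meetEvent {Ω : Type*} (N : ℕ+ → Ω → ℕ) (S : ℕ+ × ℕ → ℝ≥0 → Ω → ℤ) (K T : ℕ) (ρ σ : ℕ+ × ℕ) : Set Ω :=
  {ω | meet (extend (front (position S ω) (present N ω \ {ρ, σ}) K T)) T
    (position S ω ρ) (position S ω σ)}

lemma setOf_meet_eq {Ω : Type*} (S : ℕ+ × ℕ → ℝ≥0 → Ω → ℤ) (f : ℕ → ℕ) (T : ℕ) (ρ σ : ℕ+ × ℕ) :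
    {ω | meet f T (position S ω ρ) (position S ω σ)} =
      ⋃ n ∈ Finset.range T, ⋃ z ∈ Finset.Ioc (f n) (f (n + 1) + 1),
        surviveVisit (S ρ) ((ρ.1 : ℕ) : ℤ) f n z ∩ surviveVisit (S σ) ((σ.1 : ℕ) : ℤ) f n z := by
  ext ω
  simp only [Set.mem_iUnion, Finset.mem_range, exists_prop]
  rfl

/-- The front takes finitely many values, so its independence of the pair can be used value by
value, with no conditioning. -/
lemma meetEvent_eq {Ω : Type*} (N : ℕ+ → Ω → ℕ) (S : ℕ+ × ℕ → ℝ≥0 → Ω → ℤ) (K T : ℕ) (ρ σ : ℕ+ × ℕ) :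
    meetEvent N S K T ρ σ = ⋃ g : Fin (T + 1) → Fin (K + 1),
      {ω | front (position S ω) (present N ω \ {ρ, σ}) K T = g} ∩
        {ω | meet (extend g) T (position S ω ρ) (position S ω σ)} := by
  ext ω
  simp [meetEvent]

variable {Ω : Type*} [mΩ : MeasurableSpace Ω] {P : Measure Ω} {D : ℝ≥0} {N : ℕ+ → Ω → ℕ}
  {S : ℕ+ × ℕ → ℝ≥0 → Ω → ℤ}

/-- The front without `B` depends only on the numbers of particles and on the walks outside `B`; the
rational-time description gives measurability with respect to exactly these sources. -/
lemma IsSystem.measurableSet_front (h : IsSystem P D N S) (B : Set (ℕ+ × ℕ)) {K T : ℕ}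
    (g : Fin (T + 1) → Fin (K + 1)) : MeasurableSet[algOn N S (Sum.inr '' B)ᶜ]
      {ω | front (position S ω) (present N ω \ B) K T = g} := by
  have hA : ∀ ρ, MeasurableSet[algOn N S (Sum.inr '' B)ᶜ] {ω | ρ ∈ present N ω \ B} := by
    intro ρ
    by_cases hρ : ρ ∈ B
    · convert @MeasurableSet.empty Ω (algOn N S (Sum.inr '' B)ᶜ)
      ext ω
      simp [hρ]
    · have : {ω | ρ ∈ present N ω \ B} = {ω | ρ ∈ present N ω} := by
        ext ω
        simp [hρ]
      rw [this]
      exact h.measurableSet_mem_present_algOn (by simp)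
  have hx : ∀ ρ, (∀ ω, ρ ∉ present N ω \ B) ∨
      ∀ t, Measurable[algOn N S (Sum.inr '' B)ᶜ] fun ω => position S ω ρ t := by
    intro ρ
    by_cases hρ : ρ ∈ B
    · exact Or.inl fun ω hω => hω.2 hρ
    · refine Or.inr fun t => ?_
      have hS := measurable_S_algOn N S (I := (Sum.inr '' B)ᶜ) (ρ := ρ) (by simpa using hρ) t
      exact (measurable_of_countable (fun z : ℤ => ((ρ.1 : ℕ) : ℤ) + z)).comp hS
  exact @measurable_front Ω _ (algOn N S _) _ _ _ hA hx K T g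

/-- The event that a particle stays above `K` up to time `T`. -/
def staysAbove (S : ℕ+ × ℕ → ℝ≥0 → Ω → ℤ) (K T : ℕ) (ρ : ℕ+ × ℕ) : Set Ω :=
  {ω | ∀ u : ℝ≥0, u ≤ T → (K : ℤ) < position S ω ρ u}

lemma IsSystem.measurableSet_staysAbove (h : IsSystem P D N S) (K T : ℕ) (ρ : ℕ+ × ℕ) :
    MeasurableSet[algOn N S {Sum.inr ρ}] (staysAbove S K T ρ) := by
  have : staysAbove S K T ρ = {ω | ∃ u, 0 ≤ u ∧ u ≤ (T : ℝ≥0) ∧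
      S ρ u ω ∈ {z : ℤ | ((ρ.1 : ℕ) : ℤ) + z ≤ K}}ᶜ := by
    ext ω
    simp [staysAbove, position]
  rw [this]
  exact (h.measurableSet_exists_mem_algOn (Set.mem_singleton _) 0 T _).compl

/-- With probability at least `1 / 4`, and independently of the reduced front, both particles stay
above `K` up to time `T`, and then their removal does not change the front. So the reduced front is
dominated by a law that is the same for all pairs. -/
lemma IsSystem.measure_front_diff_le [IsProbabilityMeasure P] (h : IsSystem P D N S)
    {ρ σ : ℕ+ × ℕ} (hρσ : ρ ≠ σ) {K T : ℕ} (hρ : 1 / 2 ≤ P (staysAbove S K T ρ))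
    (hσ : 1 / 2 ≤ P (staysAbove S K T σ)) (g : Fin (T + 1) → Fin (K + 1)) :
    P {ω | front (position S ω) (present N ω \ {ρ, σ}) K T = g} ≤
      4 * P {ω | front (position S ω) (present N ω) K T = g} := by
  set F : Set Ω := {ω | front (position S ω) (present N ω \ {ρ, σ}) K T = g}
  have hF := h.measurableSet_front {ρ, σ} (K := K) (T := T) g
  have hρm := h.measurableSet_staysAbove K T ρ
  have hσm := h.measurableSet_staysAbove K T σ
  have hle : ∀ {s t}, s ∈ t → algOn N S {s} ≤ algOn N S t := fun {s t} hst =>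
    iSup₂_le fun s' hs' => sourceAlg_le_algOn N S (by rwa [Set.mem_singleton_iff.1 hs'])
  have h1 : P (staysAbove S K T ρ ∩ staysAbove S K T σ) =
      P (staysAbove S K T ρ) * P (staysAbove S K T σ) :=
    h.measure_inter (by simpa using hρσ) hρm hσm
  have hboth : MeasurableSet[algOn N S (Sum.inr '' {ρ, σ})]
      (staysAbove S K T ρ ∩ staysAbove S K T σ) :=
    (hle (by simp) _ hρm).inter (hle (by simp) _ hσm)
  have h2 := h.measure_inter disjoint_compl_left hF hboth
  have h3 : P (F ∩ (staysAbove S K T ρ ∩ staysAbove S K T σ)) ≤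
      P {ω | front (position S ω) (present N ω) K T = g} := by
    refine measure_mono_ae ?_
    filter_upwards [h.ae_good] with ω hg hω
    obtain ⟨hωF, hωρ, hωσ⟩ := hω
    -- The two particles need not be present; only those that are count as removed.
    have e : present N ω \ {ρ, σ} = present N ω \ ({ρ, σ} ∩ present N ω) := by
      rw [Set.sdiff_inter_self_eq_sdiff]
    have hωF' : front (position S ω) (present N ω \ {ρ, σ}) K T = g := hωF
    change front (position S ω) (present N ω) K T = g
    rw [← hωF']
    ext n
    have hn : (n : ℕ) ≤ T := Nat.le_of_lt_succ n.2
    have e1 := hg.extend_front K hn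
    have e2 := (hg.mono (B := present N ω \ {ρ, σ}) Set.sdiff_subset).extend_front K hn
    have e3 := hg.frontCount_diff (B := {ρ, σ} ∩ present N ω) Set.inter_subset_right (K := K)
      (T := T) (by
        rintro τ ⟨rfl | rfl, -⟩
        exacts [hωρ, hωσ]) hn
    rw [← e] at e3
    simp only [extend, min_eq_left hn] at e1 e2
    exact e1.trans (e3.symm.trans e2.symm)
  rw [h2, h1] at h3
  calc P F = 4 * (P F * (1 / 2 * (1 / 2))) := by
        rw [one_div, ← ENNReal.mul_inv (by simp) (by simp), mul_comm (P F), ← mul_assoc,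
          show (2 : ℝ≥0∞) * 2 = 4 by norm_num, ENNReal.mul_inv_cancel (by simp) (by simp), one_mul]
    _ ≤ 4 * (P F * (P (staysAbove S K T ρ) * P (staysAbove S K T σ))) := by gcongr
    _ ≤ _ := by gcongr

lemma IsSystem.measurableSet_surviveVisit_algOn (h : IsSystem P D N S)
    {I : Set (ℕ+ ⊕ (ℕ+ × ℕ))} {ρ : ℕ+ × ℕ} (hρ : Sum.inr ρ ∈ I) (a : ℤ) (f : ℕ → ℕ) (n : ℕ)
    (z : ℤ) : MeasurableSet[algOn N S I] (surviveVisit (S ρ) a f n z) := by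
  have hreg := fun ω => (h.walk ρ).regularPath ω
  exact @measurableSet_surviveVisit Ω (algOn N S I) (S ρ)
    (fun t => measurable_S_algOn N S hρ t) hreg a f n z

lemma IsSystem.measurableSet_meet_algOn (h : IsSystem P D N S) (f : ℕ → ℕ) (T : ℕ)
    (ρ σ : ℕ+ × ℕ) : MeasurableSet[algOn N S (Sum.inr '' {ρ, σ})]
      {ω | meet f T (position S ω ρ) (position S ω σ)} := by
  rw [setOf_meet_eq]
  refine Finset.measurableSet_biUnion _ fun n _ => Finset.measurableSet_biUnion _ fun z _ => ?_
  exact (h.measurableSet_surviveVisit_algOn (by simp) _ f n z).inter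
    (h.measurableSet_surviveVisit_algOn (by simp) _ f n z)

lemma IsSystem.measurableSet_meetEvent (h : IsSystem P D N S) (K T : ℕ) (ρ σ : ℕ+ × ℕ) :
    MeasurableSet (meetEvent N S K T ρ σ) := by
  rw [meetEvent_eq]
  exact MeasurableSet.iUnion fun g => (h.algOn_le _ _ (h.measurableSet_front _ g)).inter
    (h.algOn_le _ _ (h.measurableSet_meet_algOn _ _ _ _))

lemma IsSystem.measure_meet_le (h : IsSystem P D N S) {ρ σ : ℕ+ × ℕ} (hρσ : ρ ≠ σ) (f : ℕ → ℕ)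
    (T : ℕ) : P {ω | meet f T (position S ω ρ) (position S ω σ)} ≤
      ∑ n ∈ Finset.range T, ∑ z ∈ Finset.Ioc (f n) (f (n + 1) + 1),
        P (surviveVisit (S ρ) ((ρ.1 : ℕ) : ℤ) f n z) *
          P (surviveVisit (S σ) ((σ.1 : ℕ) : ℤ) f n z) := by
  rw [setOf_meet_eq]
  refine (measure_biUnion_finset_le _ _).trans (Finset.sum_le_sum fun n _ => ?_)
  refine (measure_biUnion_finset_le _ _).trans (Finset.sum_le_sum fun z _ => ?_)
  rw [h.measure_inter (I := {Sum.inr ρ}) (J := {Sum.inr σ}) (by simpa using hρσ)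
    (h.measurableSet_surviveVisit_algOn (Set.mem_singleton _) _ f n z)
    (h.measurableSet_surviveVisit_algOn (Set.mem_singleton _) _ f n z)]

open scoped Classical in
lemma IsSystem.measure_meetEvent_le [IsProbabilityMeasure P] (h : IsSystem P D N S)
    {ρ σ : ℕ+ × ℕ} (hρσ : ρ ≠ σ) {K T : ℕ} (hρ : 1 / 2 ≤ P (staysAbove S K T ρ))
    (hσ : 1 / 2 ≤ P (staysAbove S K T σ)) :
    P (meetEvent N S K T ρ σ) ≤ ∑ g : Fin (T + 1) → Fin (K + 1),
      4 * P {ω | front (position S ω) (present N ω) K T = g} *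
        ∑ n ∈ Finset.range T, ∑ z ∈ Finset.Ioc (extend g n) (extend g (n + 1) + 1),
          P (surviveVisit (S ρ) ((ρ.1 : ℕ) : ℤ) (extend g) n z) *
            P (surviveVisit (S σ) ((σ.1 : ℕ) : ℤ) (extend g) n z) := by
  rw [meetEvent_eq, ← Set.biUnion_univ, ← Finset.coe_univ]
  refine (measure_biUnion_finset_le _ _).trans (Finset.sum_le_sum fun g _ => ?_)
  rw [h.measure_inter disjoint_compl_left (h.measurableSet_front _ g)
    (h.measurableSet_meet_algOn _ _ _ _)]
  exact mul_le_mul' (h.measure_front_diff_le hρσ hρ hσ g) (h.measure_meet_le hρσ _ T)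

/-- A bound for the expected number of pairs that meet. -/
lemma IsSystem.exists_sum_meetEvent_le [IsProbabilityMeasure P] (h : IsSystem P D N S)
    {δ : ℝ≥0∞} (hδ : 0 < δ) : ∃ L : ℕ, ∀ (G : Finset ℕ+) (K T : ℕ),
      (∀ i ∈ G, 1 / 2 ≤ P (staysAbove S K T (i, 0))) →
      ∑ p ∈ G.offDiag, P (meetEvent N S K T (p.1, 0) (p.2, 0)) ≤
        4 * ((∑' d : ℤ, visitBound D d) ^ 2 * (K + (L + L * K) : ℕ) +
          δ * (G.card * (4 / srwLaw D 1 {z | z ≤ -1}))) := by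
  classical
  obtain ⟨L, hL⟩ := exists_sum_sq_le (U := fun i : ℕ+ => S (i, 0))
    (a := fun i : ℕ+ => ((i : ℕ) : ℤ)) (fun i => h.walk _)
    (fun i j hij => PNat.coe_injective (Int.ofNat_injective hij)) (h.walk (1, 0)) h.rate_pos hδ
  refine ⟨L, fun G K T hG => ?_⟩
  set b := (∑' d : ℤ, visitBound D d) ^ 2 * (K + (L + L * K) : ℕ) +
    δ * (G.card * (4 / srwLaw D 1 {z | z ≤ -1}))
  set q : (Fin (T + 1) → Fin (K + 1)) → ℝ≥0∞ := fun g =>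
    P {ω | front (position S ω) (present N ω) K T = g}
  have hm : ∀ g : Fin (T + 1) → Fin (K + 1),
      MeasurableSet {ω | front (position S ω) (present N ω) K T = g} := by
    intro g
    have := h.algOn_le _ _ (h.measurableSet_front ∅ g)
    simpa using this
  set v : (Fin (T + 1) → Fin (K + 1)) → ℕ → ℕ → ℕ+ → ℝ≥0∞ := fun g n z i =>
    P (surviveVisit (S (i, 0)) ((i : ℕ) : ℤ) (extend g) n z)
  have hq : ∑ g, q g ≤ 1 := by
    have hd : Set.PairwiseDisjoint (Finset.univ : Finset (Fin (T + 1) → Fin (K + 1)))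
        fun g => {ω | front (position S ω) (present N ω) K T = g} := fun g _ g' _ hgg' =>
      Set.disjoint_left.2 fun ω h1 h2 => hgg' (Eq.trans (Eq.symm h1) h2)
    rw [← measure_biUnion_finset hd fun g _ => hm g]
    exact prob_le_one
  -- Adding the diagonal terms turns the sum over pairs into a square, as in `exists_sum_sq_le`.
  have hsq : ∀ (g : Fin (T + 1) → Fin (K + 1)) n z,
      ∑ p ∈ G.offDiag, v g n z p.1 * v g n z p.2 ≤ (∑ i ∈ G, v g n z i) ^ 2 := by
    intro g n z
    rw [sq, Finset.sum_mul_sum, ← Finset.sum_product']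
    exact Finset.sum_le_sum_of_subset fun p hp => by
      rw [Finset.mem_offDiag] at hp
      exact Finset.mem_product.2 ⟨hp.1, hp.2.1⟩
  -- The deterministic bound requires a monotone front; the other values of `g` are never taken.
  have hbound : ∀ g, q g * ∑ n ∈ Finset.range T,
      ∑ z ∈ Finset.Ioc (extend g n) (extend g (n + 1) + 1), (∑ i ∈ G, v g n z i) ^ 2 ≤ q g * b := by
    intro g
    by_cases hg : Monotone (extend g)
    · exact mul_le_mul' le_rfl (hL G (extend g) K T hg (extend_le g))
    · have : q g = 0 := by
        have he : {ω | front (position S ω) (present N ω) K T = g} = ∅ := by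
          refine Set.eq_empty_of_forall_notMem fun ω hω => hg ?_
          have hω' : front (position S ω) (present N ω) K T = g := hω
          rw [← hω']
          exact extend_front_mono _ _ _ _
        simp only [q, he, measure_empty]
      simp [this]
  calc ∑ p ∈ G.offDiag, P (meetEvent N S K T (p.1, 0) (p.2, 0))
      ≤ ∑ p ∈ G.offDiag, ∑ g : Fin (T + 1) → Fin (K + 1), 4 * q g * ∑ n ∈ Finset.range T,
          ∑ z ∈ Finset.Ioc (extend g n) (extend g (n + 1) + 1), v g n z p.1 * v g n z p.2 := by
        refine Finset.sum_le_sum fun p hp => ?_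
        rw [Finset.mem_offDiag] at hp
        exact h.measure_meetEvent_le (fun he => hp.2.2 (congrArg Prod.fst he)) (hG _ hp.1)
          (hG _ hp.2.1)
    _ = ∑ g : Fin (T + 1) → Fin (K + 1), 4 * q g * ∑ n ∈ Finset.range T,
          ∑ z ∈ Finset.Ioc (extend g n) (extend g (n + 1) + 1),
            ∑ p ∈ G.offDiag, v g n z p.1 * v g n z p.2 := by
        rw [Finset.sum_comm]
        refine Finset.sum_congr rfl fun g _ => ?_
        rw [← Finset.mul_sum, Finset.sum_comm]
        congr 1
        exact Finset.sum_congr rfl fun n _ => Finset.sum_comm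
    _ ≤ ∑ g : Fin (T + 1) → Fin (K + 1), 4 * (q g * b) := by
        refine Finset.sum_le_sum fun g _ => ?_
        rw [mul_assoc]
        refine mul_le_mul' le_rfl (le_trans ?_ (hbound g))
        gcongr with n _ z _
        exact hsq g n z
    _ = 4 * ((∑ g, q g) * b) := by rw [← Finset.mul_sum, Finset.sum_mul]
    _ ≤ 4 * b := by
        gcongr
        exact mul_le_of_le_one_left zero_le hq

end Pairs

/-! ### The lower bound -/

section LowerBound

variable {Ω : Type*} [mΩ : MeasurableSpace Ω] {P : Measure Ω} {D : ℝ≥0} {N : ℕ+ → Ω → ℕ}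
  {S : ℕ+ × ℕ → ℝ≥0 → Ω → ℤ}

/-- A particle that starts far away stays away with probability at least `1 / 2`. -/
lemma IsSystem.half_le_measure_staysAbove [IsProbabilityMeasure P] (h : IsSystem P D N S)
    {K T : ℕ} {i : ℕ+} {d : ℝ} (hd : 0 < d) (hi : (K : ℝ) + d ≤ (i : ℕ))
    (hT : 4 * (T * unitVariance D) ≤ d ^ 2) (j : ℕ) : 1 / 2 ≤ P (staysAbove S K T (i, j)) := by
  have hm := h.algOn_le _ _ (h.measurableSet_staysAbove K T (i, j))
  have hc : P (staysAbove S K T (i, j))ᶜ ≤ 1 / 2 := by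
    calc P (staysAbove S K T (i, j))ᶜ
        ≤ P {ω | ∃ u ≤ (T : ℝ≥0), S (i, j) u ω ≤ -(((i : ℕ) : ℤ) - K)} := by
          refine measure_mono fun ω hω => ?_
          simp only [staysAbove, position, Set.mem_compl_iff, Set.mem_ofPred_eq, not_forall,
            not_lt] at hω
          obtain ⟨u, hu, hx⟩ := hω
          exact ⟨u, hu, by omega⟩
      _ ≤ 2 * srwLaw D T {z | z ≤ -(((i : ℕ) : ℤ) - K)} := (h.walk _).measure_exists_le T _
      _ ≤ 2 * ENNReal.ofReal (T * unitVariance D / d ^ 2) := by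
          gcongr
          refine (measure_mono fun z hz => ?_).trans ((h.walk (i, j)).chebyshev T hd)
          have hz' : z ≤ -(((i : ℕ) : ℤ) - K) := hz
          have hz'' : (z : ℝ) ≤ -((i : ℕ) - K) := by exact_mod_cast hz'
          change d ≤ |(z : ℝ)|
          have := neg_le_abs (z : ℝ)
          linarith
      _ ≤ 2 * ENNReal.ofReal (1 / 4) := by
          refine mul_le_mul' le_rfl (ENNReal.ofReal_le_ofReal ?_)
          rw [div_le_iff₀ (by positivity)]
          linarith
      _ = 1 / 2 := by
          rw [show (2 : ℝ≥0∞) = ENNReal.ofReal 2 by simp, ← ENNReal.ofReal_mul zero_le_two,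
            ← ENNReal.ofReal_one, ← ENNReal.ofReal_div_of_pos two_pos]
          norm_num
  rw [prob_compl_eq_one_sub hm] at hc
  have h1 : (1 : ℝ≥0∞) - 1 / 2 ≤ 1 - (1 - P (staysAbove S K T (i, j))) := by gcongr
  rw [ENNReal.sub_sub_cancel ENNReal.one_ne_top prob_le_one] at h1
  simpa using h1

/-- The event that the first particle at `i` is present and gets to `0` at time `T`. -/
def reaches (N : ℕ+ → Ω → ℕ) (S : ℕ+ × ℕ → ℝ≥0 → Ω → ℤ) (T : ℕ) (i : ℕ+) : Set Ω :=
  {ω | (i, 0) ∈ present N ω} ∩ {ω | position S ω (i, 0) T ≤ 0}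

lemma measurableSet_position_le_algOn {Ω : Type*} (N : ℕ+ → Ω → ℕ)
    (S : ℕ+ × ℕ → ℝ≥0 → Ω → ℤ) (T : ℕ) (ρ : ℕ+ × ℕ) {I : Set (ℕ+ ⊕ (ℕ+ × ℕ))} (hρ : Sum.inr ρ ∈ I) :
    MeasurableSet[algOn N S I] {ω | position S ω ρ T ≤ 0} :=
  measurable_S_algOn N S hρ T (MeasurableSet.of_discrete (s := {z | ((ρ.1 : ℕ) : ℤ) + z ≤ 0}))

lemma IsSystem.measurableSet_reaches (h : IsSystem P D N S) (T : ℕ) (i : ℕ+) :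
    MeasurableSet[algOn N S {Sum.inl i, Sum.inr (i, 0)}] (reaches N S T i) :=
  (h.measurableSet_mem_present_algOn (by simp)).inter
    (measurableSet_position_le_algOn N S T (i, 0) (by simp))

lemma IsSystem.measure_reaches [IsProbabilityMeasure P] (h : IsSystem P D N S) (T : ℕ) (i : ℕ+) :
    P (reaches N S T i) = P {ω | 0 < N 1 ω} * srwLaw D T {z | z ≤ -((i : ℕ) : ℤ)} := by
  rw [reaches, h.measure_inter (I := {Sum.inl i}) (J := {Sum.inr (i, 0)}) (by simp)
    (h.measurableSet_mem_present_algOn (by simp))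
    (measurableSet_position_le_algOn N S T (i, 0) (by simp)), ← (h.walk (i, 0)).measure_eval]
  congr 1
  · exact (h.ident_N i 1).measure_mem_eq (s := {n | 0 < n}) MeasurableSet.of_discrete
  · congr 1
    ext ω
    simp only [position, Set.mem_ofPred_eq]
    omega

lemma IsSystem.measure_pos (h : IsSystem P D N S) : 0 < P {ω | 0 < N 1 ω} := by
  have h1 := (integral_pos_iff_support_of_nonneg (fun _ => sq_nonneg _) (h.sq_N 1)).1 (h.pos_N 1)
  refine h1.trans_le (measure_mono fun ω hω => ?_)
  have : (N 1 ω : ℝ) ^ 2 ≠ 0 := hω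
  change 0 < N 1 ω
  rw [pos_iff_ne_zero]
  rintro h0
  simp [h0] at this

lemma measurable_indicator_one {Ω : Type*} {m : MeasurableSpace Ω} {s : Set Ω}
    (hs : MeasurableSet s) : Measurable (s.indicator (1 : Ω → ℝ)) :=
  measurable_one.indicator hs

open scoped Classical in
/-- Many particles get to `0` with high probability. -/
lemma IsSystem.measure_card_reaches_lt [IsProbabilityMeasure P] (h : IsSystem P D N S) {T : ℕ}
    {G : Finset ℕ+} (hG : G.Nonempty) {q : ℝ} (hq : 0 < q)
    (hGq : ∀ i ∈ G, q ≤ P.real (reaches N S T i)) :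
    P {ω | ((G.filter fun i => ω ∈ reaches N S T i).card : ℝ) ≤ q * G.card / 2} ≤
      ENNReal.ofReal (4 / (q ^ 2 * G.card)) := by
  have hcard : (0 : ℝ) < G.card := by exact_mod_cast hG.card_pos
  have hm : ∀ i, MeasurableSet (reaches N S T i) := fun i =>
    h.algOn_le _ _ (h.measurableSet_reaches T i)
  set Y : ℕ+ → Ω → ℝ := fun i => (reaches N S T i).indicator 1
  have hY : ∀ i, MemLp (Y i) 2 P := fun i =>
    memLp_indicator_const 2 (hm i) (1 : ℝ) (Or.inr (measure_ne_top _ _))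
  have hind : Pairwise fun i j => IndepFun (Y i) (Y j) P := by
    intro i j hij
    have hd : Disjoint ({Sum.inl i, Sum.inr (i, 0)} : Set (ℕ+ ⊕ (ℕ+ × ℕ)))
        {Sum.inl j, Sum.inr (j, 0)} := by
      simp [hij.symm]
    have hc : ∀ i, MeasurableSpace.comap (Y i) inferInstance ≤
        algOn N S {Sum.inl i, Sum.inr (i, 0)} := by
      intro i
      have h1 := h.measurableSet_reaches T i
      have : Measurable[algOn N S {Sum.inl i, Sum.inr (i, 0)}] (Y i) :=
        measurable_indicator_one h1
      exact this.comap_le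
    exact indep_of_indep_of_le_left (indep_of_indep_of_le_right (h.indep hd) (hc j)) (hc i)
  have hint : ∀ i, ∫ ω, Y i ω ∂P = P.real (reaches N S T i) := fun i => integral_indicator_one (hm i)
  have hv : ∀ i, ∫ ω, Y i ω ^ 2 ∂P ≤ 1 := by
    intro i
    have : ∀ ω, Y i ω ^ 2 = Y i ω := fun ω => by
      simp only [Y, Set.indicator_apply]
      split_ifs <;> simp
    simp_rw [this]
    rw [hint]
    exact measureReal_le_one
  have hdev := measure_sum_deviation_le hY hind hv G (c := q * G.card / 2) (by positivity)
  refine (measure_mono fun ω hω => ?_).trans (hdev.trans_eq ?_)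
  · have h1 : ∑ i ∈ G, Y i ω = ((G.filter fun i => ω ∈ reaches N S T i).card : ℝ) := by
      rw [Finset.card_filter]
      push_cast
      exact Finset.sum_congr rfl fun i _ => by simp [Y, Set.indicator_apply]
    have h2 : q * G.card ≤ ∑ i ∈ G, ∫ ω, Y i ω ∂P := by
      rw [mul_comm, ← nsmul_eq_mul]
      exact Finset.card_nsmul_le_sum _ _ _ fun i hi => (hGq i hi).trans_eq (hint i).symm
    have h3 : ((G.filter fun i => ω ∈ reaches N S T i).card : ℝ) ≤ q * G.card / 2 := hω
    have h4 : q * G.card / 2 ≤ -(∑ i ∈ G, Y i ω - ∑ i ∈ G, ∫ ω, Y i ω ∂P) := by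
      rw [h1]
      linarith
    exact h4.trans (neg_le_abs _)
  · congr 1
    field_simp
    norm_num

open scoped Classical in
/-- If growth number `K + 1` is late, then few particles get to `0` or many pairs meet. -/
lemma IsSystem.ae_card_reaches_le [IsProbabilityMeasure P] (h : IsSystem P D N S) (K T : ℕ)
    (G : Finset ℕ+) : ∀ᵐ ω ∂P,
      (T : ℝ≥0∞) < growthTime (position S ω) (present N ω) (K + 1) →
      (G.filter fun i => ω ∈ reaches N S T i).card ≤
        K + (G.offDiag.filter fun p => ω ∈ meetEvent N S K T (p.1, 0) (p.2, 0)).card := by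
  filter_upwards [h.ae_good] with ω hg hK
  have hmem : ∀ i ∈ G.filter (fun i => ω ∈ reaches N S T i), i ∈ G ∧ ω ∈ reaches N S T i := by
    intro i hi
    rwa [Finset.mem_filter] at hi
  refine (hg.card_le_add_card_meet hK (fun i : ℕ+ => (i, 0)) _
    fun i hi => (hmem i hi).2).trans (Nat.add_le_add_left ?_ K)
  refine Finset.card_le_card fun p hp => ?_
  rw [Finset.mem_filter, Finset.mem_offDiag] at hp ⊢
  exact ⟨⟨(hmem _ hp.1.1).1, (hmem _ hp.1.2.1).1, hp.1.2.2⟩, hp.2⟩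

open scoped Classical in
lemma IsSystem.measure_card_meetEvent_ge (h : IsSystem P D N S) (K T : ℕ) (G : Finset ℕ+) {b : ℝ}
    (hb : 0 < b) :
    P {ω | b ≤ ((G.offDiag.filter fun p => ω ∈ meetEvent N S K T (p.1, 0) (p.2, 0)).card : ℝ)} ≤
      (∑ p ∈ G.offDiag, P (meetEvent N S K T (p.1, 0) (p.2, 0))) / ENNReal.ofReal b := by
  have hm := fun p : ℕ+ × ℕ+ => h.measurableSet_meetEvent K T (p.1, 0) (p.2, 0)
  have he : ∀ ω, (((G.offDiag.filter fun p => ω ∈ meetEvent N S K T (p.1, 0) (p.2, 0)).card : ℕ) :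
      ℝ≥0∞) = ∑ p ∈ G.offDiag,
        (meetEvent N S K T (p.1, 0) (p.2, 0)).indicator (1 : Ω → ℝ≥0∞) ω := by
    intro ω
    rw [Finset.card_filter]
    push_cast
    exact Finset.sum_congr rfl fun p _ => by simp [Set.indicator_apply]
  have hint : ∑ p ∈ G.offDiag, P (meetEvent N S K T (p.1, 0) (p.2, 0)) = ∫⁻ ω, ∑ p ∈ G.offDiag,
      (meetEvent N S K T (p.1, 0) (p.2, 0)).indicator (1 : Ω → ℝ≥0∞) ω ∂P := by
    rw [lintegral_finsetSum _ fun p _ => measurable_one.indicator (hm p)]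
    exact Finset.sum_congr rfl fun p _ => (lintegral_indicator_one (hm p)).symm
  rw [hint]
  refine (measure_mono fun ω hω => ?_).trans (meas_ge_le_lintegral_div
    (Finset.measurable_fun_sum _ fun p _ => measurable_one.indicator (hm p)).aemeasurable
    (ENNReal.ofReal_pos.2 hb).ne' ENNReal.ofReal_ne_top)
  change ENNReal.ofReal b ≤ _
  rw [← he, ← ENNReal.ofReal_natCast]
  exact ENNReal.ofReal_le_ofReal hω

/-- A bound for the probability that growth number `K + 1` is late, where the particles of `G`
start at suitable distances. -/
lemma IsSystem.exists_measure_late_le [IsProbabilityMeasure P] (h : IsSystem P D N S) :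
    ∃ C : ℝ, 0 < C ∧ ∀ δ : ℝ, 0 < δ → ∃ L : ℕ, ∀ (G : Finset ℕ+) (K T : ℕ) (q : ℝ), 0 < q →
      G.Nonempty → (∀ i ∈ G, q ≤ P.real (reaches N S T i)) → 4 * (K : ℝ) ≤ q * G.card →
      (∀ i ∈ G, 1 / 2 ≤ P (staysAbove S K T (i, 0))) →
      P {ω | (T : ℝ≥0∞) < growthTime (position S ω) (present N ω) (K + 1)} ≤
        ENNReal.ofReal (4 / (q ^ 2 * G.card) +
          C * ((K + (L + L * K) : ℕ) + δ * G.card) / (q * G.card)) := by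
  classical
  set V := ∑' d : ℤ, visitBound D d
  set s := srwLaw D 1 {z | z ≤ -1}
  have hV : V ≠ ⊤ := (h.walk (1, 0)).visitBound_summable
  have hs : s ≠ 0 := (srwLaw_le_neg_one_pos h.rate_pos one_pos).ne'
  obtain ⟨C, hC0, hC⟩ : ∃ C : ℝ, 0 < C ∧ V ^ 2 + 4 / s ≤ ENNReal.ofReal C := by
    have hne : V ^ 2 + 4 / s ≠ ⊤ := ENNReal.add_ne_top.2
      ⟨ENNReal.pow_ne_top hV, ENNReal.div_ne_top (by simp) hs⟩
    refine ⟨(V ^ 2 + 4 / s).toReal + 1, by positivity, ?_⟩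
    refine ENNReal.le_ofReal_iff_toReal_le hne (by positivity) |>.2 ?_
    linarith
  refine ⟨16 * C, by positivity, fun δ hδ => ?_⟩
  obtain ⟨L, hL⟩ := h.exists_sum_meetEvent_le (ENNReal.ofReal_pos.2 hδ)
  refine ⟨L, fun G K T q hq hG hGq hKq hstay => ?_⟩
  have hcard : (0 : ℝ) < G.card := by exact_mod_cast hG.card_pos
  have h1 := h.measure_card_reaches_lt hG hq hGq
  have h2 := h.measure_card_meetEvent_ge K T G (b := q * G.card / 4) (by positivity)
  have h3 : 4 * (V ^ 2 * ((K + (L + L * K) : ℕ) : ℝ≥0∞) + ENNReal.ofReal δ * (G.card * (4 / s))) ≤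
      ENNReal.ofReal (4 * C * ((K + (L + L * K) : ℕ) + δ * G.card)) := by
    calc _ ≤ 4 * (ENNReal.ofReal C * ((K + (L + L * K) : ℕ) : ℝ≥0∞) +
          ENNReal.ofReal δ * (G.card * ENNReal.ofReal C)) := by
          gcongr
          · exact le_self_add.trans hC
          · exact le_add_self.trans hC
      _ = _ := by
          rw [← ENNReal.ofReal_natCast, ← ENNReal.ofReal_natCast, ← ENNReal.ofReal_mul hC0.le,
            ← ENNReal.ofReal_mul (Nat.cast_nonneg _), ← ENNReal.ofReal_mul hδ.le,
            ← ENNReal.ofReal_add (by positivity) (by positivity), ← ENNReal.ofReal_ofNat 4,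
            ← ENNReal.ofReal_mul (by norm_num)]
          congr 1
          push_cast
          ring
  -- If more than `q * G.card / 2` particles reach `0`, then, as `K` is at most half of that number,
  -- at least `q * G.card / 4` pairs meet.
  calc P {ω | (T : ℝ≥0∞) < growthTime (position S ω) (present N ω) (K + 1)}
      ≤ P ({ω | ((G.filter fun i => ω ∈ reaches N S T i).card : ℝ) ≤ q * G.card / 2} ∪
          {ω | q * G.card / 4 ≤ ((G.offDiag.filter fun p =>
            ω ∈ meetEvent N S K T (p.1, 0) (p.2, 0)).card : ℝ)}) := by
        refine measure_mono_ae ?_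
        filter_upwards [h.ae_card_reaches_le K T G] with ω hω hlate
        have h4 := hω hlate
        by_cases h5 : ((G.filter fun i => ω ∈ reaches N S T i).card : ℝ) ≤ q * G.card / 2
        · exact Or.inl h5
        · refine Or.inr ?_
          have h6 : ((G.filter fun i => ω ∈ reaches N S T i).card : ℝ) ≤ K +
            ((G.offDiag.filter fun p => ω ∈ meetEvent N S K T (p.1, 0) (p.2, 0)).card : ℝ) := by
            exact_mod_cast h4
          change q * G.card / 4 ≤ ((G.offDiag.filter fun p =>
            ω ∈ meetEvent N S K T (p.1, 0) (p.2, 0)).card : ℝ)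
          linarith
    _ ≤ ENNReal.ofReal (4 / (q ^ 2 * G.card)) +
          ENNReal.ofReal (4 * C * ((K + (L + L * K) : ℕ) + δ * G.card)) /
            ENNReal.ofReal (q * G.card / 4) := by
        refine (measure_union_le _ _).trans (add_le_add h1 (h2.trans ?_))
        gcongr
        exact (hL G K T hstay).trans h3
    _ = _ := by
        rw [← ENNReal.ofReal_div_of_pos (by positivity),
          ← ENNReal.ofReal_add (by positivity) (by positivity)]
        congr 2
        field_simp
        norm_num

/-- At time `r ^ 2`, the aggregate has length at least a multiple of `r`, with high probability. -/
lemma IsSystem.exists_late_small [IsProbabilityMeasure P] (h : IsSystem P D N S) {ε : ℝ}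
    (hε : 0 < ε) : ∃ η : ℝ, 0 < η ∧ ∃ r₀ : ℕ, ∀ r : ℕ, r₀ ≤ r →
      P {ω | ((r ^ 2 : ℕ) : ℝ≥0∞) < growthTime (position S ω) (present N ω) (⌊η * r⌋₊ + 1)} ≤
        ENNReal.ofReal ε := by
  obtain ⟨C, hC, hlate⟩ := h.exists_measure_late_le
  -- `a` is so large that a particle starting beyond `a * r` stays above `a * r / 2` up to time `r ^
  -- 2` with probability at least `1 / 2`.
  obtain ⟨a, ha⟩ := exists_nat_ge (16 * unitVariance D + 1)
  have ha1 : (1 : ℝ) ≤ a := by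
    have := unitVariance_nonneg D
    linarith
  have ha0 : 0 < a := by exact_mod_cast zero_lt_one.trans_le ha1
  -- The starting sites go up to `2 * a * r`, that is, `2 * a` times the square root of the time `r
  -- ^ 2`.
  obtain ⟨c, hc0, hc⟩ := (h.walk (1, 0)).exists_lower_bound h.rate_pos (2 * a)
  have hc1 : c ≠ ⊤ := by
    obtain ⟨n, hn⟩ := hc.exists
    exact ne_top_of_le_ne_top (measure_ne_top _ _) hn
  set q : ℝ := P.real {ω | 0 < N 1 ω} * c.toReal
  have hq : 0 < q := mul_pos (ENNReal.toReal_pos h.measure_pos.ne' (measure_ne_top _ _))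
    (ENNReal.toReal_pos hc0.ne' hc1)
  -- This `δ` makes its term in the final bound exactly `ε / 4`. It is fixed before `η`, which
  -- depends on `L`.
  obtain ⟨L, hL⟩ := hlate (ε * q / (4 * C)) (by positivity)
  obtain ⟨n₀, hn₀⟩ := eventually_atTop.1 hc
  -- The three bounds give `K ≤ a * r / 2` (room to stay above `K`), `4 * K ≤ q * G.card`
  -- (pigeonhole), and a contribution of the moves of the front of at most `ε / 4`.
  set η : ℝ := min (min (a / 2) (q * a / 4)) (ε * (q * a) / (4 * C * (1 + L)))
  have hη : 0 < η := by positivity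
  obtain ⟨r₁, hr₁⟩ := exists_nat_ge (16 / (ε * (q ^ 2 * a)))
  obtain ⟨r₂, hr₂⟩ := exists_nat_ge (4 * C * L / (ε * (q * a)))
  refine ⟨η, hη, n₀ + r₁ + r₂ + 1, fun r hr => ?_⟩
  have hr0 : (0 : ℝ) < r := by
    have : 0 < r := by omega
    exact_mod_cast this
  set K := ⌊η * r⌋₊
  have hK : (K : ℝ) ≤ η * r := Nat.floor_le (by positivity)
  set b : ℕ+ := ⟨a * r, Nat.mul_pos ha0 (by omega)⟩
  have hb : (b : ℕ) = a * r := rfl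
  have hcard : (Finset.Ioc b (2 * b)).card = a * r := by
    rw [PNat.card_Ioc, PNat.mul_coe, hb]
    simp only [PNat.val_ofNat]
    omega
  have hcard' : ((Finset.Ioc b (2 * b)).card : ℝ) = a * r := by
    rw [hcard]
    push_cast
    rfl
  have hmem : ∀ i ∈ Finset.Ioc b (2 * b), (a * r : ℝ) ≤ (i : ℕ) ∧ (i : ℕ) ≤ 2 * (a * r) := by
    intro i hi
    rw [Finset.mem_Ioc] at hi
    have h1 : (b : ℕ) < i := PNat.coe_lt_coe _ _ |>.2 hi.1
    have h2 : (i : ℕ) ≤ (2 * b : ℕ+) := PNat.coe_le_coe _ _ |>.2 hi.2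
    rw [PNat.mul_coe, hb] at h2
    rw [hb] at h1
    exact ⟨by exact_mod_cast h1.le, h2⟩
  have key := hL (Finset.Ioc b (2 * b)) K (r ^ 2) q hq ?_ ?_ ?_ ?_
  · refine key.trans (ENNReal.ofReal_le_ofReal ?_)
    rw [hcard']
    have e1 : 4 / (q ^ 2 * (a * r)) ≤ ε / 4 := by
      have : 16 / (ε * (q ^ 2 * a)) ≤ r := hr₁.trans (Nat.cast_le.2 (by omega))
      rw [div_le_iff₀ (by positivity)] at this
      rw [div_le_iff₀ (by positivity)]
      linarith
    have e2 : C * L / (q * (a * r)) ≤ ε / 4 := by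
      have : 4 * C * L / (ε * (q * a)) ≤ r := hr₂.trans (Nat.cast_le.2 (by omega))
      rw [div_le_iff₀ (by positivity)] at this
      rw [div_le_iff₀ (by positivity)]
      linarith
    have e3 : C * ((1 + L) * K) / (q * (a * r)) ≤ ε / 4 := by
      have h1 : η ≤ ε * (q * a) / (4 * C * (1 + L)) := min_le_right _ _
      rw [le_div_iff₀ (by positivity)] at h1
      rw [div_le_iff₀ (by positivity)]
      have h2 : C * ((1 + L) * K) ≤ C * ((1 + L) * (η * r)) := by gcongr
      have h3 := mul_le_mul_of_nonneg_right h1 hr0.le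
      linarith
    have e4 : C * (ε * q / (4 * C) * (a * r)) / (q * (a * r)) = ε / 4 := by
      field_simp
    have e5 : C * ((K + (L + L * K) : ℕ) + ε * q / (4 * C) * (a * r)) / (q * (a * r)) =
        C * L / (q * (a * r)) + C * ((1 + L) * K) / (q * (a * r)) +
          C * (ε * q / (4 * C) * (a * r)) / (q * (a * r)) := by
      rw [← add_div, ← add_div]
      congr 1
      push_cast
      ring
    rw [e5, e4]
    linarith
  · rw [← Finset.card_pos, hcard]
    exact Nat.mul_pos ha0 (by omega)
  · intro i hi
    rw [measureReal_def, h.measure_reaches, ENNReal.toReal_mul]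
    refine mul_le_mul_of_nonneg_left ?_ ENNReal.toReal_nonneg
    refine ENNReal.toReal_mono (measure_ne_top _ _) ((hn₀ (r ^ 2) ?_).trans (measure_mono ?_))
    · nlinarith
    · intro z hz
      have hz' : (z : ℝ) ≤ -(2 * a * √((r ^ 2 : ℕ) : ℝ)) := hz
      rw [Nat.cast_pow, Real.sqrt_sq hr0.le] at hz'
      have h1 : ((i : ℕ) : ℝ) ≤ 2 * (a * r) := by exact_mod_cast (hmem i hi).2
      have h2 : (z : ℝ) ≤ -((i : ℕ) : ℝ) := by linarith
      change z ≤ -((i : ℕ) : ℤ)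
      exact_mod_cast h2
  · rw [hcard']
    have h1 : η ≤ q * a / 4 := (min_le_left _ _).trans (min_le_right _ _)
    have h2 := mul_le_mul_of_nonneg_right h1 hr0.le
    linarith
  · intro i hi
    refine h.half_le_measure_staysAbove (d := a * r / 2) (by positivity) ?_ ?_ 0
    · have h1 : η ≤ a / 2 := (min_le_left _ _).trans (min_le_left _ _)
      have h2 := mul_le_mul_of_nonneg_right h1 hr0.le
      have := (hmem i hi).1
      linarith
    · push_cast
      have h1 : 16 * unitVariance D ≤ a ^ 2 := by nlinarith
      have h2 := mul_le_mul_of_nonneg_right h1 (sq_nonneg (r : ℝ))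
      nlinarith

/-- If growth number `K + 1` has happened by time `t` and there is no explosion, then `R(t) > K`. -/
lemma lt_rightEnd {ι : Type*} {x : ι → ℝ≥0 → ℤ} {A : Set ι} {K k : ℕ} {t : ℝ≥0}
    (hK : growthTime x A (K + 1) ≤ t) (hk : (t : ℝ≥0∞) < growthTime x A k) :
    K < rightEnd x A t := by
  -- The bound `k` is essential, since `sSup` of an unbounded set of natural numbers is `0`.
  refine Nat.lt_of_succ_le (le_csSup ⟨k, fun m hm => ?_⟩ hK)
  by_contra! hlt
  exact absurd (hk.trans_le (growthTime_mono x A hlt.le)) (not_lt.2 hm)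

/-- The bound at squares `r ^ 2` extends to all `t` with `r = ⌊√t⌋`, as growth times up to `r ^ 2`
are also up to `t`. Since `√t < r + 1 ≤ 2 * r`, it is enough to halve `η`. -/
lemma IsSystem.exists_lower_bound_rightEnd [IsProbabilityMeasure P] (h : IsSystem P D N S) {ε : ℝ}
    (hε : 0 < ε) : ∃ η : ℝ, 0 < η ∧ ∃ t₀ : ℝ≥0, ∀ t : ℝ≥0, t₀ ≤ t →
      1 - ε ≤ P.real {ω | η < (R N S ω t : ℝ) / √(t : ℝ)} := by
  obtain ⟨η, hη, r₀, hr₀⟩ := h.exists_late_small hε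
  refine ⟨η / 2, by positivity, ((r₀ + 1 : ℕ) : ℝ≥0) ^ 2, fun t ht => ?_⟩
  have ht' : ((r₀ + 1 : ℕ) : ℝ) ≤ √(t : ℝ) := by
    refine Real.le_sqrt_of_sq_le ?_
    exact_mod_cast ht
  set r := ⌊√(t : ℝ)⌋₊
  have hr : r₀ + 1 ≤ r := Nat.le_floor ht'
  have h1 : (r : ℝ) ≤ √(t : ℝ) := Nat.floor_le (Real.sqrt_nonneg _)
  have h2 : √(t : ℝ) < r + 1 := Nat.lt_floor_add_one _
  have hrt : ((r ^ 2 : ℕ) : ℝ≥0) ≤ t := by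
    have : (r : ℝ) ^ 2 ≤ t := by
      rw [← Real.sq_sqrt (NNReal.coe_nonneg t)]
      exact pow_le_pow_left₀ (Nat.cast_nonneg _) h1 2
    rw [← NNReal.coe_le_coe]
    push_cast
    exact this
  have hr1 : (1 : ℝ) ≤ r := by exact_mod_cast (by omega : 1 ≤ r)
  obtain ⟨T, hT⟩ := exists_nat_ge_nnreal t
  set A : Set Ω := {ω | η / 2 < (R N S ω t : ℝ) / √(t : ℝ)}
  have hA : P Aᶜ ≤ ENNReal.ofReal ε := by
    refine (measure_mono_ae ?_).trans (hr₀ r (by omega))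
    filter_upwards [h.ae_exists_lt_growthTime T] with ω hω hωA
    obtain ⟨k, hk⟩ := hω
    change ((r ^ 2 : ℕ) : ℝ≥0∞) < growthTime (position S ω) (present N ω) (⌊η * r⌋₊ + 1)
    by_contra! hle
    refine hωA ?_
    have h3 : ⌊η * r⌋₊ < R N S ω t := by
      refine lt_rightEnd (hle.trans ?_) ((ENNReal.coe_le_coe.2 hT).trans_lt hk)
      exact_mod_cast hrt
    have h4 : η * r < R N S ω t := (Nat.floor_lt (by positivity)).1 h3
    change η / 2 < (R N S ω t : ℝ) / √(t : ℝ)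
    rw [lt_div_iff₀ (by linarith)]
    nlinarith
  have hAr : P.real Aᶜ ≤ ε := ENNReal.toReal_le_of_le_ofReal hε.le hA
  have hunion : P.real (A ∪ Aᶜ) ≤ P.real A + P.real Aᶜ := measureReal_union_le _ _
  rw [Set.union_compl_self, probReal_univ] at hunion
  linarith

end LowerBound

end DLA

end

theorem theorem3 {Ω : Type*} [MeasurableSpace Ω] (P : Measure Ω) [IsProbabilityMeasure P]
    (D : ℝ≥0) (hD : 0 < D)
    (N : ℕ+ → Ω → ℕ) (S : ℕ+ × ℕ → ℝ≥0 → Ω → ℤ)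
    -- the numbers of particles at time `0` are i.i.d. with a finite positive second moment
    (hN_meas : ∀ i, Measurable (N i))
    (hN_indep : iIndepFun N P)
    (hN_ident : ∀ i j, IdentDistrib (N i) (N j) P P)
    (hN_sq : ∀ i, Integrable (fun ω => (N i ω : ℝ) ^ 2) P)
    (hN_pos : ∀ i, 0 < ∫ ω, (N i ω : ℝ) ^ 2 ∂P)
    -- the displacements are independent random walks, independent of these numbers
    (hS_walk : ∀ ρ, DLA.IsSimpleRandomWalk P D (S ρ))
    (hS_indep : iIndepFun (fun (ρ : ℕ+ × ℕ) (ω : Ω) (t : ℝ≥0) => S ρ t ω) P)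
    (hNS_indep : IndepFun (fun (ω : Ω) (i : ℕ+) => N i ω)
      (fun (ω : Ω) (ρ : ℕ+ × ℕ) (t : ℝ≥0) => S ρ t ω) P) :
    ∀ ε : ℝ, 0 < ε → ∃ η : ℝ, 0 < η ∧ ∃ t₀ : ℝ≥0, ∀ t : ℝ≥0, t₀ ≤ t →
      1 - ε ≤ P.real {ω | η < (DLA.R N S ω t : ℝ) / √(t : ℝ)} := by
  have h : DLA.IsSystem P D N S :=
    ⟨hD, hN_meas, hN_indep, hN_ident, hN_sq, hN_pos, hS_walk, hS_indep, hNS_indep⟩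
  exact fun ε hε => h.exists_lower_bound_rightEnd hε
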